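/- Let $p,q\ge 0$ with $p+q=1$ and $q\neq0$, and put $\tau=p/q$ (with $0^0=1$). Consider the $N$-particle asymmetric simple exclusion process on $\mathbb Z$: each particle carries an independent exponential clock of rate one; when it rings, the particle attempts, with probability $p$, a step to the right and, with probability $q$, a step to the left, and the step is made if and only if the target site is unoccupied. Let $Y=\{y_1<\dots<y_N\}$ be the initial configuration, $x_1(t)<\dots<x_N(t)$ the particle positions at time $t\ge0$, and $\mathbb P_Y$ the corresponding probability. Put $$f(\xi,\xi')=p+q\xi\xi'-\xi,\qquad \varepsilon(\xi)=p\,\xi^{-1}+q\,\xi-1,$$ and, for $U,V\subset\{1,\dots,N\}$, $\sigma(U,V)=\#\{(i,j): i\in U,\ j\in V,\ i\ge j\}$ and $\sigma(U)=\sigma(U,\{1,\dots,N\})$. Let $\mathcal C_R$ be the circle of radius $R$ around $0$, where $R$ is so large that $R>1$ and $f(\xi,\xi')\ne0$ whenever $|\xi|,|\xi'|\ge R$ (all sufficiently large $R$ are admissible, with a bound depending only on $q$); every contour integral carries a factor $1/2\pi i$. Let $1\le n\le m\le N$ and let $x_n<x_{n+1}<\dots<x_m$ be integers. Then $$\mathbb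 P_Y(x_i(t)=x_i,\ i=n,\dots,m)=\sum_{S,\,S_1,\,\Lambda_2}(-1)^{\sigma(S\cup S_1,\Lambda_2)+n-1+(m-n)k}\ \mathrm{sgn}\,\Lambda_2\ \tau^{\sigma(S\cup S_1\cup\Lambda_2)-m(m-1)/2-mk}\,q^{k(k-1)/2+(n-1)(n-2)/2}$$ $$\times\int_{\mathcal C_R}\!\!\cdots\int_{\mathcal C_R}\frac{\prod_{i\in S_1,\,j\in S\cup\Lambda_2}f(\xi_i,\xi_j)\ \prod_{i\in\Lambda_2,\,j\in S}f(\xi_i,\xi_j)\ \prod_{n\le i<j<m}f(\xi_{\ell_i},\xi_{\ell_j})}{\prod_{i<j}f(\xi_i,\xi_j)}$$ $$\times\Big(1-\prod_{j\in S}\xi_j\Big)\ \frac{\prod_{i<j;\ i,j\in S\cup S_1}(\xi_j-\xi_i)}{\prod_{j\in S\cup S_1}(1-\xi_j)}\ \frac1{\prod_{i\in S_1,\,j\in S}(\xi_j-\xi_i)}$$ $$\times\prod_{i\in S_1}\xi_i^{x_n}\ \prod_{n\le i<m}\xi_{\ell_i}^{x_i}\ \prod_{j\in S}\xi_j^{x_m}\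 \prod_i\xi_i^{-y_i-1}\ e^{\sum_i\varepsilon(\xi_i)t}\ \prod_i d\xi_i .$$ The summation is over all disjoint sets $S,S_1\subset\{1,\dots,N\}$ with $|S_1|=n-1$ and all $(m-n)$-tuples $\Lambda_2=(\ell_n,\dots,\ell_{m-1})$ of distinct elements of $\{1,\dots,N\}\setminus(S\cup S_1)$. Here $k=|S|$, $\mathrm{sgn}\,\Lambda_2$ is $-1$ to the number of inversions of $\Lambda_2$, $\Lambda_2$ also denotes the set of its entries, and in the integrand indices whose range is not specified run over $S\cup S_1\cup\Lambda_2$. (The factors $\xi_j-\xi_i$ in the denominator cancel against those in the numerator.) -/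

import Mathlib

open MeasureTheory ProbabilityTheory Finset
open scoped NNReal ENNReal BigOperators

noncomputable section

namespace ASEP

/-! ### The `N`-particle asymmetric simple exclusion process -/

/-- Configurations of `N` particles on `ℤ`: the particle positions, in increasing order.
The particle with label `i ∈ {1, …, N}` has the index `i - 1 : Fin N`. -/
abbrev Config (N : ℕ) := {X : Fin N → ℤ // StrictMono X}

variable {N : ℕ}

/-- A move of one particle by one step to an unoccupied site preserves the order. -/
theorem strictMono_update (X : Config N) (i : Fin N) (d : ℤˣ)
    (h : ∀ j, X.1 j ≠ X.1 i + d) : StrictMono (Function.update X.1 i (X.1 i + d)) := by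
  have hd : (d : ℤ) = 1 ∨ (d : ℤ) = -1 := by
    rcases Int.units_eq_one_or d with rfl | rfl <;> simp
  intro a b hab
  have hX := X.2 hab
  have ha := h a
  have hb := h b
  simp only [Function.update_apply]
  split_ifs with h1 h2 h2
  · exact absurd (h1.trans h2.symm) hab.ne
  · subst h1; omega
  · subst h2; omega
  · exact hX

open Classical in
/-- The particle with index `i` attempts a step `d = ±1`: it jumps if the target site is
unoccupied, and stays put otherwise. -/
def jump (X : Config N) (i : Fin N) (d : ℤˣ) : Config N :=
  if h : ∀ j, X.1 j ≠ X.1 i + d then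
    ⟨Function.update X.1 i (X.1 i + d), strictMono_update X i d h⟩
  else X

/-- The law of the configuration after one clock has rung in the configuration `X`: the ringing
particle is uniformly distributed, and it attempts a step to the right with probability `p` and
a step to the left with probability `q`. -/
def ringLaw (p q : ℝ) (X : Config N) : Measure (Config N) :=
  ∑ i : Fin N, (ENNReal.ofReal (p / N) • Measure.dirac (jump X i 1) +
    ENNReal.ofReal (q / N) • Measure.dirac (jump X i (-1)))

/-- The law of the configuration after `k` rings, started from `Y`. -/
def chainLaw (p q : ℝ) (Y : Config N) : ℕ → Measure (Config N)
  | 0 => Measure.dirac Y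
  | k + 1 => (chainLaw p q Y k).bind (ringLaw p q)

/-- The law at time `t` of the ASEP started from `Y`. The particles carry independent exponential
clocks of rate one, so that the number of rings up to time `t` is Poisson with mean `N t` and is
independent of the successive choices of the ringing particle and of the direction. -/
def law (p q : ℝ) (Y : Config N) (t : ℝ≥0) : Measure (Config N) :=
  (poissonMeasure (N * t)).bind (chainLaw p q Y)

/-- The generator of the ASEP: each particle jumps to the right at rate `p` and to the left at
rate `q` whenever the target site is unoccupied (`jump X i d = X` otherwise). -/
def generator (p q : ℝ) (g : Config N → ℝ) (X : Config N) : ℝ :=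
  ∑ i : Fin N, (p * (g (jump X i 1) - g X) + q * (g (jump X i (-1)) - g X))

/-! #### The laws are probability measures, start at `Y` and satisfy Kolmogorov's equation -/

theorem isProb_ringLaw {p q : ℝ} (hp : 0 ≤ p) (hq : 0 ≤ q) (hpq : p + q = 1) [NeZero N]
    (X : Config N) : IsProbabilityMeasure (ringLaw p q X) := by
  have hN : (0 : ℝ) < N := by exact_mod_cast Nat.pos_of_ne_zero (NeZero.ne N)
  constructor
  simp only [ringLaw, Measure.coe_finsetSum, Finset.sum_apply, Measure.add_apply,
    Measure.smul_apply, measure_univ, smul_eq_mul, mul_one, Finset.sum_const, card_univ,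
    Fintype.card_fin]
  rw [← ENNReal.ofReal_add (by positivity) (by positivity), ← ENNReal.ofReal_nsmul, ← add_div, hpq]
  simp [hN.ne']

theorem isProb_chainLaw {p q : ℝ} (hp : 0 ≤ p) (hq : 0 ≤ q) (hpq : p + q = 1) [NeZero N]
    (Y : Config N) (k : ℕ) : IsProbabilityMeasure (chainLaw p q Y k) := by
  induction k with
  | zero => rw [chainLaw]; infer_instance
  | succ k ih =>
    rw [chainLaw]
    exact isProbabilityMeasure_bind Measurable.of_discrete.aemeasurable
      (Filter.Eventually.of_forall fun X => isProb_ringLaw hp hq hpq X)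

/-- The law at time `t` is a probability measure. -/
theorem isProb_law {p q : ℝ} (hp : 0 ≤ p) (hq : 0 ≤ q) (hpq : p + q = 1) [NeZero N]
    (Y : Config N) (t : ℝ≥0) : IsProbabilityMeasure (law p q Y t) :=
  isProbabilityMeasure_bind Measurable.of_discrete.aemeasurable
    (Filter.Eventually.of_forall fun k => isProb_chainLaw hp hq hpq Y k)

theorem integral_bind_of_bounded {α β : Type*} [MeasurableSpace α] [MeasurableSpace β]
    [DiscreteMeasurableSpace α] [DiscreteMeasurableSpace β] (μ : Measure α)
    [IsProbabilityMeasure μ] (κ : α → Measure β) (hκ : ∀ a, IsProbabilityMeasure (κ a))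
    (g : β → ℝ) (C : ℝ) (hg : ∀ b, |g b| ≤ C) :
    ∫ b, g b ∂(μ.bind κ) = ∫ a, ∫ b, g b ∂(κ a) ∂μ := by
  let K : Kernel α β := ⟨κ, Measurable.of_discrete⟩
  have : IsMarkovKernel K := ⟨hκ⟩
  have : IsProbabilityMeasure (μ.bind K) := inferInstance
  have hi : Integrable g (μ.bind K) :=
    Integrable.of_bound (Measurable.of_discrete.aestronglyMeasurable) C
      (Filter.Eventually.of_forall hg)
  change ∫ b, g b ∂(μ.bind K) = ∫ a, ∫ b, g b ∂(K a) ∂μ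
  rw [Measure.comp_eq_comp_const_apply] at hi ⊢
  rw [Kernel.integral_comp hi, Kernel.const_apply]

theorem integral_ringLaw {p q : ℝ} (hp : 0 ≤ p) (hq : 0 ≤ q) (hpq : p + q = 1) [NeZero N]
    (g : Config N → ℝ) (X : Config N) :
    N * (∫ Z, g Z ∂(ringLaw p q X) - g X) = generator p q g X := by
  have hN : (N : ℝ) ≠ 0 := by exact_mod_cast NeZero.ne N
  have hd : ∀ (c : ℝ≥0∞) (Z : Config N), c ≠ ∞ → Integrable g (c • Measure.dirac Z) :=
    fun c Z hc => (integrable_dirac (by simp)).smul_measure hc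
  have h1 : ∫ Z, g Z ∂(ringLaw p q X) =
      ∑ i : Fin N, (p / N * g (jump X i 1) + q / N * g (jump X i (-1))) := by
    rw [ringLaw, integral_finsetSum_measure]
    · refine Finset.sum_congr rfl fun i _ => ?_
      rw [integral_add_measure (hd _ _ ENNReal.ofReal_ne_top) (hd _ _ ENNReal.ofReal_ne_top),
        integral_smul_measure, integral_smul_measure, integral_dirac, integral_dirac,
        ENNReal.toReal_ofReal (by positivity), ENNReal.toReal_ofReal (by positivity)]
      simp
    · exact fun i _ => (hd _ _ ENNReal.ofReal_ne_top).add_measure (hd _ _ ENNReal.ofReal_ne_top)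
  have h2 : (N : ℝ) * g X = ∑ i : Fin N, (p * g X + q * g X) := by
    rw [Finset.sum_const, card_univ, Fintype.card_fin, nsmul_eq_mul, ← add_mul, hpq, one_mul]
  rw [mul_sub, h2, h1, Finset.mul_sum, ← Finset.sum_sub_distrib, generator]
  refine Finset.sum_congr rfl fun i _ => ?_
  field_simp
  ring

theorem integral_law {p q : ℝ} (hp : 0 ≤ p) (hq : 0 ≤ q) (hpq : p + q = 1) [NeZero N]
    (Y : Config N) (g : Config N → ℝ) (C : ℝ) (hg : ∀ X, |g X| ≤ C) (t : ℝ≥0) :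
    ∫ X, g X ∂(law p q Y t) = Real.exp (-(N * t)) *
      ∑' k : ℕ, (∫ X, g X ∂(chainLaw p q Y k)) * ((N * t : ℝ) ^ k / k.factorial) := by
  have hb : ∀ k, |∫ X, g X ∂(chainLaw p q Y k)| ≤ C := fun k => by
    have := isProb_chainLaw hp hq hpq Y k
    simpa using norm_integral_le_of_norm_le_const (μ := chainLaw p q Y k) (f := g)
      (C := C) (Filter.Eventually.of_forall hg)
  rw [law, integral_bind_of_bounded _ _ (isProb_chainLaw hp hq hpq Y) g C hg,
    integral_poissonMeasure' (Integrable.of_bound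
      Measurable.of_discrete.aestronglyMeasurable C (Filter.Eventually.of_forall hb)),
    ← tsum_mul_left]
  refine tsum_congr fun k => ?_
  push_cast
  rw [smul_eq_mul]
  ring

theorem summable_expGen (b : ℕ → ℝ) (C : ℝ) (hb : ∀ k, |b k| ≤ C) (s : ℝ) :
    Summable fun k : ℕ => b k * (s ^ k / k.factorial) := by
  refine Summable.of_norm_bounded ((Real.summable_pow_div_factorial |s|).mul_left C) fun k => ?_
  rw [norm_mul, norm_div, norm_pow, Real.norm_eq_abs, Real.norm_eq_abs, Real.norm_natCast]
  exact mul_le_mul_of_nonneg_right (hb k) (by positivity)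

theorem hasDerivAt_expGen (b : ℕ → ℝ) (C : ℝ) (hb : ∀ k, |b k| ≤ C) (s : ℝ) :
    HasDerivAt (fun s => ∑' k : ℕ, b k * (s ^ k / k.factorial))
      (∑' k : ℕ, b (k + 1) * (s ^ k / k.factorial)) s := by
  have hs : ∀ s, ∑' k : ℕ, b k * (s ^ k / k.factorial) =
      b 0 + ∑' k : ℕ, b (k + 1) * (s ^ (k + 1) / (k + 1).factorial) := fun s => by
    rw [(summable_expGen b C hb s).tsum_eq_zero_add]
    simp
  rw [funext hs]
  refine HasDerivAt.const_add _ ?_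
  have hs0 : s ∈ Metric.ball (0 : ℝ) (|s| + 1) := by simp
  have hC : 0 ≤ C := (abs_nonneg _).trans (hb 0)
  refine hasDerivAt_tsum_of_isPreconnected
    (g := fun (k : ℕ) (s : ℝ) => b (k + 1) * (s ^ (k + 1) / (k + 1).factorial))
    (g' := fun (k : ℕ) (s : ℝ) => b (k + 1) * (s ^ k / k.factorial))
    (u := fun k : ℕ => C * ((|s| + 1) ^ k / k.factorial))
    ((Real.summable_pow_div_factorial (|s| + 1)).mul_left C) Metric.isOpen_ball
    (convex_ball (0 : ℝ) (|s| + 1)).isPreconnected (fun k y _ => ?_) (fun k y hy => ?_) hs0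
    ((summable_nat_add_iff (f := fun k : ℕ => b k * (s ^ k / k.factorial)) 1).2
      (summable_expGen b C hb s)) hs0
  · have h := ((hasDerivAt_pow (k + 1) y).div_const ((k + 1).factorial : ℝ)).const_mul (b (k + 1))
    refine h.congr_deriv ?_
    rw [Nat.factorial_succ]
    push_cast
    have : (k.factorial : ℝ) ≠ 0 := by positivity
    have : (k : ℝ) + 1 ≠ 0 := by positivity
    field_simp
  · have hy' : |y| ≤ |s| + 1 := by simpa using (mem_ball_zero_iff.1 hy).le
    rw [norm_mul, norm_div, norm_pow, Real.norm_eq_abs, Real.norm_eq_abs, Real.norm_natCast]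
    gcongr
    exact hb _

/-- Kolmogorov's forward equation: the laws of the ASEP are governed by its generator. -/
theorem hasDerivWithinAt_integral_law {p q : ℝ} (hp : 0 ≤ p) (hq : 0 ≤ q) (hpq : p + q = 1)
    [NeZero N] (Y : Config N) (g : Config N → ℝ) (C : ℝ) (hg : ∀ X, |g X| ≤ C) (t : ℝ≥0) :
    HasDerivWithinAt (fun s : ℝ => ∫ X, g X ∂(law p q Y s.toNNReal))
      (∫ X, generator p q g X ∂(law p q Y t)) (Set.Ici 0) t := by
  set b : ℕ → ℝ := fun k => ∫ X, g X ∂(chainLaw p q Y k) with hbdef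
  have hb : ∀ k, |b k| ≤ C := fun k => by
    have := isProb_chainLaw hp hq hpq Y k
    simpa using norm_integral_le_of_norm_le_const (μ := chainLaw p q Y k) (f := g)
      (C := C) (Filter.Eventually.of_forall hg)
  have hK : ∀ X, |∫ Z, g Z ∂(ringLaw p q X)| ≤ C := fun X => by
    have := isProb_ringLaw hp hq hpq X
    simpa using norm_integral_le_of_norm_le_const (μ := ringLaw p q X) (f := g)
      (C := C) (Filter.Eventually.of_forall hg)
  have hgen : ∀ X, |generator p q g X| ≤ N * (C + C) := fun X => by
    rw [← integral_ringLaw hp hq hpq g X, abs_mul, Nat.abs_cast]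
    gcongr
    exact (abs_sub _ _).trans (add_le_add (hK X) (hg X))
  have hbs : ∀ k, ∫ X, generator p q g X ∂(chainLaw p q Y k) = N * (b (k + 1) - b k) := by
    intro k
    have := isProb_chainLaw hp hq hpq Y k
    simp_rw [← integral_ringLaw hp hq hpq g]
    rw [integral_const_mul, integral_sub
      (Integrable.of_bound Measurable.of_discrete.aestronglyMeasurable C
        (Filter.Eventually.of_forall hK))
      (Integrable.of_bound Measurable.of_discrete.aestronglyMeasurable C
        (Filter.Eventually.of_forall hg))]
    simp only [hbdef]
    rw [chainLaw, integral_bind_of_bounded _ _ (isProb_ringLaw hp hq hpq) g C hg]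
  rw [integral_law hp hq hpq Y _ _ hgen]
  simp_rw [hbs]
  have hder : HasDerivAt (fun s : ℝ => Real.exp (-(N * s)) *
      ∑' k : ℕ, b k * ((N * s : ℝ) ^ k / k.factorial)) (Real.exp (-(N * t)) *
      ∑' k : ℕ, N * (b (k + 1) - b k) * ((N * t : ℝ) ^ k / k.factorial)) t := by
    have hl : HasDerivAt (fun s : ℝ => (N : ℝ) * s) N (t : ℝ) := by
      simpa using (hasDerivAt_id (t : ℝ)).const_mul (N : ℝ)
    have h1 := hl.neg.exp
    have h2 := (hasDerivAt_expGen b C hb (N * t)).comp (t : ℝ) hl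
    refine (h1.mul h2).congr_deriv ?_
    have h3 : ∑' k : ℕ, N * (b (k + 1) - b k) * ((N * t : ℝ) ^ k / k.factorial) =
        N * (∑' k : ℕ, b (k + 1) * ((N * t : ℝ) ^ k / k.factorial) -
          ∑' k : ℕ, b k * ((N * t : ℝ) ^ k / k.factorial)) := by
      rw [← (summable_expGen (fun k => b (k + 1)) C (fun k => hb _) _).tsum_sub
        (summable_expGen b C hb _), ← tsum_mul_left]
      exact tsum_congr fun k => by ring
    rw [h3]
    simp only [Pi.neg_apply, Function.comp_apply]
    ring
  refine hder.hasDerivWithinAt.congr (fun s hs => ?_) ?_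
  · rw [integral_law hp hq hpq Y g C hg, Real.coe_toNNReal s hs]
  · rw [integral_law hp hq hpq Y g C hg, Real.toNNReal_coe]

/-- The process starts from `Y`. -/
theorem law_zero (p q : ℝ) (Y : Config N) : law p q Y 0 = Measure.dirac Y := by
  have h : poissonMeasure 0 = Measure.dirac 0 := by
    refine Measure.ext_of_singleton fun k => ?_
    rw [poissonMeasure_singleton]
    rcases k with _ | k <;> simp
  rw [law, mul_zero, h, Measure.dirac_bind Measurable.of_discrete]
  rfl

/-! ### The integral formula -/

/-- `f(ξ, ξ') = p + q ξ ξ' - ξ`. -/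
def f (p q : ℝ) (ξ ξ' : ℂ) : ℂ := p + q * ξ * ξ' - ξ

/-- `ε(ξ) = p ξ⁻¹ + q ξ - 1`. -/
def ε (p q : ℝ) (ξ : ℂ) : ℂ := p * ξ⁻¹ + q * ξ - 1

/-- `σ(U, V) = #{(i, j) : i ∈ U, j ∈ V, i ≥ j}`. -/
def σ (U V : Finset (Fin N)) : ℕ := #{a ∈ U ×ˢ V | a.2 ≤ a.1}

/-- The sign of a tuple: `-1` to the number of its inversions. -/
def sgn {r : ℕ} (l : Fin r → Fin N) : ℤ :=
  (-1) ^ #{a : Fin r × Fin r | a.1 < a.2 ∧ l a.2 < l a.1}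

/-- The radius `R` is so large that the zeros of the denominators `1 - ξ` and `f(ξ, ξ')` lie
inside the circle of radius `R` around zero. -/
def IsLargeRadius (p q R : ℝ) : Prop :=
  1 < R ∧ ∀ ξ ξ' : ℂ, R ≤ ‖ξ‖ → R ≤ ‖ξ'‖ → f p q ξ ξ' ≠ 0

/-- All sufficiently large radii are large, with a bound that depends on `q` only. -/
theorem isLargeRadius_of_le {p q R : ℝ} (hp : 0 ≤ p) (hq : 0 < q) (hpq : p + q = 1)
    (hR : 1 < R) (hR' : 2 / q ≤ R) : IsLargeRadius p q R := by
  refine ⟨hR, fun ξ ξ' h h' h0 => ?_⟩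
  have h1 : ξ * (q * ξ' - 1) = -p := by
    unfold f at h0
    linear_combination h0
  have h2 : ‖ξ‖ * ‖(q : ℂ) * ξ' - 1‖ = p := by
    rw [← norm_mul, h1, norm_neg, Complex.norm_real, Real.norm_of_nonneg hp]
  have h3 : q * ‖ξ'‖ - 1 ≤ ‖(q : ℂ) * ξ' - 1‖ := by
    have := norm_sub_norm_le ((q : ℂ) * ξ') 1
    rwa [norm_mul, Complex.norm_real, Real.norm_of_nonneg hq.le, norm_one] at this
  have h4 : 2 ≤ q * ‖ξ'‖ := by
    rw [div_le_iff₀ hq] at hR'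
    nlinarith
  nlinarith

/-- The integral of `F` with respect to the variables `ξ i`, `i ∈ U`, each over the circle of
radius `R` around zero with the factor `1 / (2 π i)`. The function `F` must not depend on the
variables `ξ i`, `i ∉ U` (which are given the value `0`). -/
def contourIntegral (U : Finset (Fin N)) (R : ℝ) (F : (Fin N → ℂ) → ℂ) : ℂ :=
  (2 * Real.pi * Complex.I)⁻¹ ^ #U *
    ∯ z in T(0, fun _ : Fin #U => R),
      F fun i => if h : i ∈ U then z ((U.orderIsoOfFin rfl).symm ⟨i, h⟩) else 0

/-- The indices `S ∪ S₁ ∪ Λ` that occur in one integral. -/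
def indices {r : ℕ} (S S₁ : Finset (Fin N)) (l : Fin r ↪ Fin N) : Finset (Fin N) :=
  S ∪ S₁ ∪ univ.map l

/-- The integrand. The tuple `Λ = (ℓ_n, …, ℓ_{m-1})` is given by `l a = ℓ_{n+a}`. -/
def integrand (p q : ℝ) (Y : Config N) (n m : ℕ) (x : ℕ → ℤ) (t : ℝ)
    (S S₁ : Finset (Fin N)) (l : Fin (m - n) ↪ Fin N) (ξ : Fin N → ℂ) : ℂ :=
  let Λ := univ.map l
  let U := indices S S₁ l
  ((∏ i ∈ S₁, ∏ j ∈ S ∪ Λ, f p q (ξ i) (ξ j)) * (∏ i ∈ Λ, ∏ j ∈ S, f p q (ξ i) (ξ j)) *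
      (∏ a, ∏ b with a < b, f p q (ξ (l a)) (ξ (l b))) /
    ∏ i ∈ U, ∏ j ∈ U with i < j, f p q (ξ i) (ξ j)) *
  (1 - ∏ j ∈ S, ξ j) *
  ((∏ i ∈ S ∪ S₁, ∏ j ∈ S ∪ S₁ with i < j, (ξ j - ξ i)) / ∏ j ∈ S ∪ S₁, (1 - ξ j)) *
  (1 / ∏ i ∈ S₁, ∏ j ∈ S, (ξ j - ξ i)) *
  (∏ i ∈ S₁, ξ i ^ x n) * (∏ a, ξ (l a) ^ x (n + a)) * (∏ j ∈ S, ξ j ^ x m) *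
  (∏ i ∈ U, ξ i ^ (-Y.1 i - 1)) * Complex.exp (∑ i ∈ U, ε p q (ξ i) * t)

/-- The coefficient of one integral, with `τ = p / q` and `k = |S|`. -/
def coefficient (p q : ℝ) (n m : ℕ) (S S₁ : Finset (Fin N)) (l : Fin (m - n) ↪ Fin N) : ℝ :=
  (-1) ^ (σ (S ∪ S₁) (univ.map l) + (n - 1) + (m - n) * #S) * sgn l *
    (p / q) ^ ((σ (indices S S₁ l) univ : ℤ) - (m * (m - 1) / 2 : ℕ) - m * #S) *
    q ^ (#S * (#S - 1) / 2 + (n - 1) * (n - 2) / 2)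

end ASEP

end

/-! The right-hand side is a Bethe ansatz in the initial configuration `Y`. For a tuple `e` of `r =
m - 1 + k` labels, `wave` is an amplitude times a density in the variables `ξ (e a)` times `∏ ξ (e
a) ^ (-Y (e a))`, and `bethe` sums these waves over all tuples, with weights, integrating over the
torus of radius `R`. It has to be shown that a suitable combination of such superpositions solves
the backward equation of the process and equals the indicator of the event at time zero.

Evolution. Moving one coordinate of `Y` multiplies a wave by a power of one variable, so the
generator of free particles multiplies the density by `∑ ε (ζ a)` (`bethe_free_generator`).
Exclusion is the boundary condition `bethe_boundary`: when particles `u` and `u + 1` are adjacent,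
the two forbidden moves contribute nothing in total. It holds because exchanging the two labels
changes the sign of the sum. If both labels occur, the amplitude supplies the sign; if one occurs,
the weights `τ ^ (sum of labels)` balance the rates `p` and `q`. Hence `complexGenerator_bethe`, and
comparison of power series in `t` gives the expectation at time `t` (`integral_law_eq`).

Time zero. The full-range superpositions with monomial densities are orthonormal (`bethe_monomial`).
If the gaps of the exponents are large, only the identity contributes, by analyticity outside the
circle. In general the difference from the Kronecker delta is shown to vanish by comparing the
generator acting on `Y` with the one acting on the exponents (`eq_zero_of_gaps`). The actual
densities involve half-lines, that is geometric sums `z ^ (b + 1) / (z - 1)`. By the exchange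
relation `bethe_eq_zero_of_symm`, a point may change places with a half-line at the cost of a factor
`τ`; the weighted count `slotSum` of particles in the slots obeys the same rules, so the two agree
(`bethe_slot`).

Combinatorics. The formula sums over sets `S`, `S₁` rather than tuples. Summing the amplitudes over
the arrangements of a set gives a Vandermonde product times a `q`-factorial (`sum_prod_f_div`),
while the weighted counts give a `τ`-factorial; these match up to powers of `q`. At time zero the
alternating sum over `S` factors as `∏ (1 - τ ^ gapCount)`, which vanishes unless every particle
weakly left of the bound belongs to `S₁ ∪ Λ` (`sum_alternating`). Subtracting the results for the
bounds `x m` and `x m - 1`, which is where the factor `1 - ∏ ξ j` comes from, forces `S₁ ∪ Λ` to be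
the first `m - 1` particles and puts particle `m` at `x m` (`eq_of_occupied`). -/

noncomputable section

namespace ASEP

/-! ### The uniform measure on a torus -/

/-- The uniform probability measure on the interval of angles `[0, 2π]`. -/
def angleMeasure : Measure ℝ :=
  ENNReal.ofReal (2 * Real.pi)⁻¹ • volume.restrict (Set.Icc 0 (2 * Real.pi))

instance : IsProbabilityMeasure angleMeasure := by
  constructor
  have h : (0 : ℝ) < 2 * Real.pi := by positivity
  rw [angleMeasure, Measure.smul_apply, Measure.restrict_apply_univ, Real.volume_Icc, sub_zero,
    smul_eq_mul, ← ENNReal.ofReal_mul (by positivity), inv_mul_cancel₀ h.ne', ENNReal.ofReal_one]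

/-- The uniform probability measure on the circle of radius `R` around zero. -/
def circleMeasure (R : ℝ) : Measure ℂ := angleMeasure.map (circleMap 0 R)

theorem measurable_circleMap (R : ℝ) : Measurable (circleMap 0 R) :=
  (continuous_circleMap 0 R).measurable

instance (R : ℝ) : IsProbabilityMeasure (circleMeasure R) :=
  Measure.isProbabilityMeasure_map (measurable_circleMap R).aemeasurable

/-- The uniform probability measure on the torus of radius `R` around zero. -/
def torusMeasure (ι : Type*) [Fintype ι] (R : ℝ) : Measure (ι → ℂ) :=
  Measure.pi fun _ => circleMeasure R

instance (ι : Type*) [Fintype ι] (R : ℝ) : IsProbabilityMeasure (torusMeasure ι R) := by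
  unfold torusMeasure; infer_instance

/-- The torus of radius `R` around zero. -/
def torus (ι : Type*) (R : ℝ) : Set (ι → ℂ) := Set.pi Set.univ fun _ => Metric.sphere 0 R

theorem isCompact_torus (ι : Type*) (R : ℝ) : IsCompact (torus ι R) :=
  isCompact_univ_pi fun _ => isCompact_sphere 0 R

theorem mem_torus {ι : Type*} {R : ℝ} {ξ : ι → ℂ} : ξ ∈ torus ι R ↔ ∀ i, ‖ξ i‖ = R := by
  simp [torus, Set.mem_pi]

theorem ae_norm_circleMeasure {R : ℝ} (hR : 0 ≤ R) : ∀ᵐ z ∂circleMeasure R, ‖z‖ = R := by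
  rw [circleMeasure, ae_map_iff (measurable_circleMap R).aemeasurable
    (measurableSet_eq_fun measurable_norm measurable_const)]
  exact Filter.Eventually.of_forall fun θ => by simp [abs_of_nonneg hR]

theorem ae_mem_torus {ι : Type*} [Fintype ι] {R : ℝ} (hR : 0 ≤ R) :
    ∀ᵐ ξ ∂torusMeasure ι R, ξ ∈ torus ι R := by
  simp_rw [mem_torus]
  refine ae_all_iff.2 fun i => ?_
  exact (measurePreserving_eval (fun _ : ι => circleMeasure R) i).quasiMeasurePreserving.ae
    (ae_norm_circleMeasure hR)

theorem integrable_of_continuousOn_torus {ι : Type*} [Fintype ι] {R : ℝ} (hR : 0 ≤ R)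
    {F : (ι → ℂ) → ℂ} (hF : ContinuousOn F (torus ι R)) : Integrable F (torusMeasure ι R) := by
  have h := hF.integrableOn_compact (μ := torusMeasure ι R) (isCompact_torus ι R)
  rwa [IntegrableOn, Measure.restrict_eq_self_of_ae_mem (ae_mem_torus hR)] at h

/-- A restriction of the coordinates, or a permutation of them, preserves the measure. -/
theorem measurePreserving_comp {ι κ : Type*} [Fintype ι] [Fintype κ] (R : ℝ) {g : κ → ι}
    (hg : Function.Injective g) :
    MeasurePreserving (fun ξ : ι → ℂ => ξ ∘ g) (torusMeasure ι R) (torusMeasure κ R) := by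
  classical
  have hm : Measurable fun ξ : ι → ℂ => ξ ∘ g := by
    refine measurable_pi_lambda _ fun a => measurable_pi_apply _
  refine ⟨hm, ?_⟩
  refine (Measure.pi_eq fun s hs => ?_).symm
  rw [Measure.map_apply hm (MeasurableSet.univ_pi hs)]
  have h1 : (fun ξ : ι → ℂ => ξ ∘ g) ⁻¹' Set.pi Set.univ s =
      Set.pi Set.univ (fun i => ⋂ a : κ, ⋂ _ : g a = i, s a) := by
    ext ξ
    simp only [Set.mem_preimage, Set.mem_pi, Set.mem_univ, true_implies, Function.comp_apply,
      Set.mem_iInter]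
    exact ⟨fun h i a ha => ha ▸ h a, fun h a => h _ a rfl⟩
  have h2 : ∀ a, (⋂ b : κ, ⋂ _ : g b = g a, s b) = s a := fun a => by
    ext z
    simp only [Set.mem_iInter]
    exact ⟨fun h => h a rfl, fun h b hb => hg hb ▸ h⟩
  rw [h1, torusMeasure, Measure.pi_pi, ← Finset.prod_subset (Finset.subset_univ (univ.image g)),
    Finset.prod_image fun a _ b _ h => hg h]
  · exact Finset.prod_congr rfl fun a _ => by rw [h2]
  · intro i _ hi
    have : (⋂ a : κ, ⋂ _ : g a = i, s a) = Set.univ := by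
      refine Set.eq_univ_of_forall fun z => ?_
      simp only [Set.mem_iInter]
      intro a ha
      exact absurd (ha ▸ Finset.mem_image_of_mem g (Finset.mem_univ a)) hi
    rw [this, measure_univ]

theorem integral_comp_injective {ι κ : Type*} [Fintype ι] [Fintype κ] {R : ℝ} (hR : 0 ≤ R)
    {g : κ → ι} (hg : Function.Injective g) {F : (κ → ℂ) → ℂ} (hF : ContinuousOn F (torus κ R)) :
    ∫ ξ, F (ξ ∘ g) ∂torusMeasure ι R = ∫ ξ, F ξ ∂torusMeasure κ R := by
  have h := measurePreserving_comp R hg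
  rw [← h.map_eq, integral_map h.measurable.aemeasurable]
  rw [h.map_eq]
  exact (integrable_of_continuousOn_torus hR hF).aestronglyMeasurable

theorem torusMeasure_eq_map (ι : Type*) [Fintype ι] (R : ℝ) :
    torusMeasure ι R = (ENNReal.ofReal (2 * Real.pi)⁻¹ ^ Fintype.card ι •
      volume.restrict (Set.Icc 0 fun _ : ι => 2 * Real.pi)).map
        (fun θ i => circleMap 0 R (θ i)) := by
  have h : Measure.pi (fun _ : ι => angleMeasure) = ENNReal.ofReal (2 * Real.pi)⁻¹ ^ Fintype.card ι •
      volume.restrict (Set.Icc 0 fun _ : ι => 2 * Real.pi) := by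
    refine Measure.pi_eq fun s hs => ?_
    have : (Set.Icc 0 fun _ : ι => 2 * Real.pi) =
        Set.pi Set.univ fun _ : ι => Set.Icc 0 (2 * Real.pi) := by
      rw [Set.pi_univ_Icc]; rfl
    rw [this, volume_pi, Measure.restrict_pi_pi, Measure.smul_apply, Measure.pi_pi]
    simp [angleMeasure, Finset.prod_mul_distrib]
  rw [← h, torusMeasure]
  unfold circleMeasure
  rw [Measure.pi_map_pi]
  exact fun i => (measurable_circleMap R).aemeasurable

theorem integral_torusMeasure {ι : Type*} [Fintype ι] (R : ℝ) {F : (ι → ℂ) → ℂ}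
    (hF : Measurable F) :
    ∫ ξ, F ξ ∂torusMeasure ι R = ((2 * Real.pi : ℝ) : ℂ)⁻¹ ^ Fintype.card ι *
      ∫ θ in Set.Icc 0 fun _ : ι => 2 * Real.pi, F fun i => circleMap 0 R (θ i) := by
  have hm : Measurable fun (θ : ι → ℝ) i => circleMap 0 R (θ i) :=
    measurable_pi_lambda _ fun i => (measurable_circleMap R).comp (measurable_pi_apply i)
  rw [torusMeasure_eq_map, integral_map hm.aemeasurable hF.aestronglyMeasurable,
    integral_smul_measure, ENNReal.toReal_pow, ENNReal.toReal_ofReal (by positivity),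
    Complex.real_smul]
  push_cast
  rfl

/-- On the circle `dz / (2πi) = z dθ / (2π)`, whence the extra factor `∏ ξ i`. The variables outside
`U` may be integrated too, since the measure has mass one; thus integrals for different `U` all live
on the same torus and can be added. -/
theorem contourIntegral_eq {N : ℕ} (U : Finset (Fin N)) {R : ℝ} {F : (Fin N → ℂ) → ℂ}
    (hF : Measurable F) :
    contourIntegral U R F = ∫ ξ, F (fun i => if i ∈ U then ξ i else 0) * ∏ i ∈ U, ξ i
      ∂torusMeasure (Fin N) R := by
  set e := U.orderIsoOfFin rfl with he
  set ext : (Fin #U → ℂ) → (Fin N → ℂ) :=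
    fun z i => if h : i ∈ U then z (e.symm ⟨i, h⟩) else 0 with hext
  have hme : Measurable ext := by
    refine measurable_pi_lambda _ fun i => ?_
    by_cases h : i ∈ U
    · simpa [hext, h] using measurable_pi_apply (e.symm ⟨i, h⟩)
    · simp [hext, h]
  have hG : Measurable fun z : Fin #U → ℂ => F (ext z) * ∏ a, z a :=
    (hF.comp hme).mul (by fun_prop)
  have hinj : Function.Injective fun a => (e a : Fin N) :=
    Subtype.val_injective.comp e.injective
  have h1 : ∫ ξ, F (fun i => if i ∈ U then ξ i else 0) * ∏ i ∈ U, ξ i ∂torusMeasure (Fin N) R =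
      ∫ z, F (ext z) * ∏ a, z a ∂torusMeasure (Fin #U) R := by
    have h := measurePreserving_comp R hinj
    rw [← h.map_eq, integral_map h.measurable.aemeasurable hG.aestronglyMeasurable]
    refine integral_congr_ae (Filter.Eventually.of_forall fun ξ => ?_)
    simp only [Function.comp_apply]
    refine congrArg₂ (· * ·) (congrArg F ?_) ?_
    · funext i
      by_cases h : i ∈ U <;> simp [hext, h]
    · rw [← Finset.prod_coe_sort U, ← e.toEquiv.prod_comp]
      rfl
  rw [h1, integral_torusMeasure R hG, contourIntegral, torusIntegral]
  have h2 : ∀ θ : Fin #U → ℝ, torusMap 0 (fun _ => R) θ = fun i => circleMap 0 R (θ i) := by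
    intro θ; funext i; simp [torusMap, circleMap]
  have h3 : ∀ θ : Fin #U → ℝ, (∏ i : Fin #U, (R : ℂ) * Complex.exp (θ i * Complex.I) * Complex.I)
      • F (ext (torusMap 0 (fun _ => R) θ)) = Complex.I ^ #U *
        (F (ext fun i => circleMap 0 R (θ i)) * ∏ a, circleMap 0 R (θ a)) := by
    intro θ
    rw [h2, Finset.prod_mul_distrib, Finset.prod_const, card_univ, Fintype.card_fin, smul_eq_mul]
    simp only [circleMap, zero_add]
    ring
  change _ * ∫ θ in Set.Icc 0 fun _ : Fin #U => 2 * Real.pi, (∏ i : Fin #U, (R : ℂ) *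
    Complex.exp (θ i * Complex.I) * Complex.I) • F (ext (torusMap 0 (fun _ => R) θ)) = _
  simp_rw [h3]
  rw [integral_const_mul, ← mul_assoc, ← mul_pow, Fintype.card_fin]
  congr 2
  have : (Real.pi : ℂ) ≠ 0 := by exact_mod_cast Real.pi_ne_zero
  push_cast
  field_simp

/-! ### Products over ordered pairs -/

/-- The product of `g a b` over all pairs `a < b`. -/
def pairProd {r : ℕ} {M : Type*} [CommMonoid M] (g : Fin r → Fin r → M) : M :=
  ∏ x : Fin r × Fin r with x.1 < x.2, g x.1 x.2

theorem pairProd_congr {r : ℕ} {M : Type*} [CommMonoid M] {g g' : Fin r → Fin r → M}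
    (h : ∀ a b, a < b → g a b = g' a b) : pairProd g = pairProd g' :=
  Finset.prod_congr rfl fun x hx => h x.1 x.2 (Finset.mem_filter.1 hx).2

theorem pairProd_eq_zero {r : ℕ} {M : Type*} [CommMonoidWithZero M] {g : Fin r → Fin r → M}
    {a b : Fin r} (hab : a < b) (h : g a b = 0) : pairProd g = 0 :=
  Finset.prod_eq_zero (i := (a, b)) (by simpa using hab) h

theorem pairProd_erase {r : ℕ} {M : Type*} [CommMonoid M] (g : Fin r → Fin r → M)
    {a b : Fin r} (hab : a < b) :
    pairProd g = g a b *
      ∏ x ∈ (univ.filter fun x : Fin r × Fin r => x.1 < x.2).erase (a, b), g x.1 x.2 :=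
  (Finset.mul_prod_erase _ (fun x : Fin r × Fin r => g x.1 x.2)
    (by simpa using hab : (a, b) ∈ univ.filter fun x : Fin r × Fin r => x.1 < x.2)).symm

/-- Exchanging adjacent slots keeps the order of every pair except `(i, j)` itself, so only that
factor changes. The identity is multiplied out, so that it also holds where factors vanish. -/
theorem pairProd_swap {r : ℕ} {M : Type*} [CommMonoid M] (g : Fin r → Fin r → M)
    {i j : Fin r} (hij : (i : ℕ) + 1 = j) :
    pairProd (fun a b => g (Equiv.swap i j a) (Equiv.swap i j b)) * g i j =
      pairProd g * g j i := by
  have hlt : i < j := by rw [Fin.lt_def]; omega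
  rw [pairProd_erase g hlt, pairProd_erase _ hlt, Equiv.swap_apply_left, Equiv.swap_apply_right]
  have : ∏ x ∈ (univ.filter fun x : Fin r × Fin r => x.1 < x.2).erase (i, j),
      g (Equiv.swap i j x.1) (Equiv.swap i j x.2) =
      ∏ x ∈ (univ.filter fun x : Fin r × Fin r => x.1 < x.2).erase (i, j), g x.1 x.2 := by
    have hmem : ∀ x ∈ (univ.filter fun x : Fin r × Fin r => x.1 < x.2).erase (i, j),
        (Equiv.swap i j x.1, Equiv.swap i j x.2) ∈
          (univ.filter fun x : Fin r × Fin r => x.1 < x.2).erase (i, j) := by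
      rintro ⟨a, b⟩ hx
      simp only [mem_erase, mem_filter, mem_univ, true_and, ne_eq, Prod.mk.injEq,
        Equiv.swap_apply_def, Fin.lt_def, Fin.ext_iff] at hx ⊢
      split_ifs <;> omega
    refine Finset.prod_nbij' (fun x => (Equiv.swap i j x.1, Equiv.swap i j x.2))
      (fun x => (Equiv.swap i j x.1, Equiv.swap i j x.2)) hmem hmem ?_ ?_ ?_ <;> simp
  rw [this]
  exact mul_right_comm _ _ _ |>.trans (by rw [mul_comm (g j i), mul_assoc, mul_comm (g j i), ← mul_assoc])

/-! ### Scattering amplitudes -/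

variable {N r : ℕ}

/-- The scattering factor of two particles. -/
def scat (p q : ℝ) (ξ : Fin N → ℂ) (i j : Fin N) : ℂ :=
  if i = j then 0 else if i < j then 1 else -(f p q (ξ i) (ξ j) / f p q (ξ j) (ξ i))

/-- The amplitude of the plane wave belonging to the tuple `e`, zero if an entry is repeated. -/
def amp (p q : ℝ) (e : Fin r → Fin N) (ξ : Fin N → ℂ) : ℂ :=
  pairProd fun a b => scat p q ξ (e a) (e b)

theorem amp_eq_zero {p q : ℝ} {e : Fin r → Fin N} (he : ¬ Function.Injective e)
    (ξ : Fin N → ℂ) : amp p q e ξ = 0 := by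
  simp only [Function.Injective, not_forall] at he
  obtain ⟨a, b, hab, hne⟩ := he
  rcases lt_or_gt_of_ne hne with h | h
  · exact pairProd_eq_zero h (by simp [scat, hab])
  · exact pairProd_eq_zero h (by simp [scat, hab])

theorem amp_of_strictMono {p q : ℝ} {e : Fin r → Fin N} (he : StrictMono e)
    (ξ : Fin N → ℂ) : amp p q e ξ = 1 := by
  refine Finset.prod_eq_one fun x hx => ?_
  have := he (Finset.mem_filter.1 hx).2
  simp [scat, this, this.ne]

theorem scat_swap_mul {p q : ℝ} {ξ : Fin N → ℂ} (hf : ∀ i j, f p q (ξ i) (ξ j) ≠ 0)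
    {i j : Fin N} (hij : i ≠ j) :
    scat p q ξ j i * f p q (ξ i) (ξ j) = -(scat p q ξ i j * f p q (ξ j) (ξ i)) := by
  have h1 := hf i j
  have h2 := hf j i
  rcases lt_or_gt_of_ne hij with h | h
  · simp [scat, h, h.ne, h.ne', h.not_gt]
    field_simp
  · simp [scat, h, h.ne, h.ne', h.not_gt]
    field_simp

theorem scat_ne_zero {p q : ℝ} {ξ : Fin N → ℂ} (hf : ∀ i j, f p q (ξ i) (ξ j) ≠ 0)
    {i j : Fin N} (hij : i ≠ j) : scat p q ξ i j ≠ 0 := by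
  rw [scat, if_neg hij]
  split_ifs
  · exact one_ne_zero
  · exact neg_ne_zero.2 (div_ne_zero (hf _ _) (hf _ _))

/-- The behaviour of the amplitude under the exchange of two adjacent entries. -/
theorem amp_comp_swap {p q : ℝ} {ξ : Fin N → ℂ} (hf : ∀ i j, f p q (ξ i) (ξ j) ≠ 0)
    (e : Fin r → Fin N) {i j : Fin r} (hij : (i : ℕ) + 1 = j) :
    amp p q (e ∘ Equiv.swap i j) ξ * f p q (ξ (e i)) (ξ (e j)) =
      -(amp p q e ξ * f p q (ξ (e j)) (ξ (e i))) := by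
  have hne : i ≠ j := by intro h; rw [h] at hij; omega
  by_cases heq : e i = e j
  · have h1 : ¬ Function.Injective e := fun h => hne (h heq)
    have h2 : ¬ Function.Injective (e ∘ Equiv.swap i j) := fun h => hne (h (by simp [heq]))
    rw [amp_eq_zero h1, amp_eq_zero h2]; simp
  · have h1 := pairProd_swap (fun a b => scat p q ξ (e a) (e b)) hij
    have h2 := scat_swap_mul hf heq
    -- `pairProd_swap` relates the two amplitudes only after multiplication by the scattering factor
    -- of the pair, which is nonzero for distinct labels.
    refine mul_right_cancel₀ (scat_ne_zero hf heq) ?_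
    change pairProd (fun a b => scat p q ξ (e (Equiv.swap i j a)) (e (Equiv.swap i j b))) *
      _ * _ = -(pairProd (fun a b => scat p q ξ (e a) (e b)) * _) * _
    linear_combination (f p q (ξ (e i)) (ξ (e j))) * h1 +
      pairProd (fun a b => scat p q ξ (e a) (e b)) * h2

/-- Exchanging two adjacent labels preserves the order of all other pairs, and permuting the
variables along with the labels leaves the values of `f` unchanged. -/
theorem scat_comp_swap {p q : ℝ} (ξ : Fin N → ℂ) {u v : Fin N} (huv : (u : ℕ) + 1 = v)
    {i j : Fin N} (h : ¬ (i = u ∧ j = v)) (h' : ¬ (i = v ∧ j = u)) :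
    scat p q (ξ ∘ Equiv.swap u v) (Equiv.swap u v i) (Equiv.swap u v j) = scat p q ξ i j := by
  have h1 : (Equiv.swap u v i < Equiv.swap u v j) = (i < j) := by
    simp only [eq_iff_iff, Equiv.swap_apply_def, Fin.lt_def, Fin.ext_iff] at *
    split_ifs <;> omega
  simp [scat, h1]

/-- The behaviour of the amplitude under the exchange of two adjacent labels that do not both
occur. -/
theorem amp_swap_comp_of_notMem {p q : ℝ} (ξ : Fin N → ℂ) {u v : Fin N}
    (huv : (u : ℕ) + 1 = v) (e : Fin r → Fin N)
    (h : u ∉ Set.range e ∨ v ∉ Set.range e) :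
    amp p q (Equiv.swap u v ∘ e) (ξ ∘ Equiv.swap u v) = amp p q e ξ := by
  refine pairProd_congr fun a b _ => scat_comp_swap ξ huv ?_ ?_
  · rintro ⟨ha, hb⟩
    exact h.elim (fun h => h ⟨a, ha⟩) fun h => h ⟨b, hb⟩
  · rintro ⟨ha, hb⟩
    exact h.elim (fun h => h ⟨b, hb⟩) fun h => h ⟨a, ha⟩

/-- The behaviour of the amplitude under the exchange of two adjacent labels. -/
theorem amp_swap_comp {p q : ℝ} {ξ : Fin N → ℂ} (hf : ∀ i j, f p q (ξ i) (ξ j) ≠ 0)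
    {u v : Fin N} (huv : (u : ℕ) + 1 = v) {e : Fin r → Fin N} (he : Function.Injective e)
    {a b : Fin r} (ha : e a = u) (hb : e b = v) :
    amp p q (Equiv.swap u v ∘ e) (ξ ∘ Equiv.swap u v) * f p q (ξ v) (ξ u) =
      -(amp p q e ξ * f p q (ξ u) (ξ v)) := by
  have hlt : u < v := by rw [Fin.lt_def]; omega
  have h1 := hf u v
  have h2 := hf v u
  -- The slots of `u` and `v` can come in either order; `c < d` are these slots sorted.
  have key : ∀ c d : Fin r, c < d → (c = a ∧ d = b ∨ c = b ∧ d = a) →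
      amp p q (Equiv.swap u v ∘ e) (ξ ∘ Equiv.swap u v) * f p q (ξ v) (ξ u) =
      -(amp p q e ξ * f p q (ξ u) (ξ v)) := by
    intro c d hcd hc
    rw [amp, amp, pairProd_erase _ hcd, pairProd_erase (fun a b => scat p q ξ (e a) (e b)) hcd]
    have hrest : ∏ x ∈ (univ.filter fun x : Fin r × Fin r => x.1 < x.2).erase (c, d),
        scat p q (ξ ∘ Equiv.swap u v) ((Equiv.swap u v ∘ e) x.1) ((Equiv.swap u v ∘ e) x.2) =
        ∏ x ∈ (univ.filter fun x : Fin r × Fin r => x.1 < x.2).erase (c, d),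
          scat p q ξ (e x.1) (e x.2) := by
      refine Finset.prod_congr rfl fun x hx => scat_comp_swap ξ huv ?_ ?_
      · rintro ⟨h3, h4⟩
        have h5 := he (h3.trans ha.symm)
        have h6 := he (h4.trans hb.symm)
        rw [mem_erase, mem_filter] at hx
        rcases hc with ⟨rfl, rfl⟩ | ⟨rfl, rfl⟩
        · exact hx.1 (Prod.ext h5 h6)
        · have := hx.2.2; rw [h5, h6] at this; exact absurd this hcd.not_gt
      · rintro ⟨h3, h4⟩
        have h5 := he (h3.trans hb.symm)
        have h6 := he (h4.trans ha.symm)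
        rw [mem_erase, mem_filter] at hx
        rcases hc with ⟨rfl, rfl⟩ | ⟨rfl, rfl⟩
        · have := hx.2.2; rw [h5, h6] at this; exact absurd this hcd.not_gt
        · exact hx.1 (Prod.ext h5 h6)
    rw [hrest]
    rcases hc with ⟨rfl, rfl⟩ | ⟨rfl, rfl⟩
    · simp [ha, hb, scat, hlt, hlt.ne, hlt.ne', hlt.not_gt]
      field_simp
    · simp [ha, hb, scat, hlt, hlt.ne, hlt.ne', hlt.not_gt]
      field_simp
  have hab : a ≠ b := by rintro rfl; exact hlt.ne (ha.symm.trans hb)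
  rcases lt_or_gt_of_ne hab with h | h
  · exact key a b h (Or.inl ⟨rfl, rfl⟩)
  · exact key b a h (Or.inr ⟨rfl, rfl⟩)

theorem amp_comp_strictMono {M : ℕ} {p q : ℝ} {g : Fin M → Fin N} (hg : StrictMono g)
    (e : Fin r → Fin M) (ξ : Fin N → ℂ) : amp p q (g ∘ e) ξ = amp p q e (ξ ∘ g) :=
  pairProd_congr fun a b _ => by simp [scat, hg.injective.eq_iff, hg.lt_iff_lt]

/-! ### Nonvanishing of the denominators on the torus -/

theorem ne_zero_of_mem_torus {R : ℝ} (hR : 1 < R) {ι : Type*} {ξ : ι → ℂ} (hξ : ξ ∈ torus ι R)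
    (i : ι) : ξ i ≠ 0 := by
  rw [← norm_pos_iff, mem_torus.1 hξ i]; linarith

theorem ne_one_of_mem_torus {R : ℝ} (hR : 1 < R) {ι : Type*} {ξ : ι → ℂ} (hξ : ξ ∈ torus ι R)
    (i : ι) : ξ i ≠ 1 := fun h => by
  have := mem_torus.1 hξ i
  rw [h, norm_one] at this
  exact hR.ne this

theorem f_ne_zero_of_mem_torus {p q R : ℝ} (hR : IsLargeRadius p q R) {ι : Type*} {ξ : ι → ℂ}
    (hξ : ξ ∈ torus ι R) (i j : ι) : f p q (ξ i) (ξ j) ≠ 0 :=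
  hR.2 _ _ (mem_torus.1 hξ i).ge (mem_torus.1 hξ j).ge

theorem continuousOn_amp {p q R : ℝ} (hR : IsLargeRadius p q R) (e : Fin r → Fin N) :
    ContinuousOn (amp p q e) (torus (Fin N) R) := by
  unfold amp pairProd
  refine continuousOn_finsetProd _ fun x _ => ?_
  dsimp only [scat]
  split_ifs
  · exact continuousOn_const
  · exact continuousOn_const
  · refine (ContinuousOn.div ?_ ?_ fun ξ hξ => f_ne_zero_of_mem_torus hR hξ _ _).neg
    · unfold f; fun_prop
    · unfold f; fun_prop

/-! ### Superpositions of plane waves -/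

/-- The plane wave with the tuple `e` of momenta, evaluated at `Y`, with the density `Ψ`. -/
def wave (p q : ℝ) (e : Fin r → Fin N) (Y : Fin N → ℤ) (Ψ : (Fin r → ℂ) → ℂ) (ξ : Fin N → ℂ) : ℂ :=
  amp p q e ξ * Ψ (ξ ∘ e) * ∏ a, ξ (e a) ^ (-Y (e a))

/-- The superposition of the plane waves over the torus of radius `R`, with weights `w`. -/
def bethe (p q R : ℝ) (w : (Fin r → Fin N) → ℂ) (Y : Fin N → ℤ) (Ψ : (Fin r → ℂ) → ℂ) : ℂ :=
  ∑ e, w e * ∫ ξ, wave p q e Y Ψ ξ ∂torusMeasure (Fin N) R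

theorem comp_mem_torus {R : ℝ} {ι κ : Type*} {ξ : ι → ℂ} (hξ : ξ ∈ torus ι R) (e : κ → ι) :
    ξ ∘ e ∈ torus κ R :=
  mem_torus.2 fun a => mem_torus.1 hξ (e a)

theorem continuousOn_comp_torus {R : ℝ} {ι κ : Type*} (e : κ → ι) {Ψ : (κ → ℂ) → ℂ}
    (hΨ : ContinuousOn Ψ (torus κ R)) : ContinuousOn (fun ξ : ι → ℂ => Ψ (ξ ∘ e)) (torus ι R) :=
  hΨ.comp (by fun_prop) fun _ hξ => comp_mem_torus hξ e

theorem continuousOn_coord_zpow {R : ℝ} (hR : 1 < R) {ι : Type*} (i : ι) (k : ℤ) :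
    ContinuousOn (fun ξ : ι → ℂ => ξ i ^ k) (torus ι R) :=
  ContinuousOn.zpow₀ (by fun_prop) _ fun _ hξ => Or.inl (ne_zero_of_mem_torus hR hξ i)

theorem continuousOn_wave {p q R : ℝ} (hR : IsLargeRadius p q R) (e : Fin r → Fin N)
    (Y : Fin N → ℤ) {Ψ : (Fin r → ℂ) → ℂ} (hΨ : ContinuousOn Ψ (torus (Fin r) R)) :
    ContinuousOn (wave p q e Y Ψ) (torus (Fin N) R) :=
  ((continuousOn_amp hR e).mul (continuousOn_comp_torus e hΨ)).mul
    (continuousOn_finsetProd _ fun _ _ => continuousOn_coord_zpow hR.1 _ _)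

theorem integrable_wave {p q R : ℝ} (hR : IsLargeRadius p q R) (e : Fin r → Fin N)
    (Y : Fin N → ℤ) {Ψ : (Fin r → ℂ) → ℂ} (hΨ : ContinuousOn Ψ (torus (Fin r) R)) :
    Integrable (wave p q e Y Ψ) (torusMeasure (Fin N) R) :=
  integrable_of_continuousOn_torus (by linarith [hR.1]) (continuousOn_wave hR e Y hΨ)

theorem wave_eq_zero {p q : ℝ} {e : Fin r → Fin N} (he : ¬ Function.Injective e) (Y : Fin N → ℤ)
    (Ψ : (Fin r → ℂ) → ℂ) (ξ : Fin N → ℂ) : wave p q e Y Ψ ξ = 0 := by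
  simp [wave, amp_eq_zero he]

theorem integral_torus_congr {R : ℝ} (hR : 1 < R) {ι : Type*} [Fintype ι] {F G : (ι → ℂ) → ℂ}
    (h : ∀ ξ ∈ torus ι R, F ξ = G ξ) :
    ∫ ξ, F ξ ∂torusMeasure ι R = ∫ ξ, G ξ ∂torusMeasure ι R :=
  integral_congr_ae ((ae_mem_torus (by linarith)).mono h)

theorem bethe_congr {p q R : ℝ} (hR : 1 < R) (w : (Fin r → Fin N) → ℂ) (Y : Fin N → ℤ)
    {Ψ Φ : (Fin r → ℂ) → ℂ} (h : ∀ ζ ∈ torus (Fin r) R, Ψ ζ = Φ ζ) :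
    bethe p q R w Y Ψ = bethe p q R w Y Φ := by
  refine Finset.sum_congr rfl fun e _ => congrArg _ (integral_torus_congr hR fun ξ hξ => ?_)
  simp [wave, h _ (comp_mem_torus hξ e)]

theorem bethe_add {p q R : ℝ} (hR : IsLargeRadius p q R) (w : (Fin r → Fin N) → ℂ)
    (Y : Fin N → ℤ) {Ψ Φ : (Fin r → ℂ) → ℂ} (hΨ : ContinuousOn Ψ (torus (Fin r) R))
    (hΦ : ContinuousOn Φ (torus (Fin r) R)) :
    bethe p q R w Y (fun ζ => Ψ ζ + Φ ζ) = bethe p q R w Y Ψ + bethe p q R w Y Φ := by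
  rw [bethe, bethe, bethe, ← Finset.sum_add_distrib]
  refine Finset.sum_congr rfl fun e _ => ?_
  rw [← mul_add, ← integral_add (integrable_wave hR e Y hΨ) (integrable_wave hR e Y hΦ)]
  congr 2
  funext ξ
  simp only [wave]; ring

theorem bethe_const_mul {p q R : ℝ} (w : (Fin r → Fin N) → ℂ) (Y : Fin N → ℤ)
    (c : ℂ) (Ψ : (Fin r → ℂ) → ℂ) :
    bethe p q R w Y (fun ζ => c * Ψ ζ) = c * bethe p q R w Y Ψ := by
  rw [bethe, bethe, Finset.mul_sum]
  refine Finset.sum_congr rfl fun e _ => ?_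
  have : ∫ ξ, wave p q e Y (fun ζ => c * Ψ ζ) ξ ∂torusMeasure (Fin N) R =
      c * ∫ ξ, wave p q e Y Ψ ξ ∂torusMeasure (Fin N) R := by
    rw [← integral_const_mul]
    congr 1
    funext ξ
    simp only [wave]; ring
  rw [this]; ring

/-- Exchange relation: the superposition vanishes if the density is `f (ζ j) (ζ i)` times a
function that is symmetric in two adjacent slots `i`, `j`. -/
theorem bethe_eq_zero_of_symm {p q R : ℝ} (hR : IsLargeRadius p q R) {w : (Fin r → Fin N) → ℂ}
    {i j : Fin r} (hij : (i : ℕ) + 1 = j) (hw : ∀ e, w (e ∘ Equiv.swap i j) = w e)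
    (Y : Fin N → ℤ) {h : (Fin r → ℂ) → ℂ}
    (hh : ∀ ζ ∈ torus (Fin r) R, h (ζ ∘ Equiv.swap i j) = h ζ) :
    bethe p q R w Y (fun ζ => h ζ * f p q (ζ j) (ζ i)) = 0 := by
  set s := Equiv.swap i j
  have hre : bethe p q R w Y (fun ζ => h ζ * f p q (ζ j) (ζ i)) =
      ∑ e : Fin r → Fin N, w (e ∘ s) * ∫ ξ, wave p q (e ∘ s) Y
        (fun ζ => h ζ * f p q (ζ j) (ζ i)) ξ ∂torusMeasure (Fin N) R :=
    ((s.arrowCongr (Equiv.refl (Fin N))).sum_comp _).symm.trans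
      (Finset.sum_congr rfl fun e _ => by rfl)
  -- Precomposing the tuples with the transposition of the slots permutes the sum. The amplitude
  -- then turns `f (ζ j) (ζ i)` into its negative, by `amp_comp_swap`, and the rest is symmetric.
  have hneg : bethe p q R w Y (fun ζ => h ζ * f p q (ζ j) (ζ i)) =
      -bethe p q R w Y (fun ζ => h ζ * f p q (ζ j) (ζ i)) := by
    conv_lhs => rw [hre]
    rw [bethe, ← Finset.sum_neg_distrib]
    refine Finset.sum_congr rfl fun e _ => ?_
    rw [hw, ← mul_neg, ← integral_neg]
    refine congrArg _ (integral_torus_congr hR.1 fun ξ hξ => ?_)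
    have h1 := amp_comp_swap (fun a b => f_ne_zero_of_mem_torus hR hξ a b) e hij
    have h2 := hh _ (comp_mem_torus hξ e)
    have h3 : ∏ a, ξ ((e ∘ s) a) ^ (-Y ((e ∘ s) a)) = ∏ a, ξ (e a) ^ (-Y (e a)) :=
      Equiv.prod_comp s fun a => ξ (e a) ^ (-Y (e a))
    rw [wave, wave, h3, ← Function.comp_assoc, h2]
    simp only [Function.comp_apply, s, Equiv.swap_apply_left, Equiv.swap_apply_right] at h1 ⊢
    linear_combination (h (ξ ∘ e) * ∏ a, ξ (e a) ^ (-Y (e a))) * h1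
  exact self_eq_neg.1 hneg

/-- In an injective tuple at most one slot carries the label `u`, so a single power changes; for
other tuples the amplitude is zero. -/
theorem wave_update {p q : ℝ} (e : Fin r → Fin N) (Y : Fin N → ℤ) (Ψ : (Fin r → ℂ) → ℂ)
    {ξ : Fin N → ℂ} (hξ : ∀ i, ξ i ≠ 0) (u : Fin N) (d : ℤ) :
    wave p q e (Function.update Y u (Y u + d)) Ψ ξ =
      wave p q e Y Ψ ξ * if u ∈ Set.range e then ξ u ^ (-d) else 1 := by
  by_cases he : Function.Injective e
  · rw [wave, wave, mul_assoc (_ * _)]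
    refine congrArg _ ?_
    split_ifs with h
    · obtain ⟨b, rfl⟩ := h
      have : ∀ a, ξ (e a) ^ (-Function.update Y (e b) (Y (e b) + d) (e a)) =
          ξ (e a) ^ (-Y (e a)) * if a = b then ξ (e b) ^ (-d) else 1 := by
        intro a
        by_cases hab : a = b
        · subst hab
          rw [Function.update_self, if_pos rfl, ← zpow_add₀ (hξ _), neg_add]
        · rw [Function.update_of_ne fun h => hab (he h), if_neg hab, mul_one]
      simp_rw [this, Finset.prod_mul_distrib, Finset.prod_ite_eq' univ b, mem_univ, if_true]
    · rw [mul_one]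
      refine Finset.prod_congr rfl fun a _ => ?_
      rw [Function.update_of_ne fun h' => h ⟨a, h'⟩]
  · rw [wave_eq_zero he, wave_eq_zero he, zero_mul]

/-- The weights are compatible with the exchange of adjacent labels. -/
def IsBalanced (p q : ℝ) (w : (Fin r → Fin N) → ℂ) : Prop :=
  ∀ u v : Fin N, (u : ℕ) + 1 = v → ∀ e : Fin r → Fin N, Function.Injective e →
    ((u ∈ Set.range e ↔ v ∈ Set.range e) → w (Equiv.swap u v ∘ e) = w e) ∧
    (u ∈ Set.range e → v ∉ Set.range e → q * w (Equiv.swap u v ∘ e) = p * w e)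

theorem mem_range_swap_comp (e : Fin r → Fin N) (u v x : Fin N) :
    x ∈ Set.range (Equiv.swap u v ∘ e) ↔ Equiv.swap u v x ∈ Set.range e := by
  constructor
  · rintro ⟨a, rfl⟩; exact ⟨a, by simp⟩
  · rintro ⟨a, ha⟩; exact ⟨a, by simp [ha]⟩

theorem bethe_update_sub {p q R : ℝ} (hR : IsLargeRadius p q R) (w : (Fin r → Fin N) → ℂ)
    (Y : Fin N → ℤ) {Ψ : (Fin r → ℂ) → ℂ} (hΨ : ContinuousOn Ψ (torus (Fin r) R))
    (u : Fin N) (d : ℤ) :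
    bethe p q R w (Function.update Y u (Y u + d)) Ψ - bethe p q R w Y Ψ =
      ∑ e, w e * ∫ ξ, wave p q e Y Ψ ξ * (if u ∈ Set.range e then ξ u ^ (-d) - 1 else 0)
        ∂torusMeasure (Fin N) R := by
  rw [bethe, bethe, ← Finset.sum_sub_distrib]
  refine Finset.sum_congr rfl fun e _ => ?_
  rw [← mul_sub, ← integral_sub (integrable_wave hR e _ hΨ) (integrable_wave hR e Y hΨ)]
  refine congrArg _ (integral_torus_congr hR.1 fun ξ hξ => ?_)
  rw [wave_update e Y Ψ (ne_zero_of_mem_torus hR.1 hξ)]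
  split_ifs <;> ring

theorem integrable_wave_mul {p q R : ℝ} (hR : IsLargeRadius p q R) (e : Fin r → Fin N)
    (Y : Fin N → ℤ) {Ψ : (Fin r → ℂ) → ℂ} (hΨ : ContinuousOn Ψ (torus (Fin r) R))
    (u : Fin N) (d : ℤ) :
    Integrable (fun ξ => wave p q e Y Ψ ξ * (if u ∈ Set.range e then ξ u ^ (-d) - 1 else 0))
      (torusMeasure (Fin N) R) := by
  refine integrable_of_continuousOn_torus (by linarith [hR.1])
    ((continuousOn_wave hR e Y hΨ).mul ?_)
  split_ifs
  · exact (continuousOn_coord_zpow hR.1 _ _).sub continuousOn_const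
  · exact continuousOn_const

/-- The boundary condition of the Bethe ansatz in the variable `Y`. -/
theorem bethe_boundary {p q R : ℝ} (hpq : p + q = 1) (hR : IsLargeRadius p q R)
    {w : (Fin r → Fin N) → ℂ} (hw : IsBalanced p q w) {u v : Fin N} (huv : (u : ℕ) + 1 = v)
    (Y : Fin N → ℤ) (hY : Y v = Y u + 1) {Ψ : (Fin r → ℂ) → ℂ}
    (hΨ : ContinuousOn Ψ (torus (Fin r) R)) :
    p * bethe p q R w (Function.update Y u (Y u + 1)) Ψ +
      q * bethe p q R w (Function.update Y v (Y v + -1)) Ψ = bethe p q R w Y Ψ := by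
  set s := Equiv.swap u v with hs
  have huv' : u ≠ v := by rintro rfl; omega
  set m : (Fin r → Fin N) → (Fin N → ℂ) → ℂ := fun e ξ =>
    p * (if u ∈ Set.range e then ξ u ^ (-1 : ℤ) - 1 else 0) +
    q * (if v ∈ Set.range e then ξ v ^ (-(-1 : ℤ)) - 1 else 0) with hm
  have h1 : p * (bethe p q R w (Function.update Y u (Y u + 1)) Ψ - bethe p q R w Y Ψ) +
      q * (bethe p q R w (Function.update Y v (Y v + -1)) Ψ - bethe p q R w Y Ψ) =
      ∑ e, w e * ∫ ξ, wave p q e Y Ψ ξ * m e ξ ∂torusMeasure (Fin N) R := by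
    rw [bethe_update_sub hR w Y hΨ, bethe_update_sub hR w Y hΨ, Finset.mul_sum, Finset.mul_sum,
      ← Finset.sum_add_distrib]
    refine Finset.sum_congr rfl fun e _ => ?_
    rw [mul_left_comm, mul_left_comm (q : ℂ), ← mul_add, ← integral_const_mul, ← integral_const_mul,
      ← integral_add ((integrable_wave_mul hR e Y hΨ u 1).const_mul _)
        ((integrable_wave_mul hR e Y hΨ v (-1)).const_mul _)]
    congr 2
    funext ξ
    simp only [hm]; ring
  -- Exchange the labels `u` and `v` in the tuple and, at the same time, the variables `ξ u` and `ξ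
  -- v`, which preserves the measure. Each term turns into the negative of the original one.
  have h2 : ∑ e, w e * ∫ ξ, wave p q e Y Ψ ξ * m e ξ ∂torusMeasure (Fin N) R =
      -∑ e, w e * ∫ ξ, wave p q e Y Ψ ξ * m e ξ ∂torusMeasure (Fin N) R := by
    conv_lhs => rw [← ((Equiv.refl (Fin r)).arrowCongr s).sum_comp]
    rw [← Finset.sum_neg_distrib]
    refine Finset.sum_congr rfl fun e _ => ?_
    change w (s ∘ e) * ∫ ξ, wave p q (s ∘ e) Y Ψ ξ * m (s ∘ e) ξ ∂torusMeasure (Fin N) R = _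
    by_cases he : Function.Injective e
    swap
    · have he' : ¬ Function.Injective (s ∘ e) := fun h => he (Function.Injective.of_comp h)
      simp [wave_eq_zero he, wave_eq_zero he']
    have hcont : ContinuousOn (fun ξ => wave p q (s ∘ e) Y Ψ ξ * m (s ∘ e) ξ)
        (torus (Fin N) R) := by
      refine (continuousOn_wave hR _ Y hΨ).mul ((continuousOn_const.mul ?_).add
        (continuousOn_const.mul ?_))
      all_goals
        split_ifs
        · exact (continuousOn_coord_zpow hR.1 _ _).sub continuousOn_const
        · exact continuousOn_const
    rw [← integral_comp_injective (by linarith [hR.1]) s.injective hcont, ← mul_neg_one,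
      mul_assoc, ← integral_mul_const, ← integral_const_mul, ← integral_const_mul]
    refine integral_torus_congr hR.1 fun ξ hξ => ?_
    have hξ0 := ne_zero_of_mem_torus hR.1 hξ
    have hu0 := hξ0 u
    have hv0 := hξ0 v
    have hru : u ∈ Set.range (s ∘ e) ↔ v ∈ Set.range e := by
      rw [mem_range_swap_comp, Equiv.swap_apply_left]
    have hrv : v ∈ Set.range (s ∘ e) ↔ u ∈ Set.range e := by
      rw [mem_range_swap_comp, Equiv.swap_apply_right]
    have hwave : wave p q (s ∘ e) Y Ψ (ξ ∘ s) * amp p q e ξ =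
        amp p q (s ∘ e) (ξ ∘ s) * (wave p q e Y Ψ ξ *
          ((if u ∈ Set.range e then ξ u ^ (-1 : ℤ) else 1) *
            (if v ∈ Set.range e then ξ v ^ (-(-1 : ℤ)) else 1))) := by
      -- Since `Y v = Y u + 1`, exchanging the two coordinates of `Y` amounts to raising one and
      -- lowering the other by one. The wave therefore changes only by powers of `ξ u` and `ξ v` and
      -- by the amplitude.
      have hY' : Y ∘ s = Function.update (Function.update Y u (Y u + 1)) v
          (Function.update Y u (Y u + 1) v + -1) := by
        funext i
        rw [Function.update_of_ne huv'.symm, hY]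
        simp only [Function.comp_apply, hs, Equiv.swap_apply_def, Function.update_apply]
        split_ifs with h3 h4 h4
        · exact absurd (h3.symm.trans h4) huv'
        · exact hY
        · ring
        · rfl
      have h3 : ξ ∘ s ∘ s ∘ e = ξ ∘ e := by
        funext a; simp [hs]
      have h4 := wave_update (p := p) (q := q) e (Function.update Y u (Y u + 1)) Ψ hξ0 v (-1)
      rw [← hY', wave_update e Y Ψ hξ0, mul_assoc] at h4
      rw [← h4, wave, wave, Function.comp_assoc, h3]
      simp only [Function.comp_apply, hs, Equiv.swap_apply_self]
      ring
    have hne : amp p q e ξ ≠ 0 := by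
      refine Finset.prod_ne_zero_iff.2 fun x hx => scat_ne_zero
        (fun i j => f_ne_zero_of_mem_torus hR hξ i j) fun h => ?_
      exact (Finset.mem_filter.1 hx).2.ne (he h)
    obtain ⟨hw1, hw2⟩ := hw u v huv e he
    refine mul_right_cancel₀ hne ?_
    clear hne
    have hmeq : m (s ∘ e) (ξ ∘ s) =
        p * (if v ∈ Set.range e then ξ v ^ (-1 : ℤ) - 1 else 0) +
        q * (if u ∈ Set.range e then ξ u ^ (-(-1 : ℤ)) - 1 else 0) := by
      simp only [hm, hru, hrv, Function.comp_apply]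
      simp only [hs, Equiv.swap_apply_left, Equiv.swap_apply_right]
    rw [hmeq]
    simp only [hm]
    -- If both labels occur, `p / ξ u + q * ξ v - 1 = f (ξ u) (ξ v) / ξ u` cancels against the
    -- exchange factor of the amplitude. If exactly one occurs, the amplitude is unaffected and the
    -- balance `q * w (s ∘ e) = p * w e`, or its mirror image, is what is needed.
    by_cases hu : u ∈ Set.range e <;> by_cases hv : v ∈ Set.range e
    · obtain ⟨a, ha⟩ := hu
      obtain ⟨b, hb⟩ := hv
      have h3 := amp_swap_comp (fun i j => f_ne_zero_of_mem_torus hR hξ i j) huv he ha hb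
      rw [hw1 (by simp [← ha, ← hb])]
      simp only [← ha, ← hb, Set.mem_range_self, if_true] at hwave ⊢
      rw [ha, hb] at *
      simp only [f, zpow_neg, zpow_one, neg_neg] at h3 hwave ⊢
      have hp : (p : ℂ) = 1 - q := by rw [eq_sub_iff_add_eq]; exact_mod_cast hpq
      rw [hp] at h3 ⊢
      field_simp at hwave ⊢
      linear_combination (w e * ((1 - q) * (1 - ξ v) + q * (ξ u - 1) * ξ v)) * hwave +
        w e * wave p q e Y Ψ ξ * ξ v * h3
    · rw [amp_swap_comp_of_notMem ξ huv e (Or.inr hv)] at hwave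
      have h3 := hw2 hu hv
      simp only [hu, hv, if_true, if_false, zpow_neg, zpow_one, neg_neg] at hwave ⊢
      field_simp at hwave ⊢
      linear_combination (q * w (s ∘ e) * (ξ u - 1)) * hwave +
        (amp p q e ξ * wave p q e Y Ψ ξ * (ξ u - 1)) * h3
    · have h3 := (hw u v huv (s ∘ e) (s.injective.comp he)).2 (hru.2 hv) (fun h => hu (hrv.1 h))
      have h4 : s ∘ s ∘ e = e := by funext a; simp [hs]
      rw [← hs, h4] at h3
      rw [amp_swap_comp_of_notMem ξ huv e (Or.inl hu)] at hwave
      simp only [hu, hv, if_true, if_false, zpow_neg, zpow_one, neg_neg] at hwave ⊢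
      field_simp at hwave ⊢
      linear_combination (p * w (s ∘ e) * (1 - ξ v)) * hwave +
        (amp p q e ξ * wave p q e Y Ψ ξ * ξ v * (ξ v - 1)) * h3
    · simp [hu, hv]
  have h3 := self_eq_neg.1 h2
  rw [h3] at h1
  have hp : (p : ℂ) = 1 - q := by rw [eq_sub_iff_add_eq]; exact_mod_cast hpq
  rw [hp] at h1 ⊢
  linear_combination h1

/-- The action of the free generator on a superposition of plane waves. -/
theorem bethe_free_generator {p q R : ℝ} (hpq : p + q = 1) (hR : IsLargeRadius p q R)
    (w : (Fin r → Fin N) → ℂ) (Y : Fin N → ℤ) {Ψ : (Fin r → ℂ) → ℂ}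
    (hΨ : ContinuousOn Ψ (torus (Fin r) R)) :
    ∑ i, (p * bethe p q R w (Function.update Y i (Y i + 1)) Ψ +
      q * bethe p q R w (Function.update Y i (Y i + -1)) Ψ - bethe p q R w Y Ψ) =
      bethe p q R w Y (fun ζ => Ψ ζ * ∑ a, ε p q (ζ a)) := by
  have hp : (p : ℂ) = 1 - q := by rw [eq_sub_iff_add_eq]; exact_mod_cast hpq
  have h1 : ∀ i, p * bethe p q R w (Function.update Y i (Y i + 1)) Ψ +
      q * bethe p q R w (Function.update Y i (Y i + -1)) Ψ - bethe p q R w Y Ψ =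
      ∑ e, w e * ∫ ξ, wave p q e Y Ψ ξ * (if i ∈ Set.range e then ε p q (ξ i) else 0)
        ∂torusMeasure (Fin N) R := by
    intro i
    have h2 : p * bethe p q R w (Function.update Y i (Y i + 1)) Ψ +
      q * bethe p q R w (Function.update Y i (Y i + -1)) Ψ - bethe p q R w Y Ψ =
      p * (bethe p q R w (Function.update Y i (Y i + 1)) Ψ - bethe p q R w Y Ψ) +
      q * (bethe p q R w (Function.update Y i (Y i + -1)) Ψ - bethe p q R w Y Ψ) := by
      rw [hp]; ring
    rw [h2, bethe_update_sub hR w Y hΨ, bethe_update_sub hR w Y hΨ, Finset.mul_sum, Finset.mul_sum,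
      ← Finset.sum_add_distrib]
    refine Finset.sum_congr rfl fun e _ => ?_
    rw [mul_left_comm, mul_left_comm (q : ℂ), ← mul_add, ← integral_const_mul, ← integral_const_mul,
      ← integral_add ((integrable_wave_mul hR e Y hΨ i 1).const_mul _)
        ((integrable_wave_mul hR e Y hΨ i (-1)).const_mul _)]
    congr 2
    funext ξ
    split_ifs
    · simp only [ε, zpow_neg, zpow_one, neg_neg, hp]; ring
    · ring
  simp_rw [h1]
  rw [Finset.sum_comm, bethe]
  refine Finset.sum_congr rfl fun e _ => ?_
  rw [← Finset.mul_sum, ← integral_finsetSum]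
  · congr 2
    funext ξ
    by_cases he : Function.Injective e
    · rw [← Finset.mul_sum]
      have : ∑ i, (if i ∈ Set.range e then ε p q (ξ i) else 0) = ∑ a, ε p q (ξ (e a)) := by
        classical
        rw [← Finset.sum_filter]
        have : (univ.filter fun i => i ∈ Set.range e) = univ.image e := by ext; simp
        rw [this, Finset.sum_image fun a _ b _ h => he h]
      rw [this]
      simp only [wave, Function.comp_apply]; ring
    · simp [wave_eq_zero he]
  · intro i _
    refine integrable_of_continuousOn_torus (by linarith [hR.1])
      ((continuousOn_wave hR e Y hΨ).mul ?_)
    split_ifs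
    · unfold ε
      refine ((continuousOn_const.mul ?_).add (by fun_prop)).sub continuousOn_const
      exact ContinuousOn.inv₀ (by fun_prop) fun ξ hξ => ne_zero_of_mem_torus hR.1 hξ i
    · exact continuousOn_const

/-! ### Integration over one variable -/

theorem aestronglyMeasurable_circleMeasure {R : ℝ} (hR : 0 ≤ R) {φ : ℂ → ℂ}
    (hφ : ContinuousOn φ (Metric.sphere 0 R)) : AEStronglyMeasurable φ (circleMeasure R) := by
  have h := hφ.aestronglyMeasurable (μ := circleMeasure R) Metric.isClosed_sphere.measurableSet
  rwa [Measure.restrict_eq_self_of_ae_mem] at h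
  simpa using ae_norm_circleMeasure hR

theorem integral_circleMeasure {R : ℝ} (hR : 0 ≤ R) {φ : ℂ → ℂ}
    (hφ : ContinuousOn φ (Metric.sphere 0 R)) :
    ∫ z, φ z ∂circleMeasure R = Real.circleAverage φ 0 R := by
  have h := aestronglyMeasurable_circleMeasure hR hφ
  rw [circleMeasure] at h ⊢
  rw [integral_map (measurable_circleMap R).aemeasurable h, angleMeasure, integral_smul_measure,
    ENNReal.toReal_ofReal (by positivity), integral_Icc_eq_integral_Ioc,
    ← intervalIntegral.integral_of_le (by positivity), Real.circleAverage]

/-- Inversion maps the circle of radius `R` to that of radius `R⁻¹` and reverses the angle.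
Analyticity outside the large circle becomes analyticity in a disc, where the mean value property
applies. -/
theorem integral_circleMeasure_inv {R : ℝ} (hR : 0 < R) {φ : ℂ → ℂ}
    (hφ : ContinuousOn φ (Metric.sphere 0 R⁻¹)) :
    ∫ z, φ z⁻¹ ∂circleMeasure R = Real.circleAverage φ 0 R⁻¹ := by
  have hc : ContinuousOn (fun z : ℂ => φ z⁻¹) (Metric.sphere 0 R) := by
    refine hφ.comp (ContinuousOn.inv₀ continuousOn_id fun z hz => ?_) fun z hz => ?_
    · rw [← norm_pos_iff]
      simp at hz ⊢
      rintro rfl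
      simp at hz
      linarith
    · simp at hz ⊢; exact hz
  rw [integral_circleMeasure hR.le hc, Real.circleAverage, Real.circleAverage]
  congr 1
  have h1 : ∀ θ : ℝ, (circleMap 0 R θ)⁻¹ = circleMap 0 R⁻¹ (-θ) := by
    intro θ
    simp [circleMap, Complex.exp_neg, mul_comm]
  simp_rw [h1]
  rw [intervalIntegral.integral_comp_neg (fun θ => φ (circleMap 0 R⁻¹ θ)), neg_zero]
  have hp : Function.Periodic (fun θ => φ (circleMap 0 R⁻¹ θ)) (2 * Real.pi) := fun θ => by
    simp only [periodic_circleMap 0 R⁻¹ θ]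
  have := hp.intervalIntegral_add_eq (-(2 * Real.pi)) 0
  simpa using this

theorem integral_circleMeasure_pow {R : ℝ} (hR : 0 < R) {k : ℕ} (hk : k ≠ 0) :
    ∫ z, z ^ k ∂circleMeasure R = 0 := by
  rw [integral_circleMeasure hR.le (by fun_prop)]
  have h : DiffContOnCl ℂ (fun z : ℂ => z ^ k) (Metric.ball 0 |R|) :=
    Differentiable.diffContOnCl (by fun_prop)
  rw [h.circleAverage]
  simp [hk]

theorem integral_circleMeasure_inv_pow_mul {R : ℝ} (hR : 0 < R) {k : ℕ} (hk : k ≠ 0) {ψ : ℂ → ℂ}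
    (hψ : DifferentiableOn ℂ ψ (Metric.closedBall 0 R⁻¹)) :
    ∫ z, z⁻¹ ^ k * ψ z⁻¹ ∂circleMeasure R = 0 := by
  have hd : DifferentiableOn ℂ (fun z => z ^ k * ψ z) (Metric.closedBall 0 R⁻¹) :=
    (by fun_prop : DifferentiableOn ℂ (fun z : ℂ => z ^ k) _).mul hψ
  rw [integral_circleMeasure_inv (φ := fun z => z ^ k * ψ z) hR
    (hd.continuousOn.mono Metric.sphere_subset_closedBall)]
  have h : DiffContOnCl ℂ (fun z => z ^ k * ψ z) (Metric.ball 0 |R⁻¹|) := by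
    refine DifferentiableOn.diffContOnCl ?_
    have hR' : 0 < R⁻¹ := inv_pos.2 hR
    rwa [abs_of_pos hR', closure_ball _ hR'.ne']
  rw [h.circleAverage]
  simp [hk]

theorem integral_torus_eq_zero {R : ℝ} (hR : 1 < R) {F : (Fin N → ℂ) → ℂ}
    (hF : ContinuousOn F (torus (Fin N) R)) (b : Fin N)
    (h : ∀ ξ ∈ torus (Fin N) R, ∫ z, F (Function.update ξ b z) ∂circleMeasure R = 0) :
    ∫ ξ, F ξ ∂torusMeasure (Fin N) R = 0 := by
  have hR0 : 0 ≤ R := by linarith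
  obtain _ | M := N
  · exact b.elim0
  have hmp := (measurePreserving_piFinSuccAbove (fun _ : Fin (M + 1) => circleMeasure R) b).symm
  have hint := integrable_of_continuousOn_torus hR0 hF
  rw [torusMeasure] at hint ⊢
  rw [← hmp.integral_comp']
  rw [← hmp.integrable_comp_emb (MeasurableEquiv.measurableEmbedding _)] at hint
  refine (integral_prod_symm _ hint).trans ?_
  refine integral_eq_zero_of_ae ((ae_mem_torus hR0 (ι := Fin M)).mono fun y hy => ?_)
  have hmem : b.insertNth (R : ℂ) y ∈ torus (Fin (M + 1)) R := by
    rw [mem_torus] at hy ⊢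
    intro i
    induction i using b.succAboveCases with
    | x => simpa using hR0
    | p i => simpa using hy i
  have := h _ hmem
  simp only [Fin.update_insertNth] at this
  exact this

/-! ### Amplitudes in the inverse variables -/

/-- The scattering factor in terms of the inverse variables. -/
def scatInv (p q : ℝ) (ζ : Fin N → ℂ) (i j : Fin N) : ℂ :=
  if i = j then 0 else if i < j then 1 else
    -((q + p * ζ i * ζ j - ζ j) / (q + p * ζ j * ζ i - ζ i))

theorem scat_eq_scatInv (p q : ℝ) {ξ : Fin N → ℂ} (hξ : ∀ i, ξ i ≠ 0) (i j : Fin N) :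
    scat p q ξ i j = scatInv p q (fun a => (ξ a)⁻¹) i j := by
  have hi := hξ i
  have hj := hξ j
  have h1 : f p q (ξ i) (ξ j) = ξ i * ξ j * (q + p * (ξ i)⁻¹ * (ξ j)⁻¹ - (ξ j)⁻¹) := by
    unfold f; field_simp; ring
  have h2 : f p q (ξ j) (ξ i) = ξ i * ξ j * (q + p * (ξ j)⁻¹ * (ξ i)⁻¹ - (ξ i)⁻¹) := by
    unfold f; field_simp; ring
  rw [scat, scatInv, h1, h2, mul_div_mul_left _ _ (mul_ne_zero hi hj)]

/-- `f` vanishes at `ξ = -R`, `ξ' = (1 + p / R) / q`. As `‖ξ‖ = R`, the largeness of `R` forces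
`‖ξ'‖ < R`. -/
theorem IsLargeRadius.lt {p q R : ℝ} (hR : IsLargeRadius p q R) (hp : 0 ≤ p) (hq : 0 < q) :
    1 + p / R < q * R := by
  have hR0 : 0 < R := by linarith [hR.1]
  by_contra! h
  refine hR.2 (-R : ℂ) (((1 + p / R) / q : ℝ) : ℂ) ?_ ?_ ?_
  · simp [abs_of_pos hR0]
  · rw [Complex.norm_real, Real.norm_of_nonneg (by positivity), le_div_iff₀ hq]; linarith
  · have h1 : (q : ℂ) ≠ 0 := by exact_mod_cast hq.ne'
    have h2 : (R : ℂ) ≠ 0 := by exact_mod_cast hR0.ne'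
    unfold f
    push_cast
    field_simp
    ring

/-- A zero would give `q = w * (1 - p * z)`, whose norm is at most `R⁻¹ * (1 + p / R) < q` by
`IsLargeRadius.lt`. So the amplitudes are analytic in the inverse variables on the closed disc of
radius `R⁻¹`. -/
theorem IsLargeRadius.inv_ne_zero {p q R : ℝ} (hR : IsLargeRadius p q R) (hp : 0 ≤ p)
    (hq : 0 < q) {z w : ℂ} (hz : ‖z‖ ≤ R⁻¹) (hw : ‖w‖ ≤ R⁻¹) : (q : ℂ) + p * z * w - w ≠ 0 := by
  have hR0 : 0 < R := by linarith [hR.1]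
  intro h
  have h1 : (q : ℂ) = w * (1 - p * z) := by linear_combination h
  have h2 : q ≤ R⁻¹ * (1 + p * R⁻¹) := by
    calc q = ‖w * (1 - p * z)‖ := by rw [← h1, Complex.norm_real, Real.norm_of_nonneg hq.le]
      _ = ‖w‖ * ‖1 - p * z‖ := norm_mul _ _
      _ ≤ R⁻¹ * (1 + p * R⁻¹) := by
        refine mul_le_mul hw ((norm_sub_le _ _).trans ?_) (norm_nonneg _) (by positivity)
        rw [norm_one, norm_mul, Complex.norm_real, Real.norm_of_nonneg hp]
        gcongr
  have h3 := hR.lt hp hq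
  rw [← div_eq_mul_inv] at h2
  have h4 : R⁻¹ * (1 + p / R) * R = 1 + p / R := by field_simp
  nlinarith

/-- A plane wave integrates to zero if it carries a factor `ξ b ^ k` with `k < 0`. -/
theorem integral_wave_eq_zero {p q R : ℝ} (hp : 0 ≤ p) (hq : 0 < q) (hR : IsLargeRadius p q R)
    (e : Fin r → Fin N) (Y : Fin N → ℤ) (X : Fin r → ℤ) {a : Fin r} (ha : X a < Y (e a)) :
    ∫ ξ, wave p q e Y (fun ζ => ∏ a, ζ a ^ X a) ξ ∂torusMeasure (Fin N) R = 0 := by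
  have hR0 : 0 < R := by linarith [hR.1]
  by_cases he : Function.Injective e
  swap
  · simp [wave_eq_zero he]
  refine integral_torus_eq_zero hR.1 (continuousOn_wave hR e Y
    (continuousOn_finsetProd _ fun _ _ => continuousOn_coord_zpow hR.1 _ _)) (e a) fun ξ hξ => ?_
  obtain ⟨k, hk⟩ : ∃ k : ℕ, Y (e a) - X a = k := ⟨_, (Int.toNat_of_nonneg (by omega)).symm⟩
  have hk0 : k ≠ 0 := by omega
  -- The amplitude as a function of the inverse `z` of the variable `ξ (e a)`, the others being
  -- fixed. It is analytic in the disc, and the remaining power of `z` is `k = Y (e a) - X a > 0`,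
  -- so the mean over the circle is the value zero at the centre.
  set ψ : ℂ → ℂ := fun z =>
    pairProd fun c d => scatInv p q (Function.update (fun i => (ξ i)⁻¹) (e a) z) (e c) (e d)
  set C : ℂ := ∏ c ∈ univ.erase a, ξ (e c) ^ (X c - Y (e c))
  have hup : ∀ z ∈ Metric.closedBall (0 : ℂ) R⁻¹, ∀ i,
      ‖Function.update (fun i => (ξ i)⁻¹) (e a) z i‖ ≤ R⁻¹ := by
    intro z hz i
    by_cases hi : i = e a
    · subst hi; simpa using hz
    · rw [Function.update_of_ne hi, norm_inv, mem_torus.1 hξ]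
  have hψ : DifferentiableOn ℂ ψ (Metric.closedBall 0 R⁻¹) := by
    refine DifferentiableOn.fun_finsetProd fun x _ => ?_
    have hcoord : ∀ i, DifferentiableOn ℂ
        (fun z => Function.update (fun i => (ξ i)⁻¹) (e a) z i) (Metric.closedBall 0 R⁻¹) := by
      intro i
      by_cases hi : i = e a
      · subst hi; simpa using! differentiableOn_id
      · simp only [Function.update_of_ne hi]; exact differentiableOn_const _
    dsimp only [scatInv]
    split_ifs
    · exact differentiableOn_const _
    · exact differentiableOn_const _
    · refine (DifferentiableOn.div ?_ ?_ fun z hz => ?_).neg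
      · exact (((hcoord _).const_mul _).mul (hcoord _)).const_add _ |>.sub (hcoord _)
      · exact (((hcoord _).const_mul _).mul (hcoord _)).const_add _ |>.sub (hcoord _)
      · exact hR.inv_ne_zero hp hq (hup z hz _) (hup z hz _)
  have h1 := integral_circleMeasure_inv_pow_mul hR0 hk0 hψ
  have h2 : ∀ᵐ z ∂circleMeasure R, wave p q e Y (fun ζ => ∏ a, ζ a ^ X a)
      (Function.update ξ (e a) z) = C * (z⁻¹ ^ k * ψ z⁻¹) := by
    refine (ae_norm_circleMeasure hR0.le).mono fun z hz => ?_
    have hz0 : z ≠ 0 := by rw [← norm_pos_iff, hz]; exact hR0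
    have hu0 : ∀ i, Function.update ξ (e a) z i ≠ 0 := by
      intro i
      by_cases hi : i = e a
      · subst hi; simpa using hz0
      · rw [Function.update_of_ne hi]; exact ne_zero_of_mem_torus hR.1 hξ i
    have h3 : amp p q e (Function.update ξ (e a) z) = ψ z⁻¹ := by
      refine pairProd_congr fun c d _ => ?_
      rw [scat_eq_scatInv p q hu0]
      congr 1
      funext i
      by_cases hi : i = e a
      · subst hi; simp
      · simp [Function.update_of_ne hi]
    have h4 : (∏ c, (Function.update ξ (e a) z ∘ e) c ^ X c) *
        ∏ c, Function.update ξ (e a) z (e c) ^ (-Y (e c)) = z⁻¹ ^ k * C := by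
      rw [← Finset.prod_mul_distrib, ← Finset.mul_prod_erase univ _ (mem_univ a)]
      refine congrArg₂ _ ?_ (Finset.prod_congr rfl fun c hc => ?_)
      · rw [Function.comp_apply, Function.update_self, ← zpow_add₀ hz0, inv_pow, ← zpow_natCast,
          ← zpow_neg, ← hk]
        congr 1; ring
      · rw [Function.comp_apply, Function.update_of_ne fun h => (Finset.mem_erase.1 hc).1 (he h),
          ← zpow_add₀ (ne_zero_of_mem_torus hR.1 hξ _), sub_eq_add_neg]
    rw [wave, h3, mul_assoc, h4]
    ring
  rw [integral_congr_ae h2, integral_const_mul, h1, mul_zero]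

/-- A pure monomial integrates to zero if it carries a factor `ξ b ^ k` with `k ≠ 0`. -/
theorem integral_prod_zpow {R : ℝ} (hR : 1 < R) (k : Fin N → ℤ) :
    ∫ ξ, ∏ i, ξ i ^ k i ∂torusMeasure (Fin N) R = if k = 0 then 1 else 0 := by
  have hR0 : 0 < R := by linarith
  split_ifs with h
  · simp [h]
  · obtain ⟨b, hb⟩ := Function.ne_iff.1 h
    refine integral_torus_eq_zero hR (continuousOn_finsetProd _ fun _ _ =>
      continuousOn_coord_zpow hR _ _) b fun ξ _ => ?_
    have h1 : ∀ z, ∏ i, Function.update ξ b z i ^ k i =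
        (∏ i ∈ univ.erase b, ξ i ^ k i) * z ^ k b := by
      intro z
      rw [← Finset.mul_prod_erase univ _ (mem_univ b), Function.update_self, mul_comm]
      refine congrArg₂ _ (Finset.prod_congr rfl fun c hc => ?_) rfl
      rw [Function.update_of_ne (Finset.mem_erase.1 hc).1]
    simp_rw [h1]
    rw [integral_const_mul]
    refine mul_eq_zero_of_right _ ?_
    have hb0 : k b ≠ 0 := hb
    rcases lt_or_gt_of_ne hb0 with h2 | h2
    · obtain ⟨n, hn⟩ : ∃ n : ℕ, -k b = n := ⟨_, (Int.toNat_of_nonneg (by omega)).symm⟩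
      have := integral_circleMeasure_inv_pow_mul hR0 (k := n) (by omega) (ψ := fun _ => 1)
        (differentiableOn_const _)
      rw [← this]
      congr 1; funext z
      rw [mul_one, inv_pow, ← zpow_natCast, ← zpow_neg, ← hn, neg_neg]
    · obtain ⟨n, hn⟩ : ∃ n : ℕ, k b = n := ⟨_, (Int.toNat_of_nonneg (by omega)).symm⟩
      have := integral_circleMeasure_pow hR0 (k := n) (by omega)
      simpa [hn] using this

/-! ### Legal moves -/

theorem val_succ_eq_of_apply_eq_add_one {Z : Fin N → ℤ} (hZ : StrictMono Z) {i j : Fin N}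
    (h : Z j = Z i + 1) : (i : ℕ) + 1 = j := by
  have h1 : i < j := hZ.lt_iff_lt.1 (by omega)
  by_contra h2
  have h3 : (i : ℕ) + 1 < j := by have := Fin.lt_def.1 h1; omega
  have h4 := hZ (show i < ⟨i + 1, by omega⟩ from by rw [Fin.lt_def]; simp)
  have h5 := hZ (show (⟨i + 1, by omega⟩ : Fin N) < j from by rw [Fin.lt_def]; simpa using h3)
  omega

theorem strictMono_update_one_iff {Z : Fin N → ℤ} (hZ : StrictMono Z) (i : Fin N) (d : ℤˣ) :
    StrictMono (Function.update Z i (Z i + d)) ↔ ¬ ∃ j, Z j = Z i + d := by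
  constructor
  · rintro h ⟨j, hj⟩
    have hji : j ≠ i := by
      rintro rfl
      have : (d : ℤ) ≠ 0 := d.ne_zero
      omega
    refine hji (h.injective ?_)
    rw [Function.update_of_ne hji, Function.update_self, hj]
  · intro h
    exact strictMono_update ⟨Z, hZ⟩ i d (by simpa using h)

open Classical in
-- A particle blocked on its right and the particle blocking it form an adjacent pair `u`, `v`; the
-- latter is blocked on its left. Rewriting both sums over such pairs, each pair contributes `a u +
-- b v`.
theorem sum_blocked_eq_zero {M : Type*} [AddCommMonoid M] {Z : Fin N → ℤ} (hZ : StrictMono Z)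
    (a b : Fin N → M)
    (h : ∀ u v : Fin N, (u : ℕ) + 1 = v → Z v = Z u + 1 → a u + b v = 0) :
    ∑ i, (if ∃ j, Z j = Z i + 1 then a i else 0) +
      ∑ i, (if ∃ j, Z j = Z i + -1 then b i else 0) = 0 := by
  have h1 : ∀ i, (if ∃ j, Z j = Z i + 1 then a i else 0) =
      ∑ j, if Z j = Z i + 1 then a i else 0 := by
    intro i
    split_ifs with hi
    · obtain ⟨j, hj⟩ := hi
      rw [Finset.sum_eq_single j, if_pos hj]
      · intro k _ hk
        rw [if_neg fun h' => hk (hZ.injective (h'.trans hj.symm))]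
      · simp
    · rw [Finset.sum_eq_zero]
      intro j _
      rw [if_neg fun h' => hi ⟨j, h'⟩]
  have h2 : ∀ i, (if ∃ j, Z j = Z i + -1 then b i else 0) =
      ∑ j, if Z i = Z j + 1 then b i else 0 := by
    intro i
    split_ifs with hi
    · obtain ⟨j, hj⟩ := hi
      rw [Finset.sum_eq_single j, if_pos (by omega)]
      · intro k _ hk
        rw [if_neg fun h' => hk (hZ.injective (by omega))]
      · simp
    · rw [Finset.sum_eq_zero]
      intro j _
      rw [if_neg fun h' => hi ⟨j, by omega⟩]
  simp_rw [h1, h2]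
  rw [Finset.sum_comm (f := fun i j => if Z i = Z j + 1 then b i else 0), ← Finset.sum_add_distrib]
  refine Finset.sum_eq_zero fun i _ => ?_
  rw [← Finset.sum_add_distrib]
  refine Finset.sum_eq_zero fun j _ => ?_
  split_ifs with hij
  · exact h i j (val_succ_eq_of_apply_eq_add_one hZ hij) hij
  · simp

/-- The number of pairs of adjacent particles. -/
def blocked (Z : Fin N → ℤ) : ℂ :=
  open Classical in ∑ i, if ∃ j, Z j = Z i + 1 then 1 else 0

open Classical in
/-- With the boundary condition, the free generator acts by the legal moves. -/
theorem sum_free_eq_sum_legal {Z : Fin N → ℤ} (hZ : StrictMono Z) (a b : Fin N → ℂ) (c : ℂ)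
    (h : ∀ u v : Fin N, (u : ℕ) + 1 = v → Z v = Z u + 1 → a u + b v = c) :
    ∑ i, (a i + b i - c) =
      ∑ i, (if StrictMono (Function.update Z i (Z i + 1)) then a i else 0) +
      ∑ i, (if StrictMono (Function.update Z i (Z i + -1)) then b i else 0) -
        (N - blocked Z) * c := by
  -- Subtracting the `c` of the boundary condition from the right moves only leaves one diagonal
  -- term `c` per adjacent pair, which is how `blocked` enters.
  have h1 := sum_blocked_eq_zero hZ (fun i => a i - c) b fun u v huv hZuv => by
    linear_combination h u v huv hZuv
  have h2 : ∀ i, (if StrictMono (Function.update Z i (Z i + 1)) then a i else 0) =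
      a i - (if ∃ j, Z j = Z i + 1 then a i - c else 0) -
        (if ∃ j, Z j = Z i + 1 then 1 else 0) * c := by
    intro i
    have := strictMono_update_one_iff hZ i 1
    simp only [Units.val_one] at this
    by_cases hb : ∃ j, Z j = Z i + 1
    · rw [if_neg fun h => this.1 h hb, if_pos hb, if_pos hb]; ring
    · rw [if_pos (this.2 hb), if_neg hb, if_neg hb]; ring
  have h3 : ∀ i, (if StrictMono (Function.update Z i (Z i + -1)) then b i else 0) =
      b i - (if ∃ j, Z j = Z i + -1 then b i else 0) := by
    intro i
    have := strictMono_update_one_iff hZ i (-1)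
    simp only [Units.val_neg, Units.val_one] at this
    by_cases hb : ∃ j, Z j = Z i + -1
    · rw [if_neg fun h => this.1 h hb, if_pos hb]; ring
    · rw [if_pos (this.2 hb), if_neg hb]; ring
  simp_rw [h2, h3]
  simp only [Finset.sum_sub_distrib, Finset.sum_add_distrib, ← Finset.sum_mul, blocked] at h1 ⊢
  simp only [Finset.sum_const, card_univ, Fintype.card_fin, nsmul_eq_mul]
  linear_combination h1

/-! ### An induction on the gaps -/

/-- The relation solves for one right move of `X` in terms of the other right moves and of `X`
itself, because left moves of `Y` preserve the level `d`. Starting from exponents with large gaps,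
the gap conditions are removed one at a time, from the rightmost gap to the leftmost, each removal
requiring larger gaps further left. -/
theorem eq_zero_of_gaps {D : (Fin N → ℤ) → (Fin N → ℤ) → ℂ} (d : ℤ)
    (hfar : ∀ X Y, StrictMono X → StrictMono Y →
      (∀ u v : Fin N, (u : ℕ) + 1 = v → d < X v - X u) → ∑ i, X i = ∑ i, Y i + d → D Y X = 0)
    (hrel : ∀ X Y, StrictMono X → StrictMono Y → ∑ i, X i = ∑ i, Y i + (d - 1) →
      (open Classical in
      ∑ i, (if StrictMono (Function.update Y i (Y i + -1)) then
          D (Function.update Y i (Y i + -1)) X else 0) =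
        ∑ i, (if StrictMono (Function.update X i (X i + 1)) then
          D Y (Function.update X i (X i + 1)) else 0)))
    {X Y : Fin N → ℤ} (hX : StrictMono X) (hY : StrictMono Y)
    (hXY : ∑ i, X i = ∑ i, Y i + d) : D Y X = 0 := by
  classical
  set Good : (Fin N → ℤ) → Prop := fun X => ∀ Y, StrictMono Y → ∑ i, X i = ∑ i, Y i + d → D Y X = 0
    with hGood
  have hsum : ∀ (Z : Fin N → ℤ) (i : Fin N) (c : ℤ),
      ∑ k, Function.update Z i (Z i + c) k = ∑ k, Z k + c := by
    intro Z i c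
    rw [Finset.sum_update_of_mem (mem_univ i), ← Finset.add_sum_erase univ Z (mem_univ i),
      Finset.sdiff_singleton_eq_erase]
    ring
  -- In the relation at level `d - 1`, the left side vanishes since `X` is good, and on the right
  -- only the move of `j` survives.
  have step : ∀ (X : Fin N → ℤ) (j : Fin N), StrictMono X →
      StrictMono (Function.update X j (X j + 1)) → Good X →
      (∀ i, i ≠ j → StrictMono (Function.update X i (X i + 1)) →
        Good (Function.update X i (X i + 1))) → Good (Function.update X j (X j + 1)) := by
    intro X j hX hXj hgood hother Y hY hd
    rw [hsum] at hd
    have h := hrel X Y hX hY (by omega)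
    rw [Finset.sum_eq_zero, Finset.sum_eq_single j, if_pos hXj] at h
    · exact h.symm
    · intro i _ hij
      split_ifs with hXi
      · exact hother i hij hXi Y hY (by rw [hsum]; exact hd)
      · rfl
    · simp
    · intro i _
      split_ifs with hYi
      · exact hgood _ hYi (by rw [hsum]; omega)
      · rfl
  -- After `k` steps only the gaps to the right of indices below `N - k` are constrained; for `k =
  -- N` no condition is left.
  have main : ∀ k : ℕ, k ≤ N → ∃ L : ℤ, ∀ X, StrictMono X →
      (∀ u v : Fin N, (u : ℕ) + 1 = v → (u : ℕ) < N - k → L ≤ X v - X u) → Good X := by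
    intro k
    induction k with
    | zero =>
      intro _
      refine ⟨d + 1, fun X hX hgap Y hY hd => hfar X Y hX hY (fun u v huv => ?_) hd⟩
      have := hgap u v huv (by have := u.2; omega)
      omega
    | succ k ih =>
      intro hk
      obtain ⟨L, hL⟩ := ih (by omega)
      set j : Fin N := ⟨N - (k + 1), by omega⟩ with hj
      -- The gap to the right of `j` is allowed to shrink from `L` to `L - m`, one unit at a time.
      have inner : ∀ m : ℕ, ∃ L' : ℤ, 2 ≤ L' ∧ ∀ X, StrictMono X →
          (∀ u v : Fin N, (u : ℕ) + 1 = v → (u : ℕ) < j → L' ≤ X v - X u) →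
          (∀ v : Fin N, (j : ℕ) + 1 = v → L - m ≤ X v - X j) → Good X := by
        intro m
        induction m with
        | zero =>
          refine ⟨max L 2, le_max_right _ _, fun X hX h1 h2 => hL X hX fun u v huv hu => ?_⟩
          by_cases huj : u = j
          · subst huj; simpa using h2 v huv
          · have hne : (u : ℕ) ≠ j := fun h => huj (Fin.ext h)
            have hjv : (j : ℕ) = N - (k + 1) := rfl
            exact (le_max_left _ _).trans (h1 u v huv (by omega))
        | succ m ihm =>
          obtain ⟨L', hL2, hL'⟩ := ihm
          refine ⟨L' + 2, by omega, fun X hX h1 h2 => ?_⟩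
          by_cases hcase : ∀ v : Fin N, (j : ℕ) + 1 = v → L - m ≤ X v - X j
          · exact hL' X hX (fun u v huv hu => by have := h1 u v huv hu; omega) hcase
          -- Moving `j` back widens the critical gap by one, so `X'` is good by induction; any other
          -- right move of `X'` does not narrow that gap. A gap further left loses at most two
          -- units, one at each end, which explains `L' + 2`.
          set X' := Function.update X j (X j + -1) with hX'
          have hX'j : X' j = X j + -1 := Function.update_self _ _ _
          have hX'ne : ∀ i, i ≠ j → X' i = X i := fun i hi => Function.update_of_ne hi _ _
          have hback : Function.update X' j (X' j + 1) = X := by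
            funext i
            by_cases hi : i = j
            · subst hi; rw [Function.update_self, hX'j]; ring
            · rw [Function.update_of_ne hi, hX'ne i hi]
          have hX's : StrictMono X' := by
            have := (strictMono_update_one_iff hX j (-1)).2
            simp only [Units.val_neg, Units.val_one] at this
            refine this ?_
            rintro ⟨i, hi⟩
            have h3 : X j = X i + 1 := by omega
            have h4 := val_succ_eq_of_apply_eq_add_one hX h3
            have := h1 i j h4 (by omega)
            omega
          rw [← hback]
          refine step X' j hX's (by rw [hback]; exact hX) ?_ ?_
          · refine hL' X' hX's (fun u v huv hu => ?_) fun v hv => ?_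
            · have h3 := h1 u v huv hu
              have huj : u ≠ j := by rintro rfl; omega
              rw [hX'ne u huj]
              by_cases hvj : v = j
              · subst hvj; omega
              · rw [hX'ne v hvj]; omega
            · have h3 := h2 v hv
              have hvj : v ≠ j := by rintro rfl; omega
              rw [hX'ne v hvj, hX'j]; push_cast at h3; omega
          · intro i hij hXi
            have hval : ∀ w, Function.update X' i (X' i + 1) w = X w + (if w = i then 1 else 0) -
                (if w = j then 1 else 0) := by
              intro w
              by_cases hwi : w = i
              · subst hwi
                simp [hX'ne w hij, hij]
              · by_cases hwj : w = j
                · subst hwj; simp [hwi, hX'j]; ring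
                · simp [hwi, hwj, hX'ne w hwj]
            refine hL' _ hXi (fun u v huv hu => ?_) fun v hv => ?_
            · have h3 := h1 u v huv hu
              rw [hval, hval]
              split_ifs <;> omega
            · have h3 := h2 v hv
              have hvj : v ≠ j := by rintro rfl; omega
              rw [hval, hval, if_neg hvj, if_neg hij.symm, if_pos rfl]
              push_cast at h3
              split_ifs <;> omega
      -- For this number of steps the bound on the critical gap is at most one, and strict
      -- monotonicity provides it.
      obtain ⟨L', _, hL'⟩ := inner (L - 1).toNat
      refine ⟨L', fun X hX h1 => hL' X hX (fun u v huv hu => h1 u v huv (by simpa [hj] using hu))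
        fun v hv => ?_⟩
      have h3 : X j < X v := hX (by rw [Fin.lt_def]; omega)
      have := Int.self_le_toNat (L - 1)
      omega
  obtain ⟨L, hL⟩ := main N le_rfl
  exact hL X hX (fun u v _ hu => by omega) Y hY hXY

/-! ### Orthogonality -/

theorem continuousOn_monomial {R : ℝ} (hR : 1 < R) {ι : Type*} [Fintype ι] (X : ι → ℤ) :
    ContinuousOn (fun ζ : ι → ℂ => ∏ a, ζ a ^ X a) (torus ι R) :=
  continuousOn_finsetProd _ fun _ _ => continuousOn_coord_zpow hR _ _

theorem prod_zpow_update {ι : Type*} [Fintype ι] [DecidableEq ι] {ζ : ι → ℂ} (hζ : ∀ i, ζ i ≠ 0)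
    (X : ι → ℤ) (i : ι) (d : ℤ) :
    ∏ a, ζ a ^ Function.update X i (X i + d) a = (∏ a, ζ a ^ X a) * ζ i ^ d := by
  rw [← Finset.mul_prod_erase univ _ (mem_univ i), Function.update_self, zpow_add₀ (hζ i),
    ← Finset.mul_prod_erase univ (fun a => ζ a ^ X a) (mem_univ i)]
  have : ∏ x ∈ univ.erase i, ζ x ^ Function.update X i (X i + d) x =
      ∏ x ∈ univ.erase i, ζ x ^ X x := Finset.prod_congr rfl fun c hc => by
    rw [Function.update_of_ne (Finset.mem_erase.1 hc).1]
  rw [this]; ring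

theorem bethe_sum {p q R : ℝ} (hR : IsLargeRadius p q R) (w : (Fin r → Fin N) → ℂ)
    (Y : Fin N → ℤ) {κ : Type*} (s : Finset κ) {Ψ : κ → (Fin r → ℂ) → ℂ}
    (hΨ : ∀ k ∈ s, ContinuousOn (Ψ k) (torus (Fin r) R)) :
    bethe p q R w Y (fun ζ => ∑ k ∈ s, Ψ k ζ) = ∑ k ∈ s, bethe p q R w Y (Ψ k) := by
  classical
  induction s using Finset.induction_on with
  | empty =>
    simp [bethe, wave]
  | insert a s ha ih =>
    rw [Finset.sum_insert ha, ← ih fun k hk => hΨ k (Finset.mem_insert_of_mem hk),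
      ← bethe_add hR w Y (hΨ a (Finset.mem_insert_self a s))]
    · refine bethe_congr hR.1 w Y fun ζ _ => ?_
      rw [Finset.sum_insert ha]
    · exact continuousOn_finsetSum _ fun k hk => hΨ k (Finset.mem_insert_of_mem hk)

/-- The free generator in the exponents. -/
theorem bethe_free_generator_exponent {p q R : ℝ} (hR : IsLargeRadius p q R)
    (w : (Fin r → Fin N) → ℂ) (Y : Fin N → ℤ) (X : Fin r → ℤ) :
    bethe p q R w Y (fun ζ => (∏ a, ζ a ^ X a) * ∑ a, ε p q (ζ a)) =
      ∑ a, (q * bethe p q R w Y (fun ζ => ∏ b, ζ b ^ Function.update X a (X a + 1) b) +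
        p * bethe p q R w Y (fun ζ => ∏ b, ζ b ^ Function.update X a (X a + -1) b) -
        bethe p q R w Y (fun ζ => ∏ b, ζ b ^ X b)) := by
  have hc := continuousOn_monomial hR.1 (ι := Fin r)
  have h1 : bethe p q R w Y (fun ζ => (∏ a, ζ a ^ X a) * ∑ a, ε p q (ζ a)) =
      bethe p q R w Y (fun ζ => ∑ a, ((q * (∏ b, ζ b ^ Function.update X a (X a + 1) b) +
        p * (∏ b, ζ b ^ Function.update X a (X a + -1) b)) + (-1) * ∏ b, ζ b ^ X b)) := by
    refine bethe_congr hR.1 w Y fun ζ hζ => ?_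
    rw [Finset.mul_sum]
    refine Finset.sum_congr rfl fun a _ => ?_
    have h0 := ne_zero_of_mem_torus hR.1 hζ
    rw [prod_zpow_update h0, prod_zpow_update h0, ε, zpow_neg, zpow_one]
    ring
  rw [h1, bethe_sum hR]
  · refine Finset.sum_congr rfl fun a _ => ?_
    rw [bethe_add hR, bethe_add hR, bethe_const_mul, bethe_const_mul, bethe_const_mul]
    · ring
    · exact continuousOn_const.mul (hc _)
    · exact continuousOn_const.mul (hc _)
    · exact (continuousOn_const.mul (hc _)).add (continuousOn_const.mul (hc _))
    · exact continuousOn_const.mul (hc _)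
  · intro a _
    exact ((continuousOn_const.mul (hc _)).add (continuousOn_const.mul (hc _))).add
      (continuousOn_const.mul (hc _))

/-- The boundary condition of the Bethe ansatz in the exponents. -/
theorem bethe_boundary_exponent {p q R : ℝ} (hR : IsLargeRadius p q R)
    {w : (Fin r → Fin N) → ℂ} {u v : Fin r} (huv : (u : ℕ) + 1 = v)
    (hw : ∀ e, w (e ∘ Equiv.swap u v) = w e) (Y : Fin N → ℤ) {X : Fin r → ℤ}
    (hX : X v = X u + 1) :
    q * bethe p q R w Y (fun ζ => ∏ b, ζ b ^ Function.update X u (X u + 1) b) +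
      p * bethe p q R w Y (fun ζ => ∏ b, ζ b ^ Function.update X v (X v + -1) b) =
      bethe p q R w Y (fun ζ => ∏ b, ζ b ^ X b) := by
  have hc := continuousOn_monomial hR.1 (ι := Fin r)
  have huv' : u ≠ v := by rintro rfl; omega
  set X' := Function.update X v (X v + -1) with hX'
  have hXs : ∀ a, X' (Equiv.swap u v a) = X' a := by
    intro a
    have hv : X' v = X u := by rw [hX', Function.update_self]; omega
    have hu : X' u = X u := by rw [hX', Function.update_of_ne huv']
    rw [Equiv.swap_apply_def]
    split_ifs with h1 h2
    · rw [h1, hv, hu]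
    · rw [h2, hv, hu]
    · rfl
  -- `X'` has equal entries at `u` and `v`, so its monomial is symmetric there. Multiplied by `f (ζ
  -- v) (ζ u) = p + q * ζ v * ζ u - ζ v`, it yields exactly the three monomials of the boundary
  -- condition.
  have h1 := bethe_eq_zero_of_symm hR huv hw Y (h := fun ζ => ∏ a, ζ a ^ X' a) fun ζ _ => by
    refine (Equiv.prod_comp (Equiv.swap u v) _).symm.trans (Finset.prod_congr rfl fun a _ => ?_)
    simp [hXs]
  have h2 : bethe p q R w Y (fun ζ => (∏ a, ζ a ^ X' a) * f p q (ζ v) (ζ u)) =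
      bethe p q R w Y (fun ζ => (q * (∏ b, ζ b ^ Function.update X u (X u + 1) b) +
        p * (∏ b, ζ b ^ X' b)) + (-1) * ∏ b, ζ b ^ X b) := by
    refine bethe_congr hR.1 w Y fun ζ hζ => ?_
    have h0 := ne_zero_of_mem_torus hR.1 hζ
    have hv0 := h0 v
    rw [hX', prod_zpow_update h0, prod_zpow_update h0, zpow_neg, zpow_one, f]
    field_simp
    ring
  rw [h2, bethe_add hR, bethe_add hR, bethe_const_mul, bethe_const_mul, bethe_const_mul] at h1
  · linear_combination h1
  · exact continuousOn_const.mul (hc _)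
  · exact continuousOn_const.mul (hc _)
  · exact (continuousOn_const.mul (hc _)).add (continuousOn_const.mul (hc _))
  · exact continuousOn_const.mul (hc _)

/-- A nonzero contribution of `e` needs `Y (e a) ≤ X a` for all `a`, by `integral_wave_eq_zero`.
These nonnegative differences add up to `d`, so each is at most `d`; as the gaps of `X` exceed `d`,
the values `Y (e a)` increase with `a` and `e` is the identity. Its amplitude is one, leaving a pure
monomial. -/
theorem bethe_monomial_of_far {p q R : ℝ} (hp : 0 ≤ p) (hq : 0 < q) (hR : IsLargeRadius p q R)
    (d : ℤ) {X Y : Fin N → ℤ} (hX : StrictMono X)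
    (hgap : ∀ u v : Fin N, (u : ℕ) + 1 = v → d < X v - X u) (hY : StrictMono Y)
    (hd : ∑ i, X i = ∑ i, Y i + d) :
    bethe p q R (fun _ => 1) Y (fun ζ => ∏ a, ζ a ^ X a) = if Y = X then 1 else 0 := by
  rw [bethe, Finset.sum_eq_single (id : Fin N → Fin N)]
  · have h1 : ∀ ξ ∈ torus (Fin N) R, wave p q id Y (fun ζ => ∏ a, ζ a ^ X a) ξ =
        ∏ i, ξ i ^ (X i - Y i) := by
      intro ξ hξ
      rw [wave, amp_of_strictMono strictMono_id, one_mul, Function.comp_id,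
        ← Finset.prod_mul_distrib]
      refine Finset.prod_congr rfl fun i _ => ?_
      rw [id, ← zpow_add₀ (ne_zero_of_mem_torus hR.1 hξ i), sub_eq_add_neg]
    rw [one_mul, integral_torus_congr hR.1 h1, integral_prod_zpow hR.1]
    congr 1
    rw [eq_iff_iff, eq_comm (a := Y)]
    exact sub_eq_zero (a := X) (b := Y)
  · intro e _ he
    rw [one_mul]
    by_cases hinj : Function.Injective e
    swap
    · simp [wave_eq_zero hinj]
    by_cases hlt : ∃ a, X a < Y (e a)
    · obtain ⟨a, ha⟩ := hlt
      exact integral_wave_eq_zero hp hq hR e Y X ha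
    push Not at hlt
    exfalso
    have hbij : Function.Bijective e := Finite.injective_iff_bijective.1 hinj
    have hsum : ∑ a, (X a - Y (e a)) = d := by
      rw [Finset.sum_sub_distrib, hbij.sum_comp Y, hd]; ring
    have hle : ∀ a, X a - Y (e a) ≤ d := fun a => by
      rw [← hsum]
      exact Finset.single_le_sum (f := fun a => X a - Y (e a))
        (fun b _ => sub_nonneg.2 (hlt b)) (mem_univ a)
    have hmono : StrictMono e := by
      intro a b hab
      refine hY.lt_iff_lt.1 ?_
      have h1 := hlt a
      have h2 := hle b
      have hab' := Fin.lt_def.1 hab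
      have h3 := hgap a ⟨a + 1, by omega⟩ rfl
      have h4 := hX.monotone (show (⟨a + 1, by omega⟩ : Fin N) ≤ b from by
        rw [Fin.le_def]; simpa using hab')
      omega
    refine he ((StrictMono.range_inj hmono strictMono_id).1 ?_)
    rw [hbij.surjective.range_eq, Set.range_id]
  · simp

/-- The plane wave superpositions with full range are orthonormal. -/
theorem bethe_monomial {p q R : ℝ} (hp : 0 ≤ p) (hq : 0 < q) (hpq : p + q = 1)
    (hR : IsLargeRadius p q R) {X Y : Fin N → ℤ} (hX : StrictMono X) (hY : StrictMono Y) :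
    bethe p q R (fun _ => 1) Y (fun ζ => ∏ a, ζ a ^ X a) = if Y = X then 1 else 0 := by
  classical
  have hsum : ∀ (Z : Fin N → ℤ) (i : Fin N) (c : ℤ),
      ∑ k, Function.update Z i (Z i + c) k = ∑ k, Z k + c := by
    intro Z i c
    rw [Finset.sum_update_of_mem (mem_univ i), ← Finset.add_sum_erase univ Z (mem_univ i),
      Finset.sdiff_singleton_eq_erase]
    ring
  have hbal : IsBalanced p q (fun _ : Fin N → Fin N => (1 : ℂ)) := by
    intro u v _ e he
    refine ⟨fun _ => rfl, fun _ hv => ?_⟩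
    exact absurd ((Finite.injective_iff_surjective.1 he) v) hv
  set G : (Fin N → ℤ) → (Fin N → ℤ) → ℂ := fun Y X =>
    bethe p q R (fun _ => 1) Y (fun ζ => ∏ a, ζ a ^ X a) with hG
  -- Induction on the excess `∑ X - ∑ Y`.
  suffices H : ∀ n : ℕ, ∀ X Y : Fin N → ℤ, StrictMono X → StrictMono Y →
      ∑ i, X i - ∑ i, Y i < n → G Y X = if Y = X then 1 else 0 by
    obtain ⟨n, hn⟩ : ∃ n : ℕ, ∑ i, X i - ∑ i, Y i < n :=
      ⟨(∑ i, X i - ∑ i, Y i + 1).toNat, by have := Int.self_le_toNat (∑ i, X i - ∑ i, Y i + 1); omega⟩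
    exact H n X Y hX hY hn
  intro n
  induction n with
  | zero =>
    intro X Y hX hY hlt
    -- The excess is negative here, so every gap is trivially larger than it.
    refine bethe_monomial_of_far hp hq hR (∑ i, X i - ∑ i, Y i) hX (fun u v huv => ?_) hY (by ring)
    have : X u < X v := hX (by rw [Fin.lt_def]; omega)
    push_cast at hlt
    omega
  | succ n ih =>
    intro X Y hX hY hlt
    by_cases hlt' : ∑ i, X i - ∑ i, Y i < n
    · exact ih X Y hX hY hlt'
    have hd : ∑ i, X i = ∑ i, Y i + n := by push_cast at hlt; omega
    refine sub_eq_zero.1 (eq_zero_of_gaps (D := fun Y X => G Y X - if Y = X then 1 else 0) n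
      ?_ ?_ hX hY hd)
    · intro X Y hX hY hgap hd
      exact sub_eq_zero.2 (bethe_monomial_of_far hp hq hR n hX hgap hY hd)
    · intro X Y hX hY hd
      have h1 := bethe_free_generator hpq hR (fun _ => 1) Y (continuousOn_monomial hR.1 X)
      rw [bethe_free_generator_exponent hR] at h1
      have hlegY := sum_free_eq_sum_legal hY _ _ _ fun u v huv hYuv =>
        bethe_boundary hpq hR hbal huv Y hYuv (continuousOn_monomial hR.1 X)
      have hlegX := sum_free_eq_sum_legal hX
        (fun i => q * G Y (Function.update X i (X i + 1)))
        (fun i => p * G Y (Function.update X i (X i + -1))) (G Y X) fun u v huv hXuv =>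
        bethe_boundary_exponent hR huv (fun _ => rfl) Y hXuv
      -- Both generators, acting on `Y` and on the exponents, multiply the density by the same
      -- function `∑ ε`; with the boundary conditions both reduce to legal moves.
      have h2 : ∑ i, (if StrictMono (Function.update Y i (Y i + 1)) then
            (p : ℂ) * G (Function.update Y i (Y i + 1)) X else 0) +
          ∑ i, (if StrictMono (Function.update Y i (Y i + -1)) then
            (q : ℂ) * G (Function.update Y i (Y i + -1)) X else 0) - (N - blocked Y) * G Y X =
          ∑ i, (if StrictMono (Function.update X i (X i + 1)) then
            (q : ℂ) * G Y (Function.update X i (X i + 1)) else 0) +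
          ∑ i, (if StrictMono (Function.update X i (X i + -1)) then
            (p : ℂ) * G Y (Function.update X i (X i + -1)) else 0) - (N - blocked X) * G Y X :=
        hlegY.symm.trans (h1.trans hlegX)
      have hiff : ∀ (c : ℤ) (i : Fin N), Function.update Y i (Y i + c) = X ↔
          Y = Function.update X i (X i + -c) := by
        intro c i
        constructor <;> rintro rfl <;> simp
      have hdelta : ∀ (c : ℤ) (i : Fin N), (if StrictMono (Function.update Y i (Y i + c)) then
          (if Function.update Y i (Y i + c) = X then (1 : ℂ) else 0) else 0) =
          if StrictMono (Function.update X i (X i + -c)) then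
            (if Y = Function.update X i (X i + -c) then 1 else 0) else 0 := by
        intro c i
        by_cases h : Function.update Y i (Y i + c) = X
        · have h' := (hiff c i).1 h
          rw [h, if_pos hX, if_pos rfl, ← h', if_pos hY, if_pos rfl]
        · have h' := fun h' => h ((hiff c i).2 h')
          simp only [if_neg h, if_neg h', ite_self]
      -- The moves at rate `p` lower the excess to `n - 2`, where the induction hypothesis applies;
      -- the Kronecker deltas match term by term.
      have h3 : ∑ i, (if StrictMono (Function.update Y i (Y i + 1)) then
            (p : ℂ) * G (Function.update Y i (Y i + 1)) X else 0) =
          ∑ i, (if StrictMono (Function.update X i (X i + -1)) then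
            (p : ℂ) * G Y (Function.update X i (X i + -1)) else 0) := by
        refine Finset.sum_congr rfl fun i _ => ?_
        have h4 := congrArg (fun z => (p : ℂ) * z) (hdelta 1 i)
        simp only [mul_ite, mul_zero] at h4
        refine Eq.trans ?_ (h4.trans ?_)
        · refine if_ctx_congr Iff.rfl (fun h => ?_) fun _ => rfl
          rw [ih X _ hX h (by rw [hsum]; omega), mul_ite, mul_zero]
        · refine if_ctx_congr Iff.rfl (fun h => ?_) fun _ => rfl
          rw [ih _ Y h hY (by rw [hsum]; omega), mul_ite, mul_zero]
      -- At excess `n - 1` the value is already known, and it is zero unless `Y = X`.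
      have h5 : (N - blocked Y) * G Y X = (N - blocked X) * G Y X := by
        rw [ih X Y hX hY (by omega)]
        split_ifs with h
        · rw [h]
        · simp
      have h6 : (q : ℂ) * ∑ i, (if StrictMono (Function.update Y i (Y i + -1)) then
            G (Function.update Y i (Y i + -1)) X else 0) =
          q * ∑ i, (if StrictMono (Function.update X i (X i + 1)) then
            G Y (Function.update X i (X i + 1)) else 0) := by
        simp only [Finset.mul_sum, mul_ite, mul_zero]
        linear_combination h2 - h3 + h5
      -- What remains are the moves at rate `q`, which raise the excess to `n`; here `q ≠ 0` is
      -- essential.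
      have h7 := mul_left_cancel₀ (by exact_mod_cast hq.ne' : (q : ℂ) ≠ 0) h6
      have h8 : ∀ i, (if StrictMono (Function.update X i (X i + 1)) then
            (if Y = Function.update X i (X i + 1) then (1 : ℂ) else 0) else 0) =
          if StrictMono (Function.update Y i (Y i + -1)) then
          (if Function.update Y i (Y i + -1) = X then (1 : ℂ) else 0) else 0 := fun i => by
        rw [hdelta (-1) i, neg_neg]
      have h9 : ∀ (P : Prop) [Decidable P] (x y : ℂ), (if P then x - y else 0) =
          (if P then x else 0) - if P then y else 0 := by
        intro P _ x y; split_ifs <;> simp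
      simp only [h9, Finset.sum_sub_distrib, h8]
      rw [← h7]

/-! ### Plane wave superpositions of fewer slots than particles -/

/-- The injective tuples are the rearrangements of the increasing ones. -/
theorem sum_injective_tuples {M : Type*} [AddCommMonoid M] (G : (Fin r → Fin N) → M)
    (hG : ∀ e, ¬ Function.Injective e → G e = 0) :
    ∑ e, G e = ∑ g : Fin r ↪o Fin N, ∑ s : Equiv.Perm (Fin r), G (g ∘ s) := by
  rw [← Finset.sum_product']
  refine (Finset.sum_of_injOn (fun x : (Fin r ↪o Fin N) × Equiv.Perm (Fin r) => x.1 ∘ x.2)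
    ?_ (fun _ _ => by simp) ?_ (fun _ _ => rfl)).symm
  · rintro ⟨g, s⟩ - ⟨g', s'⟩ - h
    dsimp only at h
    have hg : g = g' := by
      apply DFunLike.coe_injective
      refine (StrictMono.range_inj g.strictMono g'.strictMono).1 ?_
      rw [← s.surjective.range_comp g, ← s'.surjective.range_comp g', h]
    subst hg
    congr 1
    ext a
    have := congrFun h a
    simp only [Function.comp_apply, g.injective.eq_iff] at this
    rw [this]
  · intro e _ he
    refine hG e fun hinj => he ?_
    have hm : StrictMono (e ∘ Tuple.sort e) :=
      (Tuple.monotone_sort e).strictMono_of_injective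
        (hinj.comp (Tuple.sort e).injective)
    refine ⟨(OrderEmbedding.ofStrictMono _ hm, (Tuple.sort e)⁻¹), by simp, ?_⟩
    funext a
    simp

/-- The integration over the momenta outside of the tuple is trivial. -/
theorem bethe_eq_sum_orderEmbedding {p q R : ℝ} (hR : IsLargeRadius p q R)
    {w : (Fin r → Fin N) → ℂ} (hw : ∀ e (s : Equiv.Perm (Fin r)), w (e ∘ s) = w e)
    (Y : Fin N → ℤ) {Ψ : (Fin r → ℂ) → ℂ} (hΨ : ContinuousOn Ψ (torus (Fin r) R)) :
    bethe p q R w Y Ψ = ∑ g : Fin r ↪o Fin N, w g * bethe p q R (fun _ => 1) (Y ∘ g) Ψ := by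
  rw [bethe, sum_injective_tuples _ fun e he => by simp [wave_eq_zero he]]
  refine Finset.sum_congr rfl fun g _ => ?_
  have h0 : bethe p q R (fun _ => 1) (Y ∘ g) Ψ =
      ∑ g' : Fin r ↪o Fin r, ∑ s : Equiv.Perm (Fin r),
        (1 : ℂ) * ∫ ξ, wave p q (g' ∘ s) (Y ∘ g) Ψ ξ ∂torusMeasure (Fin r) R := by
    rw [bethe, sum_injective_tuples _ fun e he => by simp [wave_eq_zero he]]
  have huniq : ∀ g' : Fin r ↪o Fin r, g' = RelEmbedding.refl _ := fun g' => by
    apply DFunLike.coe_injective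
    refine (StrictMono.range_inj g'.strictMono strictMono_id).1 ?_
    rw [(Finite.surjective_of_injective g'.injective).range_eq, Set.range_id]
  rw [h0, Fintype.sum_eq_single (RelEmbedding.refl _) fun g' h => absurd (huniq g') h,
    Finset.mul_sum]
  refine Finset.sum_congr rfl fun s _ => ?_
  rw [hw, one_mul, ← integral_comp_injective (by linarith [hR.1]) g.injective
    (continuousOn_wave hR _ (Y ∘ g) hΨ)]
  congr 2
  funext ξ
  rw [wave, wave, amp_comp_strictMono g.strictMono]
  rfl

/-- The superposition of plane waves with a monomial density. -/
theorem bethe_prod_zpow {p q R : ℝ} (hp : 0 ≤ p) (hq : 0 < q) (hpq : p + q = 1)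
    (hR : IsLargeRadius p q R) {w : (Fin r → Fin N) → ℂ}
    (hw : ∀ e (s : Equiv.Perm (Fin r)), w (e ∘ s) = w e) {X : Fin r → ℤ} (hX : StrictMono X)
    {Y : Fin N → ℤ} (hY : StrictMono Y) :
    bethe p q R w Y (fun ζ => ∏ a, ζ a ^ X a) =
      ∑ g : Fin r ↪o Fin N, w g * if Y ∘ g = X then 1 else 0 := by
  rw [bethe_eq_sum_orderEmbedding hR hw Y
    (continuousOn_finsetProd _ fun a _ => continuousOn_coord_zpow hR.1 a _)]
  exact Finset.sum_congr rfl fun g _ => by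
    rw [bethe_monomial hp hq hpq hR hX (hY.comp g.strictMono)]

/-! ### Straightening of products of point and half-line densities -/

/-- The density of a slot: a power, or a geometric sum over a half-line for the slots in `T`. -/
def slotFn (T : Finset (Fin r)) (b : Fin r → ℤ) (a : Fin r) (z : ℂ) : ℂ :=
  if a ∈ T then z ^ (b a + 1) / (z - 1) else z ^ b a

/-- The indicator of a slot: a point, or a half-line for the slots in `T`. -/
def slotInd (T : Finset (Fin r)) (b : Fin r → ℤ) (a : Fin r) (y : ℤ) : ℂ :=
  if a ∈ T then if y ≤ b a then 1 else 0 else if y = b a then 1 else 0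

/-- The factor `τ` for each inversion, and zero for a repetition. -/
def invWeight (τ : ℂ) (i j : Fin N) : ℂ := if i = j then 0 else if i < j then 1 else τ

/-- The weighted number of tuples of particles that occupy the slots. -/
def slotSum (τ : ℂ) (w : (Fin r → Fin N) → ℂ) (Y : Fin N → ℤ) (T : Finset (Fin r))
    (b : Fin r → ℤ) : ℂ :=
  ∑ e : Fin r → Fin N, w e * pairProd (fun a c => invWeight τ (e a) (e c)) *
    ∏ a, slotInd T b a (Y (e a))

/-- The bounds of the slots are increasing, strictly so at the points. -/
def IsSlotOrdered (T : Finset (Fin r)) (b : Fin r → ℤ) : Prop :=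
  ∀ i j, i < j → b i ≤ b j ∧ (j ∉ T → b i < b j)

theorem continuousOn_slotFn {R : ℝ} (hR : 1 < R) (T : Finset (Fin r)) (b : Fin r → ℤ) :
    ContinuousOn (fun ζ : Fin r → ℂ => ∏ a, slotFn T b a (ζ a)) (torus (Fin r) R) := by
  refine continuousOn_finsetProd _ fun a _ => ?_
  unfold slotFn
  split_ifs
  · exact (continuousOn_coord_zpow hR a _).div (by fun_prop)
      fun ζ hζ => sub_ne_zero.2 (ne_one_of_mem_torus hR hζ a)
  · exact continuousOn_coord_zpow hR a _

/-- For `‖z‖ > 1` the half-line factor `z ^ (b + 1) / (z - 1)` is the geometric sum of `z ^ y` over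
`y ≤ b`. Its top term is split off as a point. -/
theorem prod_slotFn_peel {T : Finset (Fin r)} (b : Fin r → ℤ) {i : Fin r} (hi : i ∈ T)
    {ζ : Fin r → ℂ} (h0 : ζ i ≠ 0) (h1 : ζ i ≠ 1) :
    ∏ a, slotFn T b a (ζ a) = ∏ a, slotFn (T.erase i) b a (ζ a) +
      ∏ a, slotFn T (Function.update b i (b i - 1)) a (ζ a) := by
  refine (Finset.prod_add_prod_eq (mem_univ i) ?_ (fun j _ hj => ?_) fun j _ hj => ?_).symm
  · have h2 := sub_ne_zero.2 h1
    simp only [slotFn, hi, if_true, Finset.notMem_erase, if_false, Function.update_self,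
      sub_add_cancel, zpow_add_one₀ h0]
    field_simp
    ring
  · simp [slotFn, hj]
  · simp [slotFn, hj]

theorem slotSum_peel (τ : ℂ) (w : (Fin r → Fin N) → ℂ) (Y : Fin N → ℤ) {T : Finset (Fin r)}
    (b : Fin r → ℤ) {i : Fin r} (hi : i ∈ T) :
    slotSum τ w Y T b = slotSum τ w Y (T.erase i) b +
      slotSum τ w Y T (Function.update b i (b i - 1)) := by
  rw [slotSum, slotSum, slotSum, ← Finset.sum_add_distrib]
  refine Finset.sum_congr rfl fun e _ => ?_
  rw [← mul_add]
  congr 1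
  refine (Finset.prod_add_prod_eq (mem_univ i) ?_ (fun j _ hj => ?_) fun j _ hj => ?_).symm
  · simp only [slotInd, hi, if_true, Finset.notMem_erase, if_false, Function.update_self]
    rcases lt_trichotomy (Y (e i)) (b i) with h | h | h
    · rw [if_neg h.ne, if_pos (by omega), if_pos h.le, zero_add]
    · rw [if_pos h, if_neg (by omega), if_pos h.le, add_zero]
    · rw [if_neg h.ne', if_neg (by omega), if_neg (by omega), zero_add]
  · simp [slotInd, hj]
  · simp [slotInd, hj]

theorem bethe_peel {p q R : ℝ} (hR : IsLargeRadius p q R) (w : (Fin r → Fin N) → ℂ)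
    (Y : Fin N → ℤ) {T : Finset (Fin r)} (b : Fin r → ℤ) {i : Fin r} (hi : i ∈ T) :
    bethe p q R w Y (fun ζ => ∏ a, slotFn T b a (ζ a)) =
      bethe p q R w Y (fun ζ => ∏ a, slotFn (T.erase i) b a (ζ a)) +
      bethe p q R w Y
        (fun ζ => ∏ a, slotFn T (Function.update b i (b i - 1)) a (ζ a)) := by
  rw [← bethe_add hR w Y (continuousOn_slotFn hR.1 _ _) (continuousOn_slotFn hR.1 _ _)]
  exact bethe_congr hR.1 w Y fun ζ hζ => prod_slotFn_peel b hi
    (ne_zero_of_mem_torus hR.1 hζ i) (ne_one_of_mem_torus hR.1 hζ i)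

theorem prod_eq_mul_mul_erase {M : Type*} [CommMonoid M] {u v : Fin r} (huv : u ≠ v)
    (g : Fin r → M) : ∏ a, g a = g u * g v * ∏ a ∈ (univ.erase u).erase v, g a := by
  rw [mul_assoc, Finset.mul_prod_erase _ _ (by simp [huv.symm]),
    Finset.mul_prod_erase _ _ (mem_univ u)]

/-- A point and a half-line in adjacent slots change places. -/
theorem bethe_slot_swap {p q R : ℝ} (hq : 0 < q) (hpq : p + q = 1)
    (hR : IsLargeRadius p q R) {w : (Fin r → Fin N) → ℂ}
    (hw : ∀ e (s : Equiv.Perm (Fin r)), w (e ∘ s) = w e) (Y : Fin N → ℤ)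
    {T : Finset (Fin r)} {b : Fin r → ℤ} {u v : Fin r} (huv : (u : ℕ) + 1 = v)
    (hu : u ∉ T) (hv : v ∈ T) (hb : b u = b v) :
    bethe p q R w Y (fun ζ => ∏ a, slotFn T b a (ζ a)) = (p / q : ℂ) *
      bethe p q R w Y (fun ζ => ∏ a, slotFn (insert u (T.erase v))
        (Function.update b u (b u - 1)) a (ζ a)) := by
  have hne : u ≠ v := by rintro rfl; omega
  have hqc : (q : ℂ) ≠ 0 := by exact_mod_cast hq.ne'
  have hp : (p : ℂ) = 1 - q := by rw [eq_sub_iff_add_eq]; exact_mod_cast hpq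
  -- Chosen so that `h ζ * f (ζ v) (ζ u)` is the difference of the two densities: with `b = b u = b
  -- v`, `ζ v / (ζ v - 1) - τ / (ζ u - 1)` equals `f (ζ v) (ζ u) / (q * (ζ u - 1) * (ζ v - 1))`.
  set h : (Fin r → ℂ) → ℂ := fun ζ => (q : ℂ)⁻¹ *
    (ζ u ^ b v * ζ v ^ b v / ((ζ u - 1) * (ζ v - 1))) *
      ∏ a ∈ (univ.erase u).erase v, slotFn T b a (ζ a) with hdef
  have hcont : ContinuousOn (fun ζ => h ζ * f p q (ζ v) (ζ u)) (torus (Fin r) R) := by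
    refine ContinuousOn.mul (ContinuousOn.mul (ContinuousOn.mul continuousOn_const
      (ContinuousOn.div ((continuousOn_coord_zpow hR.1 _ _).mul
        (continuousOn_coord_zpow hR.1 _ _)) (by fun_prop) fun ζ hζ => ?_)) ?_) ?_
    · exact mul_ne_zero (sub_ne_zero.2 (ne_one_of_mem_torus hR.1 hζ _))
        (sub_ne_zero.2 (ne_one_of_mem_torus hR.1 hζ _))
    · refine continuousOn_finsetProd _ fun a _ => ?_
      unfold slotFn
      split_ifs
      · exact (continuousOn_coord_zpow hR.1 a _).div (by fun_prop)
          fun ζ hζ => sub_ne_zero.2 (ne_one_of_mem_torus hR.1 hζ a)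
      · exact continuousOn_coord_zpow hR.1 a _
    · unfold f; fun_prop
  have hsymm := bethe_eq_zero_of_symm hR huv (fun e => hw e _) Y (h := h) (fun ζ _ => by
    simp only [hdef, Function.comp_apply, Equiv.swap_apply_left, Equiv.swap_apply_right]
    congr 1
    · ring
    · refine Finset.prod_congr rfl fun a ha => ?_
      rw [Equiv.swap_apply_of_ne_of_ne (by rintro rfl; simp at ha) (by rintro rfl; simp at ha)])
  have hcont' : ContinuousOn (fun ζ => (p / q : ℂ) * ∏ a, slotFn (insert u (T.erase v))
      (Function.update b u (b u - 1)) a (ζ a)) (torus (Fin r) R) :=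
    continuousOn_const.mul (continuousOn_slotFn hR.1 _ _)
  rw [← bethe_const_mul, ← add_zero (bethe p q R w Y fun ζ => (p / q : ℂ) * _), ← hsymm,
    ← bethe_add hR w Y hcont' hcont]
  refine bethe_congr hR.1 w Y fun ζ hζ => ?_
  have h0 := ne_zero_of_mem_torus hR.1 hζ v
  have h0' := ne_zero_of_mem_torus hR.1 hζ u
  have h1 := sub_ne_zero.2 (ne_one_of_mem_torus hR.1 hζ u)
  have h2 := sub_ne_zero.2 (ne_one_of_mem_torus hR.1 hζ v)
  have h3 : ∏ a ∈ (univ.erase u).erase v, slotFn (insert u (T.erase v))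
      (Function.update b u (b u - 1)) a (ζ a) =
      ∏ a ∈ (univ.erase u).erase v, slotFn T b a (ζ a) := by
    refine Finset.prod_congr rfl fun a ha => ?_
    have hau : a ≠ u := by rintro rfl; simp at ha
    have hav : a ≠ v := by rintro rfl; simp at ha
    simp [slotFn, hau, hav]
  rw [prod_eq_mul_mul_erase hne, prod_eq_mul_mul_erase hne, h3]
  simp only [slotFn, hu, hv, if_true, if_false, Finset.mem_insert, Finset.mem_erase, hne.symm,
    true_or, Function.update_self, Function.update_of_ne hne.symm, hdef, hb, f, ne_eq,
    not_true_eq_false, false_and, or_false, sub_add_cancel, zpow_add_one₀ h0, hp]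
  field_simp
  ring

/-- The particle in the half-line cannot coincide with the one at the point, since repetitions have
weight zero. It therefore lies strictly to the left and has a smaller label, so the pair is an
inversion of weight `τ`, which disappears when the slots change places; the bound drops by one
accordingly. -/
theorem slotSum_swap {τ : ℂ} {w : (Fin r → Fin N) → ℂ}
    (hw : ∀ e (s : Equiv.Perm (Fin r)), w (e ∘ s) = w e) {Y : Fin N → ℤ} (hY : StrictMono Y)
    {T : Finset (Fin r)} {b : Fin r → ℤ} {u v : Fin r} (huv : (u : ℕ) + 1 = v)
    (hu : u ∉ T) (hv : v ∈ T) (hb : b u = b v) :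
    slotSum τ w Y T b = τ * slotSum τ w Y (insert u (T.erase v))
        (Function.update b u (b u - 1)) := by
  have hne : u ≠ v := by rintro rfl; omega
  have hlt : u < v := by rw [Fin.lt_def]; omega
  set s := Equiv.swap u v
  have hre : slotSum τ w Y (insert u (T.erase v)) (Function.update b u (b u - 1)) =
      ∑ e : Fin r → Fin N, w (e ∘ s) *
        pairProd (fun a c => invWeight τ (e (s a)) (e (s c))) *
        ∏ a, slotInd (insert u (T.erase v)) (Function.update b u (b u - 1)) a (Y (e (s a))) :=
    ((s.arrowCongr (Equiv.refl (Fin N))).sum_comp _).symm.trans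
      (Finset.sum_congr rfl fun e _ => by rfl)
  rw [hre, slotSum, Finset.mul_sum]
  refine Finset.sum_congr rfl fun e _ => ?_
  have h3 : ∏ a ∈ (univ.erase u).erase v, slotInd (insert u (T.erase v))
      (Function.update b u (b u - 1)) a (Y (e (s a))) =
      ∏ a ∈ (univ.erase u).erase v, slotInd T b a (Y (e a)) := by
    refine Finset.prod_congr rfl fun a ha => ?_
    have hau : a ≠ u := by rintro rfl; simp at ha
    have hav : a ≠ v := by rintro rfl; simp at ha
    simp [slotInd, hau, hav, s, Equiv.swap_apply_of_ne_of_ne hau hav]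
  have h4 := pairProd_swap (fun a c => invWeight τ (e a) (e c)) huv
  rw [hw, prod_eq_mul_mul_erase hne, prod_eq_mul_mul_erase hne, h3]
  generalize ∏ a ∈ (univ.erase u).erase v, slotInd T b a (Y (e a)) = P
  simp only [slotInd, hu, hv, if_true, if_false, Finset.mem_insert, Finset.mem_erase, hne.symm,
    true_or, Function.update_self, Function.update_of_ne hne.symm, hb, ne_eq,
    not_true_eq_false, false_and, or_false, s, Equiv.swap_apply_left, Equiv.swap_apply_right]
  by_cases h5 : Y (e u) = b v
  swap
  · simp [h5]
  by_cases h6 : e u = e v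
  · rw [pairProd_eq_zero (g := fun a c => invWeight τ (e a) (e c)) hlt (by simp [invWeight, h6]),
      pairProd_eq_zero (g := fun a c => invWeight τ (e (Equiv.swap u v a))
        (e (Equiv.swap u v c))) hlt (by simp [invWeight, h6])]
    simp
  by_cases h7 : Y (e v) ≤ b v
  · have h8 : Y (e v) ≠ b v := fun h => h6 (hY.injective (h5.trans h.symm))
    have h9 : e v < e u := hY.lt_iff_lt.1 (by omega)
    simp only [invWeight, h6, Ne.symm h6, h9, h9.not_gt, if_true, if_false, mul_one] at h4
    rw [if_pos h5, if_pos h7, if_pos (by omega)]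
    simp only [invWeight]
    linear_combination -(w e * P) * h4
  · rw [if_neg h7, if_neg (show ¬ Y (e v) ≤ b v - 1 by omega)]
    simp

/-- Without half-lines the bounds are strictly increasing and orthonormality applies. A tuple
occupying these points is automatically increasing, so it has no inversions and the value of `τ` is
irrelevant. -/
theorem bethe_slot_empty {p q R : ℝ} (hp : 0 ≤ p) (hq : 0 < q) (hpq : p + q = 1)
    (hR : IsLargeRadius p q R) {w : (Fin r → Fin N) → ℂ}
    (hw : ∀ e (s : Equiv.Perm (Fin r)), w (e ∘ s) = w e) {Y : Fin N → ℤ} (hY : StrictMono Y)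
    {b : Fin r → ℤ} (hb : IsSlotOrdered ∅ b) (τ : ℂ) :
    bethe p q R w Y (fun ζ => ∏ a, slotFn ∅ b a (ζ a)) = slotSum τ w Y ∅ b := by
  have hb' : StrictMono b := fun i j hij => (hb i j hij).2 (by simp)
  have h1 := bethe_prod_zpow hp hq hpq hR hw hb' hY
  simp only [slotFn, Finset.notMem_empty, if_false]
  rw [h1, slotSum]
  have h2 : ∀ e : Fin r → Fin N, ∏ a, slotInd ∅ b a (Y (e a)) =
      if Y ∘ e = b then 1 else 0 := fun e => by
    simp only [slotInd, Finset.notMem_empty, if_false]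
    rw [Finset.prod_ite_zero]
    simp [funext_iff]
  simp only [h2]
  have hmono : ∀ e : Fin r → Fin N, Y ∘ e = b → StrictMono e := fun e he i j hij =>
    hY.lt_iff_lt.1 (by simpa [← he] using hb' hij)
  refine Finset.sum_of_injOn (fun g : Fin r ↪o Fin N => (g : Fin r → Fin N))
    (fun g _ g' _ h => DFunLike.coe_injective h) (fun _ _ => by simp) (fun e _ he => ?_)
    fun g _ => ?_
  · rw [if_neg, mul_zero]
    intro h
    exact he ⟨OrderEmbedding.ofStrictMono e (hmono e h), by simp⟩
  · rw [pairProd, Finset.prod_eq_one, mul_one]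
    intro x hx
    have := g.strictMono (Finset.mem_filter.1 hx).2
    simp [invWeight, this, this.ne]

/-- If the half-line of the slot `i` is shifted far to the left, the superposition vanishes. -/
theorem tendsto_bethe_slot {p q R : ℝ} (hR : IsLargeRadius p q R) (w : (Fin r → Fin N) → ℂ)
    (Y : Fin N → ℤ) {T : Finset (Fin r)} (b : Fin r → ℤ) {i : Fin r} (hi : i ∈ T) :
    Filter.Tendsto (fun n : ℕ => bethe p q R w Y
      (fun ζ => ∏ a, slotFn T (Function.update b i (b i - n)) a (ζ a))) Filter.atTop (nhds 0) := by
  have hR0 : (0 : ℝ) < R := by linarith [hR.1]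
  set C : ℝ := ∑ e : Fin r → Fin N, ‖w e‖ *
    ∫ ξ, ‖wave p q e Y (fun ζ => ∏ a, slotFn T b a (ζ a)) ξ‖ ∂torusMeasure (Fin N) R
  refine squeeze_zero_norm (a := fun n : ℕ => C * (R⁻¹) ^ n) (fun n => ?_) ?_
  · rw [bethe, Finset.sum_mul]
    refine (norm_sum_le _ _).trans (Finset.sum_le_sum fun e _ => ?_)
    rw [norm_mul, mul_assoc]
    refine mul_le_mul_of_nonneg_left ?_ (norm_nonneg _)
    rw [← integral_mul_const]
    refine (norm_integral_le_integral_norm _).trans (le_of_eq (integral_congr_ae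
      ((ae_mem_torus hR0.le).mono fun ξ hξ => ?_)))
    have h0 := ne_zero_of_mem_torus hR.1 hξ (e i)
    have h1 : ∏ a, slotFn T (Function.update b i (b i - n)) a ((ξ ∘ e) a) =
        ((ξ (e i))⁻¹) ^ n * ∏ a, slotFn T b a ((ξ ∘ e) a) := by
      rw [← Finset.mul_prod_erase _ _ (mem_univ i),
        ← Finset.mul_prod_erase _ (fun a => slotFn T b a ((ξ ∘ e) a)) (mem_univ i), ← mul_assoc]
      congr 1
      · simp only [slotFn, hi, if_true, Function.update_self, Function.comp_apply]
        rw [show b i - n + 1 = b i + 1 - n by ring, zpow_sub₀ h0, zpow_natCast, inv_pow]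
        ring
      · refine Finset.prod_congr rfl fun a ha => ?_
        simp [slotFn, (Finset.mem_erase.1 ha).1]
    simp only [wave, h1, norm_mul, norm_pow, norm_inv, mem_torus.1 hξ]
    ring
  · rw [← mul_zero C]
    exact (tendsto_pow_atTop_nhds_zero_of_lt_one (by positivity)
      (inv_lt_one_of_one_lt₀ hR.1)).const_mul C

theorem eventually_slotSum_eq_zero (τ : ℂ) (w : (Fin r → Fin N) → ℂ)
    (Y : Fin N → ℤ) {T : Finset (Fin r)} (b : Fin r → ℤ) {i : Fin r} (hi : i ∈ T) :
    ∀ᶠ n : ℕ in Filter.atTop, slotSum τ w Y T (Function.update b i (b i - n)) = 0 := by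
  have h : ∀ᶠ n : ℕ in Filter.atTop, ∀ j, b i - n < Y j := by
    refine Filter.eventually_all.2 fun j => ?_
    filter_upwards [Filter.eventually_gt_atTop (b i - Y j).toNat] with n hn
    omega
  filter_upwards [h] with n hn
  refine Finset.sum_eq_zero fun e _ => ?_
  rw [Finset.prod_eq_zero (mem_univ i), mul_zero]
  simp [slotInd, hi, (hn (e i)).not_ge]

theorem IsSlotOrdered.erase {T : Finset (Fin r)} {b : Fin r → ℤ} (hb : IsSlotOrdered T b)
    {i : Fin r} (h : ∀ a, a < i → b a < b i) : IsSlotOrdered (T.erase i) b := by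
  refine fun a c hac => ⟨(hb a c hac).1, fun hc => ?_⟩
  by_cases hci : c = i
  · subst hci; exact h a hac
  · exact (hb a c hac).2 fun h' => hc (Finset.mem_erase.2 ⟨hci, h'⟩)

theorem IsSlotOrdered.update {T : Finset (Fin r)} {b : Fin r → ℤ} (hb : IsSlotOrdered T b)
    {i : Fin r} (hi : i ∈ T) {x : ℤ} (hx : x ≤ b i) (h : ∀ a, a < i → b a ≤ x) :
    IsSlotOrdered T (Function.update b i x) := by
  intro a c hac
  have := hb a c hac
  by_cases hai : a = i
  · subst hai
    rw [Function.update_self, Function.update_of_ne hac.ne']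
    exact ⟨hx.trans this.1, fun hc => hx.trans_lt (this.2 hc)⟩
  · rw [Function.update_of_ne hai]
    by_cases hci : c = i
    · subst hci
      rw [Function.update_self]
      exact ⟨h a hac, fun hc => absurd hi hc⟩
    · rwa [Function.update_of_ne hci]

/-- Slots before `u` have bounds strictly below the point `b u`, so lowering the bound of `u` by one
preserves the order, and the new point at `v` lies strictly above. -/
theorem IsSlotOrdered.swap {T : Finset (Fin r)} {b : Fin r → ℤ} (hb : IsSlotOrdered T b)
    {u v : Fin r} (huv : (u : ℕ) + 1 = v) (hu : u ∉ T) (hbuv : b u = b v) :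
    IsSlotOrdered (insert u (T.erase v)) (Function.update b u (b u - 1)) := by
  intro a c hac
  have h1 := hb a c hac
  have hne : v ≠ u := by rintro rfl; omega
  by_cases hau : a = u
  · subst hau
    rw [Function.update_self, Function.update_of_ne hac.ne']
    have := h1.1
    exact ⟨by omega, fun _ => by omega⟩
  · rw [Function.update_of_ne hau]
    by_cases hcu : c = u
    · subst hcu
      rw [Function.update_self]
      have := h1.2 hu
      exact ⟨by omega, fun hc => absurd (Finset.mem_insert_self _ _) hc⟩
    · rw [Function.update_of_ne hcu]
      refine ⟨h1.1, fun hc => ?_⟩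
      by_cases hcv : c = v
      · subst hcv
        have : a < u := by
          rw [Fin.lt_def] at hac ⊢
          have : (a : ℕ) ≠ u := fun h => hau (Fin.ext h)
          omega
        have := (hb a u this).2 hu
        omega
      · exact h1.2 fun h => hc (by simp [hcv, h])

/-- The superposition of plane waves with densities of points and half-lines counts the tuples of
particles that occupy the slots. -/
theorem bethe_slot {p q R : ℝ} (hp : 0 ≤ p) (hq : 0 < q) (hpq : p + q = 1)
    (hR : IsLargeRadius p q R) {w : (Fin r → Fin N) → ℂ}
    (hw : ∀ e (s : Equiv.Perm (Fin r)), w (e ∘ s) = w e) {Y : Fin N → ℤ} (hY : StrictMono Y)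
    (T : Finset (Fin r)) (b : Fin r → ℤ) (hb : IsSlotOrdered T b) :
    bethe p q R w Y (fun ζ => ∏ a, slotFn T b a (ζ a)) = slotSum (p / q : ℂ) w Y T b := by
  induction hn : #T generalizing T b with
  | zero =>
    obtain rfl := Finset.card_eq_zero.1 hn
    exact bethe_slot_empty hp hq hpq hR hw hY hb _
  | succ n ih =>
    -- For a fixed number of half-lines, induction on the position `i` of the leftmost one.
    suffices h : ∀ (k : ℕ) (T : Finset (Fin r)) (b : Fin r → ℤ) (i : Fin r), (i : ℕ) = k →
        #T = n + 1 → i ∈ T → (∀ a ∈ T, i ≤ a) → IsSlotOrdered T b →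
        bethe p q R w Y (fun ζ => ∏ a, slotFn T b a (ζ a)) = slotSum (p / q : ℂ) w Y T b by
      have hne : T.Nonempty := Finset.card_pos.1 (by omega)
      exact h _ T b (T.min' hne) rfl hn (Finset.min'_mem _ _) (fun a ha => Finset.min'_le _ _ ha) hb
    intro k
    induction k with
    | zero =>
      intro T b i hi0 hn hi hmin hb
      have hlow : ∀ a, a < i → False := fun a ha => by rw [Fin.lt_def] at ha; omega
      have hord : ∀ n : ℕ, IsSlotOrdered T (Function.update b i (b i - n)) := fun n =>
        hb.update hi (by omega) fun a ha => (hlow a ha).elim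
      -- In the first slot the half-line can be lowered indefinitely: each peeled term has fewer
      -- half-lines and agrees on both sides, so the discrepancy is constant in `n`, while it tends
      -- to zero.
      have hstep : ∀ n : ℕ, bethe p q R w Y (fun ζ => ∏ a, slotFn T b a (ζ a)) -
          slotSum (p / q : ℂ) w Y T b = bethe p q R w Y
            (fun ζ => ∏ a, slotFn T (Function.update b i (b i - n)) a (ζ a)) -
          slotSum (p / q : ℂ) w Y T (Function.update b i (b i - n)) := by
        intro n
        induction n with
        | zero => simp
        | succ n ihn =>
          rw [ihn, bethe_peel hR w Y _ hi, slotSum_peel _ _ _ _ hi,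
            ih _ _ ((hord n).erase fun a ha => (hlow a ha).elim)
              (by rw [Finset.card_erase_of_mem hi, hn]; rfl), Function.update_idem,
            Function.update_self, show b i - (n : ℤ) - 1 = b i - (n + 1 : ℕ) by push_cast; ring]
          ring
      have h1 := tendsto_bethe_slot hR w Y b hi
      refine sub_eq_zero.1 (tendsto_nhds_unique (f := fun _ : ℕ => _) tendsto_const_nhds
        (h1.congr' ?_))
      filter_upwards [eventually_slotSum_eq_zero (p / q : ℂ) w Y b hi] with n hn'
      rw [hstep n, hn', sub_zero]
    | succ k ihk =>
      intro T b i hik hn hi hmin hb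
      -- The slot before the leftmost half-line is a point. The half-line is peeled until its bound
      -- reaches that point, and then the two change places, moving the leftmost half-line one slot
      -- to the left.
      set u : Fin r := ⟨k, by omega⟩ with hudef
      have huv : (u : ℕ) + 1 = i := by rw [hik]
      have hui : u < i := by rw [Fin.lt_def]; omega
      have huT : u ∉ T := fun h => (hmin u h).not_gt hui
      have hbu : ∀ a, a < i → b a ≤ b u := fun a ha => by
        rcases eq_or_ne a u with rfl | hau
        · rfl
        · refine (hb a u ?_).1
          rw [Fin.lt_def] at ha ⊢
          have : (a : ℕ) ≠ u := fun h => hau (Fin.ext h)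
          omega
      induction hg : (b i - b u).toNat generalizing b with
      | zero =>
        have hbui : b u = b i := by have := (hb u i hui).1; omega
        rw [bethe_slot_swap hq hpq hR hw Y huv huT hi hbui, slotSum_swap hw hY huv huT hi hbui,
          ihk _ _ u rfl ?_ (Finset.mem_insert_self _ _) ?_ (hb.swap huv huT hbui)]
        · rw [Finset.card_insert_of_notMem fun h => huT (Finset.mem_of_mem_erase h),
            Finset.card_erase_of_mem hi, hn]
          rfl
        · intro a ha
          rcases Finset.mem_insert.1 ha with rfl | ha
          · rfl
          · exact hui.le.trans (hmin a (Finset.mem_of_mem_erase ha))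
      | succ g ihg =>
        rw [bethe_peel hR w Y _ hi, slotSum_peel _ _ _ _ hi,
          ih _ _ (hb.erase fun a ha => (hbu a ha).trans_lt (by omega))
            (by rw [Finset.card_erase_of_mem hi, hn]; rfl),
          ihg (Function.update b i (b i - 1))
            (hb.update hi (by omega) fun a ha => (hbu a ha).trans (by omega)) ?_ ?_]
        · intro a ha
          rw [Function.update_of_ne ha.ne, Function.update_of_ne hui.ne]
          exact hbu a ha
        · rw [Function.update_self, Function.update_of_ne hui.ne]
          omega

/-! ### Products over pairs -/

theorem pairProd_eq_prod_prod {M : Type*} [CommMonoid M] (g : Fin r → Fin r → M) :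
    pairProd g = ∏ a, ∏ b, if a < b then g a b else 1 := by
  rw [pairProd, Finset.prod_filter, Fintype.prod_prod_type]

theorem pairProd_succ {M : Type*} [CommMonoid M] (g : Fin (r + 1) → Fin (r + 1) → M) :
    pairProd g = (∏ b : Fin r, g 0 b.succ) * pairProd fun a b : Fin r => g a.succ b.succ := by
  simp [pairProd_eq_prod_prod, Fin.prod_univ_succ]

theorem pairProd_add {M : Type*} [CommMonoid M] {k l : ℕ} (g : Fin (k + l) → Fin (k + l) → M) :
    pairProd g = pairProd (fun a b : Fin k => g (Fin.castAdd l a) (Fin.castAdd l b)) *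
      (pairProd fun a b : Fin l => g (Fin.natAdd k a) (Fin.natAdd k b)) *
      ∏ a : Fin k, ∏ b : Fin l, g (Fin.castAdd l a) (Fin.natAdd k b) := by
  have h1 : ∀ (a : Fin k) (b : Fin l), Fin.castAdd l a < Fin.natAdd k b := fun a b => by
    rw [Fin.lt_def]; simp; omega
  have h2 : ∀ (a : Fin k) (b : Fin l), ¬ Fin.natAdd k b < Fin.castAdd l a := fun a b =>
    (h1 a b).not_gt
  have h3 : ∀ a b : Fin k, Fin.castAdd l a < Fin.castAdd l b ↔ a < b := fun a b => Iff.rfl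
  simp only [pairProd_eq_prod_prod, Fin.prod_univ_add, h1, h2, if_true, if_false,
    Finset.prod_mul_distrib, Finset.prod_const_one, mul_one, Fin.natAdd_lt_natAdd_iff, h3]
  rw [mul_assoc, mul_comm (∏ a, ∏ b, g _ _)]

/-- The product over the increasing pairs of elements of a set. -/
def orderedProd {M : Type*} [CommMonoid M] (s : Finset (Fin N)) (g : Fin N → Fin N → M) : M :=
  ∏ i ∈ s, ∏ j ∈ s with i < j, g i j

theorem orderedProd_eq_prod_prod {M : Type*} [CommMonoid M] (s : Finset (Fin N))
    (g : Fin N → Fin N → M) :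
    orderedProd s g = ∏ i ∈ s, ∏ j ∈ s, if i < j then g i j else 1 := by
  simp [orderedProd, Finset.prod_filter]

theorem orderedProd_union {M : Type*} [CommMonoid M] {s t : Finset (Fin N)} (h : Disjoint s t)
    (g : Fin N → Fin N → M) :
    orderedProd (s ∪ t) g = orderedProd s g * orderedProd t g *
      ∏ i ∈ s, ∏ j ∈ t, if i < j then g i j else g j i := by
  have h1 : ∏ i ∈ s, ∏ j ∈ t, (if i < j then g i j else g j i) =
      (∏ i ∈ s, ∏ j ∈ t, if i < j then g i j else 1) *
      ∏ j ∈ t, ∏ i ∈ s, if j < i then g j i else 1 := by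
    rw [Finset.prod_comm (s := t), ← Finset.prod_mul_distrib]
    refine Finset.prod_congr rfl fun i hi => ?_
    rw [← Finset.prod_mul_distrib]
    refine Finset.prod_congr rfl fun j hj => ?_
    rcases lt_trichotomy i j with hij | rfl | hij
    · simp [hij, hij.not_gt]
    · exact absurd hj (Finset.disjoint_left.1 h hi)
    · simp [hij, hij.not_gt]
  rw [h1]
  simp only [orderedProd_eq_prod_prod, Finset.prod_union h, Finset.prod_mul_distrib]
  simp only [mul_left_comm, mul_comm]

theorem orderedProd_insert {M : Type*} [CommMonoid M] {s : Finset (Fin N)} {l : Fin N}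
    (h : l ∉ s) (g : Fin N → Fin N → M) :
    orderedProd (insert l s) g =
      orderedProd s g * ∏ j ∈ s, if l < j then g l j else g j l := by
  rw [Finset.insert_eq, orderedProd_union (by simpa using h)]
  simp [orderedProd, Finset.filter_singleton]

theorem image_fin_succ (t : Fin (r + 1) → Fin N) :
    univ.image t = insert (t 0) (univ.image fun a : Fin r => t a.succ) := by
  ext i
  simp [Fin.exists_fin_succ, eq_comm]

theorem orderedProd_image {M : Type*} [CommMonoid M] {t : Fin r → Fin N}
    (ht : Function.Injective t) (g : Fin N → Fin N → M) :
    orderedProd (univ.image t) g =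
      pairProd fun a b => if t a < t b then g (t a) (t b) else g (t b) (t a) := by
  induction r with
  | zero => simp [orderedProd, pairProd]
  | succ r ih =>
    have h1 : Function.Injective fun a : Fin r => t a.succ :=
      ht.comp (Fin.succ_injective r)
    rw [image_fin_succ, orderedProd_insert, ih h1, pairProd_succ, Finset.prod_image h1.injOn,
      mul_comm]
    simp only [Finset.mem_image, not_exists, not_and]
    intro a _ h
    exact Fin.succ_ne_zero a (ht h)

/-! ### Sums over the arrangements of a set -/

theorem pairProd_comp_eq_zero {M : Type*} [CommMonoidWithZero M] {κ : Fin N → Fin N → M}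
    (hκ : ∀ i, κ i i = 0) {t : Fin r → Fin N} (ht : ¬ Function.Injective t) :
    (pairProd fun a b => κ (t a) (t b)) = 0 := by
  simp only [Function.Injective, not_forall] at ht
  obtain ⟨a, b, hab, hne⟩ := ht
  rcases lt_or_gt_of_ne hne with h | h
  · exact pairProd_eq_zero h (by rw [hab, hκ])
  · exact pairProd_eq_zero h (by rw [hab, hκ])

/-- A pair factor with an antisymmetrisation identity. -/
structure IsArrangement (κ : Fin N → Fin N → ℂ) (V : Finset (Fin N) → ℂ) (γ : ℕ → ℂ) : Prop where
  self : ∀ i, κ i i = 0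
  empty : V ∅ = 1
  step : ∀ s, s.Nonempty → ∑ l ∈ s, (∏ j ∈ s.erase l, κ l j) * V (s.erase l) = γ #s * V s

/-- Split off the first entry `l` of the arrangement: its pair factors with the rest depend only on
the set `S.erase l`, so induction and one use of `step` suffice. -/
theorem IsArrangement.sum_image {κ : Fin N → Fin N → ℂ} {V : Finset (Fin N) → ℂ} {γ : ℕ → ℂ}
    (h : IsArrangement κ V γ) (S : Finset (Fin N)) (hS : #S = r) :
    ∑ t : Fin r → Fin N with univ.image t = S, pairProd (fun a b => κ (t a) (t b)) =
      (∏ i ∈ range r, γ (i + 1)) * V S := by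
  induction r generalizing S with
  | zero =>
    obtain rfl := Finset.card_eq_zero.1 hS
    simp [h.empty, pairProd]
  | succ r ih =>
    have hne : S.Nonempty := Finset.card_pos.1 (by omega)
    have hcons : ∀ G : (Fin (r + 1) → Fin N) → ℂ,
        ∑ t, G t = ∑ l : Fin N, ∑ t : Fin r → Fin N, G (Fin.cons l t) := fun G => by
      rw [← (Fin.consEquiv fun _ => Fin N).sum_comp G, Fintype.sum_prod_type]
      rfl
    rw [Finset.prod_range_succ, mul_assoc, show γ (r + 1) = γ #S by rw [hS], ← h.step S hne, Finset.mul_sum,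
      Finset.sum_filter, hcons, ← Finset.sum_subset (Finset.subset_univ S)]
    · refine Finset.sum_congr rfl fun l hl => ?_
      have hcard : #(S.erase l) = r := by rw [Finset.card_erase_of_mem hl, hS]; rfl
      rw [mul_left_comm, ← ih _ hcard, Finset.mul_sum, Finset.sum_filter]
      refine Finset.sum_congr rfl fun t _ => ?_
      have himg : univ.image (Fin.cons l t : Fin (r + 1) → Fin N) =
          insert l (univ.image t) := by
        rw [image_fin_succ]; simp
      have hiff : univ.image (Fin.cons l t : Fin (r + 1) → Fin N) = S ↔
          univ.image t = S.erase l := by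
        rw [himg]
        constructor
        · intro h'
          have : l ∉ univ.image t := by
            intro hl'
            rw [Finset.insert_eq_of_mem hl'] at h'
            have h1 : #(univ.image t) ≤ r := Finset.card_image_le.trans (by simp)
            rw [h', hS] at h1
            omega
          rw [← h', Finset.erase_insert this]
        · intro h'
          rw [h', Finset.insert_erase hl]
      simp only [hiff]
      split_ifs with h'
      · have ht : Function.Injective t :=
          Set.injOn_univ.1 (by
            have h1 := Finset.card_image_iff.1 (show #(univ.image t) = #univ by
              rw [h', hcard]; simp)
            rwa [Finset.coe_univ] at h1)
        rw [pairProd_succ]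
        simp only [Fin.cons_zero, Fin.cons_succ]
        rw [← h', Finset.prod_image ht.injOn]
      · rfl
    · intro l _ hl
      refine Finset.sum_eq_zero fun t _ => if_neg fun h' => hl ?_
      rw [← h']
      exact Finset.mem_image.2 ⟨0, mem_univ _, by simp⟩

theorem IsArrangement.sum_tuples {κ : Fin N → Fin N → ℂ} {V : Finset (Fin N) → ℂ} {γ : ℕ → ℂ}
    (h : IsArrangement κ V γ) {F' : (Fin r → Fin N) → ℂ} {F : Finset (Fin N) → ℂ}
    (hF : ∀ t, Function.Injective t → F' t = F (univ.image t)) :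
    ∑ t : Fin r → Fin N, pairProd (fun a b => κ (t a) (t b)) * F' t =
      ∑ S : Finset (Fin N) with #S = r, (∏ i ∈ range r, γ (i + 1)) * V S * F S := by
  have h1 : ∀ t : Fin r → Fin N, pairProd (fun a b => κ (t a) (t b)) * F' t =
      if #(univ.image t) = r then pairProd (fun a b => κ (t a) (t b)) * F (univ.image t) else 0 := by
    intro t
    by_cases ht : Function.Injective t
    · rw [if_pos (by rw [Finset.card_image_of_injective _ ht]; simp), hF t ht]
    · rw [pairProd_comp_eq_zero h.self ht]; simp
  simp_rw [h1]
  rw [← Finset.sum_filter, ← Finset.sum_fiberwise_of_maps_to (g := fun t => univ.image t)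
    (t := univ.filter fun S : Finset (Fin N) => #S = r) (fun t ht => by simpa using ht)]
  refine Finset.sum_congr rfl fun S hS => ?_
  have hS' : #S = r := by simpa using hS
  rw [← h.sum_image S hS', Finset.sum_mul, Finset.filter_filter]
  refine Finset.sum_congr ?_ fun t ht => ?_
  · ext t
    simp only [mem_filter, mem_univ, true_and, and_iff_right_iff_imp]
    rintro rfl; exact hS'
  · rw [(Finset.mem_filter.1 ht).2]

/-- The sum over tuples that are arranged in three blocks, the outer ones of which are arrangements
of sets. -/
theorem IsArrangement.sum_blocks {κ : Fin N → Fin N → ℂ} {V : Finset (Fin N) → ℂ} {γ : ℕ → ℂ}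
    (h : IsArrangement κ V γ) {c d k : ℕ} (W : (Fin (c + d + k) → Fin N) → ℂ)
    (W' : Finset (Fin N) → (Fin d → Fin N) → Finset (Fin N) → ℂ)
    (hW : ∀ e₁ l e₂, Function.Injective e₁ → Function.Injective e₂ →
      W (Fin.append (Fin.append e₁ l) e₂) = W' (univ.image e₁) l (univ.image e₂)) :
    ∑ e : Fin (c + d + k) → Fin N, pairProd (fun a b => κ (e a) (e b)) * W e =
      (∏ i ∈ range c, γ (i + 1)) * (∏ i ∈ range k, γ (i + 1)) *
      ∑ S : Finset (Fin N) with #S = k, ∑ S₁ : Finset (Fin N) with #S₁ = c,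
        ∑ l : Fin d → Fin N, V S * V S₁ * (pairProd fun a b => κ (l a) (l b)) *
          (∏ i ∈ S₁, ∏ b, κ i (l b)) * (∏ i ∈ S₁, ∏ j ∈ S, κ i j) *
          (∏ b, ∏ j ∈ S, κ (l b) j) * W' S₁ l S := by
  rw [← (Fin.appendEquiv (α := Fin N) (c + d) k).sum_comp, Fintype.sum_prod_type,
    ← (Fin.appendEquiv (α := Fin N) c d).sum_comp, Fintype.sum_prod_type]
  simp only [Fin.appendEquiv, Equiv.coe_fn_mk, pairProd_add, Fin.append_left, Fin.append_right,
    Fin.prod_univ_add]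
  have h1 : ∀ (e₁ : Fin c → Fin N), Function.Injective e₁ → ∀ l : Fin d → Fin N,
      ∑ e₂ : Fin k → Fin N, pairProd (fun a b => κ (e₂ a) (e₂ b)) *
        ((∏ a, ∏ b, κ (e₁ a) (e₂ b)) * (∏ a, ∏ b, κ (l a) (e₂ b)) *
        W (Fin.append (Fin.append e₁ l) e₂)) =
      ∑ S : Finset (Fin N) with #S = k, (∏ i ∈ range k, γ (i + 1)) * V S *
        ((∏ i ∈ univ.image e₁, ∏ j ∈ S, κ i j) * (∏ b, ∏ j ∈ S, κ (l b) j) *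
          W' (univ.image e₁) l S) := by
    intro e₁ he₁ l
    refine h.sum_tuples fun e₂ he₂ => ?_
    rw [hW e₁ l e₂ he₁ he₂]
    simp only [Finset.prod_image he₁.injOn, Finset.prod_image he₂.injOn]
  have h2 := h.sum_tuples (r := c) (F' := fun e₁ => ∑ l : Fin d → Fin N,
      (pairProd fun a b => κ (l a) (l b)) * (∏ a, ∏ b, κ (e₁ a) (l b)) *
      ∑ e₂ : Fin k → Fin N, pairProd (fun a b => κ (e₂ a) (e₂ b)) *
        ((∏ a, ∏ b, κ (e₁ a) (e₂ b)) * (∏ a, ∏ b, κ (l a) (e₂ b)) *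
        W (Fin.append (Fin.append e₁ l) e₂)))
    (F := fun S₁ => ∑ l : Fin d → Fin N,
      (pairProd fun a b => κ (l a) (l b)) * (∏ i ∈ S₁, ∏ b, κ i (l b)) *
      ∑ S : Finset (Fin N) with #S = k, (∏ i ∈ range k, γ (i + 1)) * V S *
        ((∏ i ∈ S₁, ∏ j ∈ S, κ i j) * (∏ b, ∏ j ∈ S, κ (l b) j) * W' S₁ l S))
    (fun e₁ he₁ => by
      refine Finset.sum_congr rfl fun l _ => ?_
      rw [h1 e₁ he₁, Finset.prod_image he₁.injOn])
  refine Eq.trans ?_ (h2.trans ?_)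
  · refine Finset.sum_congr rfl fun e₁ _ => ?_
    rw [Finset.mul_sum]
    refine Finset.sum_congr rfl fun l _ => ?_
    rw [← mul_assoc, Finset.mul_sum]
    refine Finset.sum_congr rfl fun e₂ _ => ?_
    ring
  · rw [Finset.sum_comm, Finset.mul_sum]
    refine Finset.sum_congr rfl fun S₁ _ => ?_
    rw [Finset.sum_comm, Finset.mul_sum, Finset.mul_sum]
    refine Finset.sum_congr rfl fun l _ => ?_
    rw [Finset.mul_sum, Finset.mul_sum, Finset.mul_sum]
    refine Finset.sum_congr rfl fun S _ => ?_
    ring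

/-! ### Two antisymmetrisation identities -/

/-- If `l` stands first, it forms an inversion with each smaller element, so the sum over `l` runs
through the powers `τ ^ 0, …, τ ^ (#s - 1)`. Adding a new maximum supplies the next power and does
not affect the others. -/
theorem isArrangement_invWeight (τ : ℂ) :
    IsArrangement (N := N) (invWeight τ) (fun _ => 1) fun k => ∑ a ∈ range k, τ ^ a where
  self i := by simp [invWeight]
  empty := rfl
  step s hs := by
    clear hs
    simp only [mul_one]
    induction s using Finset.induction_on_max with
    | empty => simp
    | insert M s hM ih =>
      have hMs : M ∉ s := fun h => (hM M h).false
      rw [Finset.sum_insert hMs, Finset.card_insert_of_notMem hMs, Finset.sum_range_succ, ← ih,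
        Finset.erase_insert hMs, add_comm]
      congr 1
      · refine Finset.sum_congr rfl fun l hl => ?_
        have hne : M ≠ l := (hM l hl).ne'
        rw [Finset.erase_insert_of_ne hne, Finset.prod_insert fun h =>
          hMs (Finset.mem_of_mem_erase h)]
        simp [invWeight, hne.symm, hM l hl]
      · rw [Finset.prod_congr rfl fun j hj => show invWeight τ M j = τ by
          simp [invWeight, (hM j hj).ne', (hM j hj).not_gt], Finset.prod_const]

/-- The homogeneous `q`-integers. -/
def homSum (p q : ℝ) (k : ℕ) : ℂ := ∑ a ∈ range k, (q : ℂ) ^ a * (p : ℂ) ^ (k - 1 - a)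

theorem homSum_succ (p q : ℝ) (k : ℕ) : homSum p q (k + 1) = q ^ k + p * homSum p q k := by
  rw [homSum, homSum, Nat.add_sub_cancel]
  exact geom_sum₂_succ_eq _ _

theorem prod_homSum {p q : ℝ} (hq : q ≠ 0) (k : ℕ) :
    ∏ i ∈ range k, homSum p q (i + 1) =
      q ^ (k * (k - 1) / 2) * ∏ i ∈ range k, ∑ a ∈ range (i + 1), (p / q : ℂ) ^ a := by
  have hqc : (q : ℂ) ≠ 0 := by exact_mod_cast hq
  have h : ∀ k : ℕ, homSum p q (k + 1) = q ^ k * ∑ a ∈ range (k + 1), (p / q : ℂ) ^ a := by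
    intro k
    rw [homSum, ← Finset.sum_range_reflect, Finset.mul_sum]
    refine Finset.sum_congr rfl fun a ha => ?_
    have ha' : a ≤ k := by simpa [Nat.lt_succ_iff] using ha
    rw [div_pow, show k + 1 - 1 - a = k - a by omega]
    have h2 : (q : ℂ) ^ k = q ^ (k - a) * q ^ a := by rw [← pow_add]; congr 1; omega
    rw [show k + 1 - 1 - (k - a) = a by omega, h2]
    field_simp
  induction k with
  | zero => simp
  | succ k ih =>
    have h3 : (k + 1) * (k + 1 - 1) / 2 = k * (k - 1) / 2 + k := by
      rw [← Finset.sum_range_id_mul_two, ← Finset.sum_range_id_mul_two,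
        Nat.mul_div_cancel _ two_pos, Nat.mul_div_cancel _ two_pos, Finset.sum_range_succ]
    rw [Finset.prod_range_succ, Finset.prod_range_succ, ih, h, h3, pow_add]
    ring

open Polynomial in
-- Induction on the set. With the new variable replaced by an indeterminate and denominators
-- cleared, both sides are polynomials of degree at most `#s`. They agree at the `#s` old variables,
-- where a single term survives, and at `1`, where `f 1 z = q * (z - 1)` and `f z 1 = p * (1 - z)`
-- reduce the claim to the induction hypothesis.
theorem sum_prod_f_div {p q : ℝ} (hpq : p + q = 1) {ι : Type*} [DecidableEq ι] (s : Finset ι)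
    (z : ι → ℂ) (hz : Set.InjOn z s) (h1 : ∀ i ∈ s, z i ≠ 1) :
    ∑ l ∈ s, ∏ j ∈ s.erase l, f p q (z l) (z j) / (z j - z l) = homSum p q #s := by
  have hp : (p : ℂ) = 1 - q := by rw [eq_sub_iff_add_eq]; exact_mod_cast hpq
  induction s using Finset.induction_on with
  | empty => simp [homSum]
  | insert w s hw ih =>
    have hzs : Set.InjOn z s := hz.mono (by simp)
    have ih := ih hzs fun i hi => h1 i (by simp [hi])
    have hsub : ∀ i ∈ s, ∀ j ∈ s, i ≠ j → z j - z i ≠ 0 := fun i hi j hj hij =>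
      sub_ne_zero.2 fun h => hij (hzs hi hj h.symm)
    set A : ι → ℂ := fun l => ∏ j ∈ s.erase l, f p q (z l) (z j) / (z j - z l) with hA
    -- The difference of the two sides times `∏ (z j - X)`, with `X` in place of the new variable `z
    -- w`.
    set P : ℂ[X] := ∏ j ∈ s, (C (p : ℂ) + (C (q * z j) - 1) * X) -
      ∑ l ∈ s, C (A l) * ((C (p - z l : ℂ) + C (q * z l : ℂ) * X) *
        ∏ j ∈ s.erase l, (C (z j) - X)) -
      C (homSum p q (#s + 1)) * ∏ j ∈ s, (C (z j) - X) with hP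
    have hlin : ∀ a b : ℂ, (C a + C b * X : ℂ[X]).natDegree ≤ 1 := fun a b => by
      rw [add_comm]; exact natDegree_linear_le
    have hlin' : ∀ a : ℂ, (C a - X : ℂ[X]).natDegree ≤ 1 := fun a =>
      (natDegree_sub_le _ _).trans (by simp)
    have hdeg : P.natDegree ≤ #s := by
      refine (natDegree_sub_le_of_le ((natDegree_sub_le_of_le ?_ ?_).trans (max_self #s).le)
        ?_).trans (max_self #s).le
      · refine (natDegree_prod_le _ _).trans ((Finset.sum_le_card_nsmul _ _ 1 fun j _ => ?_).trans
          (by simp))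
        have := hlin p (q * z j - 1)
        rwa [C_sub, C_1] at this
      · refine natDegree_sum_le_of_forall_le _ _ fun l hl => ?_
        refine (natDegree_C_mul_le _ _).trans (natDegree_mul_le.trans ?_)
        have h2 := (natDegree_prod_le (s.erase l) fun j => (C (z j) - X : ℂ[X])).trans
          (Finset.sum_le_card_nsmul _ _ 1 fun j _ => hlin' (z j))
        rw [Finset.card_erase_of_mem hl] at h2
        have h3 : 0 < #s := Finset.card_pos.2 ⟨l, hl⟩
        have h4 := hlin (p - z l) (q * z l)
        simp only [smul_eq_mul, mul_one] at h2
        omega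
      · refine (natDegree_C_mul_le _ _).trans ((natDegree_prod_le _ _).trans
          ((Finset.sum_le_card_nsmul _ _ 1 fun j _ => hlin' (z j)).trans (by simp)))
    have heval : ∀ x, P.eval x = ∏ j ∈ s, f p q x (z j) -
        ∑ l ∈ s, A l * (f p q (z l) x * ∏ j ∈ s.erase l, (z j - x)) -
        homSum p q (#s + 1) * ∏ j ∈ s, (z j - x) := fun x => by
      simp only [hP, eval_sub, eval_prod, eval_add, eval_mul, eval_C, eval_X, eval_one,
        eval_finsetSum, f]
      congr 1
      congr 1
      · exact Finset.prod_congr rfl fun j _ => by ring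
      · exact Finset.sum_congr rfl fun j _ => by ring
    have hroot : ∀ x ∈ insert 1 (s.image z), P.eval x = 0 := by
      intro x hx
      rw [heval]
      rcases Finset.mem_insert.1 hx with rfl | hx
      · have h2 : ∏ j ∈ s, f p q 1 (z j) = q ^ #s * ∏ j ∈ s, (z j - 1) := by
          rw [← Finset.prod_const, ← Finset.prod_mul_distrib]
          exact Finset.prod_congr rfl fun j _ => by rw [f, hp]; ring
        have h3 : ∑ l ∈ s, A l * (f p q (z l) 1 * ∏ j ∈ s.erase l, (z j - 1)) =
            -(p * homSum p q #s * ∏ j ∈ s, (z j - 1)) := by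
          rw [← ih, Finset.mul_sum, Finset.sum_mul, ← Finset.sum_neg_distrib]
          refine Finset.sum_congr rfl fun l hl => ?_
          rw [← Finset.mul_prod_erase s _ hl, f, hp]
          ring
        rw [h2, h3, homSum_succ]
        ring
      · obtain ⟨i, hi, rfl⟩ := Finset.mem_image.1 hx
        have h2 : ∏ j ∈ s, (z j - z i) = 0 := Finset.prod_eq_zero hi (sub_self _)
        have h3 : ∑ l ∈ s, A l * (f p q (z l) (z i) * ∏ j ∈ s.erase l, (z j - z i)) =
            ∏ j ∈ s, f p q (z i) (z j) := by
          rw [Finset.sum_eq_single_of_mem i hi]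
          · rw [hA, mul_left_comm, ← Finset.prod_mul_distrib, ← Finset.mul_prod_erase s _ hi]
            congr 1
            refine Finset.prod_congr rfl fun j hj => div_mul_cancel₀ _ ?_
            exact hsub i hi j (Finset.mem_of_mem_erase hj) (Finset.ne_of_mem_erase hj).symm
          · intro l hl hli
            rw [Finset.prod_eq_zero (Finset.mem_erase.2 ⟨hli.symm, hi⟩) (sub_self _)]
            ring
        rw [h2, h3]
        ring
    have hP0 : P = 0 := by
      refine eq_zero_of_natDegree_lt_card_of_eval_eq_zero' P (insert 1 (s.image z)) hroot ?_
      rw [Finset.card_insert_of_notMem, Finset.card_image_of_injOn hzs]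
      · omega
      · intro h
        obtain ⟨i, hi, hi1⟩ := Finset.mem_image.1 h
        exact h1 i (by simp [hi]) hi1
    have hw0 := heval (z w)
    rw [hP0, eval_zero] at hw0
    have hne : ∀ j ∈ s, z j - z w ≠ 0 := fun j hj => sub_ne_zero.2 fun h =>
      hw (hz (by simp [hj]) (by simp) h ▸ hj)
    have hD : ∏ j ∈ s, (z j - z w) ≠ 0 := Finset.prod_ne_zero_iff.2 hne
    rw [Finset.sum_insert hw, Finset.card_insert_of_notMem hw, Finset.erase_insert hw]
    have h2 : ∀ l ∈ s, ∏ j ∈ (insert w s).erase l, f p q (z l) (z j) / (z j - z l) =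
        -(A l * (f p q (z l) (z w) * ∏ j ∈ s.erase l, (z j - z w))) / ∏ j ∈ s, (z j - z w) := by
      intro l hl
      have hwl : w ≠ l := fun h => hw (h ▸ hl)
      rw [Finset.erase_insert_of_ne hwl, Finset.prod_insert fun h =>
        hw (Finset.mem_of_mem_erase h), ← Finset.mul_prod_erase s (fun j => z j - z w) hl]
      have h3 : ∏ j ∈ s.erase l, (z j - z w) ≠ 0 := Finset.prod_ne_zero_iff.2 fun j hj =>
        hne j (Finset.mem_of_mem_erase hj)
      have h4 := hne l hl
      have h5 : z w - z l ≠ 0 := by rw [← neg_sub]; exact neg_ne_zero.2 h4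
      rw [← neg_sub (z l) (z w)]
      simp only [hA]
      field_simp
    rw [Finset.sum_congr rfl h2, Finset.prod_div_distrib, ← Finset.sum_div, ← add_div,
      div_eq_iff hD, Finset.sum_neg_distrib]
    linear_combination -hw0

/-- The pair factor of the amplitudes. -/
def signedF (p q : ℝ) (ξ : Fin N → ℂ) (i j : Fin N) : ℂ :=
  if i = j then 0 else if i < j then f p q (ξ i) (ξ j) else -f p q (ξ i) (ξ j)

/-- This is `sum_prod_f_div` multiplied by the Vandermonde product of `s`; the sign in `signedF` is
the one that orients each difference `ξ j - ξ l` by increasing labels. -/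
theorem isArrangement_signedF {p q : ℝ} (hpq : p + q = 1) {ξ : Fin N → ℂ}
    (hξ : Function.Injective ξ) (h1 : ∀ i, ξ i ≠ 1) :
    IsArrangement (signedF p q ξ) (fun s => orderedProd s fun i j => ξ j - ξ i)
      (homSum p q) where
  self i := by simp [signedF]
  empty := by simp [orderedProd]
  step s _ := by
    rw [← sum_prod_f_div hpq s ξ hξ.injOn fun i _ => h1 i, Finset.sum_mul]
    refine Finset.sum_congr rfl fun l hl => ?_
    conv_rhs => rw [← Finset.insert_erase hl, orderedProd_insert (Finset.notMem_erase l s),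
      Finset.erase_insert (Finset.notMem_erase l s)]
    rw [mul_left_comm, mul_comm, ← Finset.prod_mul_distrib]
    congr 1
    refine Finset.prod_congr rfl fun j hj => ?_
    have hne : l ≠ j := (Finset.ne_of_mem_erase hj).symm
    have h2 : ξ j - ξ l ≠ 0 := sub_ne_zero.2 fun h => hne (hξ h.symm)
    rw [signedF, if_neg hne]
    split_ifs
    · rw [div_mul_cancel₀ _ h2]
    · rw [← neg_sub (ξ j), mul_neg, div_mul_cancel₀ _ h2]

/-- Only the numerator depends on the arrangement of the labels; the denominator depends only on
their set. This makes the sum over arrangements accessible to `IsArrangement`. -/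
theorem amp_eq_mul_inv {p q : ℝ} {ξ : Fin N → ℂ} (hf : ∀ i j, f p q (ξ i) (ξ j) ≠ 0)
    (e : Fin r → Fin N) :
    amp p q e ξ = pairProd (fun a b => signedF p q ξ (e a) (e b)) *
      (orderedProd (univ.image e) fun i j => f p q (ξ i) (ξ j))⁻¹ := by
  by_cases he : Function.Injective e
  · rw [orderedProd_image he, amp, pairProd, pairProd, pairProd, ← Finset.prod_inv_distrib,
      ← Finset.prod_mul_distrib]
    refine Finset.prod_congr rfl fun x hx => ?_
    have hne : e x.1 ≠ e x.2 := fun h => (Finset.mem_filter.1 hx).2.ne (he h)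
    rw [scat, signedF, if_neg hne, if_neg hne]
    split_ifs
    · rw [mul_inv_cancel₀ (hf _ _)]
    · rw [neg_mul, div_eq_mul_inv]
  · rw [amp_eq_zero he, pairProd_comp_eq_zero (fun i => by simp [signedF]) he, zero_mul]

/-! ### The weights -/

/-- The power of `τ` belonging to a set of `m + k - 1` labels with the given sum. -/
def labelPow (τ : ℝ) (m k : ℕ) (s : ℤ) : ℝ := τ ^ (s - (m * (m - 1) / 2 : ℕ) - m * k)

/-- The sum of the labels `1, …, N` in a tuple. -/
def labelSum (e : Fin r → Fin N) : ℤ := ∑ a, ((e a : ℤ) + 1)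

theorem two_mul_pred_half (m : ℕ) : 2 * ((m * (m - 1) / 2 : ℕ) : ℤ) = m * m - m := by
  have h := Nat.mul_div_cancel' (Nat.even_mul_pred_self m).two_dvd
  rcases m with _ | m
  · simp
  · have : ((2 * ((m + 1) * (m + 1 - 1) / 2) : ℕ) : ℤ) = ((m + 1) * (m + 1 - 1) : ℕ) := by rw [h]
    push_cast [Nat.add_sub_cancel] at this ⊢
    linarith

/-- The `m + k - 1` labels are distinct, so they sum to at least `(m + k - 1) * (m + k) / 2`, which
is `m * (m - 1) / 2 + m * k + k * (k - 1) / 2`. A nonnegative exponent is what makes the rules for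
powers of `τ` valid when `p = 0`. -/
theorem le_sum_label {m k : ℕ} {U : Finset (Fin N)} (hU : #U + 1 = m + k) :
    0 ≤ ∑ i ∈ U, ((i : ℤ) + 1) - (m * (m - 1) / 2 : ℕ) - m * k := by
  have hinj : Function.Injective fun i : Fin N => (i : ℤ) + 1 := fun a b hab => Fin.ext (by
    simpa using hab)
  have h1 := Finset.sum_range_le_sum (s := U.image fun i : Fin N => (i : ℤ) + 1) (c := 1) (by simp)
  rw [Finset.sum_image hinj.injOn, Finset.card_image_of_injective _ hinj,
    Finset.sum_add_distrib, ← Nat.cast_sum, Finset.sum_range_id] at h1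
  have h2 := two_mul_pred_half m
  have h3 := two_mul_pred_half #U
  have h4 : (#U : ℤ) + 1 = m + k := by exact_mod_cast hU
  simp only [sum_const, card_range, mul_one, nsmul_eq_mul] at h1
  have h5 : (#U : ℤ) = m + k - 1 := by linarith
  rw [h5] at h1 h3
  have h6 : (0 : ℤ) ≤ k * k - k := by
    rcases k with _ | k
    · simp
    · push_cast; nlinarith
  nlinarith

theorem le_labelSum {m k : ℕ} (hr : r + 1 = m + k) {e : Fin r → Fin N}
    (he : Function.Injective e) : 0 ≤ labelSum e - (m * (m - 1) / 2 : ℕ) - m * k := by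
  have h := le_sum_label (m := m) (k := k) (U := univ.image e) (by
    rw [Finset.card_image_of_injective _ he, Finset.card_univ, Fintype.card_fin, hr])
  rwa [Finset.sum_image he.injOn] at h

theorem labelSum_comp_perm (e : Fin r → Fin N) (s : Equiv.Perm (Fin r)) :
    labelSum (e ∘ s) = labelSum e :=
  Equiv.sum_comp s fun a => ((e a : ℤ) + 1)

theorem labelSum_swap_comp {u v : Fin N} (huv : (u : ℕ) + 1 = v) {e : Fin r → Fin N}
    (he : Function.Injective e) :
    labelSum (Equiv.swap u v ∘ e) = labelSum e + (if u ∈ Set.range e then 1 else 0) -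
      if v ∈ Set.range e then 1 else 0 := by
  have hne : u ≠ v := by rintro rfl; omega
  have h1 : ∀ x : Fin N, (∑ a, if e a = x then (1 : ℤ) else 0) =
      if x ∈ Set.range e then 1 else 0 := fun x => by
    split_ifs with h
    · obtain ⟨b, rfl⟩ := h
      simp [he.eq_iff]
    · exact Finset.sum_eq_zero fun a _ => if_neg fun h' => h ⟨a, h'⟩
  rw [← h1, ← h1, labelSum, labelSum, ← Finset.sum_add_distrib, ← Finset.sum_sub_distrib]
  refine Finset.sum_congr rfl fun a _ => ?_
  rw [Function.comp_apply, Equiv.swap_apply_def]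
  have : (v : ℤ) = u + 1 := by exact_mod_cast huv.symm
  split_ifs with h2 h3 h3
  · exact absurd (h2.symm.trans h3) hne
  · rw [h2]; linarith
  · rw [h3]; linarith
  · ring

/-- Replacing the label `u` by `u + 1` raises the sum of labels by one and so multiplies the weight
by `p / q`; if both or neither occur, the sum is unchanged. -/
theorem isBalanced_labelPow {p q : ℝ} (hq : 0 < q) {m k : ℕ} (hr : r + 1 = m + k) :
    IsBalanced p q fun e : Fin r → Fin N => ((labelPow (p / q) m k (labelSum e) : ℝ) : ℂ) := by
  intro u v huv e he
  refine ⟨fun h => ?_, fun hu hv => ?_⟩ <;> dsimp only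
  · rw [labelSum_swap_comp huv he]
    simp only [h]
    ring_nf
  · rw [labelSum_swap_comp huv he, if_pos hu, if_neg hv, labelPow, labelPow]
    obtain ⟨z, hz⟩ := Int.eq_ofNat_of_zero_le (le_labelSum hr he)
    rw [show labelSum e + 1 - 0 - ((m * (m - 1) / 2 : ℕ) : ℤ) - m * k =
      (z + 1 : ℕ) by push_cast; push_cast at hz; linarith, hz, zpow_natCast, zpow_natCast, pow_succ]
    rw [← Complex.ofReal_mul, ← Complex.ofReal_mul]
    congr 1
    field_simp

/-! ### The variables are distinct almost everywhere -/

theorem circleMeasure_singleton {R : ℝ} (hR : R ≠ 0) (z : ℂ) : circleMeasure R {z} = 0 := by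
  rw [circleMeasure, Measure.map_apply (measurable_circleMap R) (measurableSet_singleton z),
    angleMeasure, Measure.smul_apply]
  have h : volume (circleMap 0 R ⁻¹' {z}) = 0 :=
    ((Set.countable_singleton z).preimage_circleMap 0 hR).measure_zero _
  rw [nonpos_iff_eq_zero.1 ((Measure.restrict_le_self _).trans h.le)]
  simp

/-- Circles have no atoms, so each diagonal is null by Fubini. The antisymmetrisation identity and
the cancellation of the factors `ξ j - ξ i` are available only off the diagonals. -/
theorem ae_injective_torusMeasure {ι : Type*} [Fintype ι] {R : ℝ} (hR : R ≠ 0) :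
    ∀ᵐ ξ ∂torusMeasure ι R, Function.Injective ξ := by
  have h : ∀ i j : ι, i ≠ j → ∀ᵐ ξ ∂torusMeasure ι R, ξ i ≠ ξ j := by
    intro i j hij
    have hg : Function.Injective ![i, j] := by
      intro a b
      fin_cases a <;> fin_cases b <;> simp [hij, hij.symm]
    have h1 := measurePreserving_finTwoArrow (circleMeasure R)
    have h2 := h1.comp (measurePreserving_comp R hg)
    have hs : MeasurableSet {x : ℂ × ℂ | x.1 = x.2} :=
      measurableSet_eq_fun measurable_fst measurable_snd
    have h3 : ∀ᵐ x ∂(circleMeasure R).prod (circleMeasure R), x.1 ≠ x.2 := by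
      rw [ae_iff]
      simp only [ne_eq, not_not]
      rw [Measure.measure_prod_null hs]
      refine Filter.Eventually.of_forall fun x => ?_
      have : Prod.mk x ⁻¹' {x : ℂ × ℂ | x.1 = x.2} = {x} := by
        ext y; simp [eq_comm]
      dsimp only
      rw [this]
      exact circleMeasure_singleton hR x
    filter_upwards [h2.quasiMeasurePreserving.ae h3] with ξ hξ
    simpa using hξ
  have h' : ∀ᵐ ξ ∂torusMeasure ι R, ∀ i j : ι, i ≠ j → ξ i ≠ ξ j := by
    refine ae_all_iff.2 fun i => ae_all_iff.2 fun j => ?_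
    by_cases hij : i = j
    · exact Filter.Eventually.of_forall fun ξ h => absurd hij h
    · filter_upwards [h i j hij] with ξ hξ _ using hξ
  filter_upwards [h'] with ξ hξ i j hij
  by_contra hne
  exact hξ i j hne hij

/-! ### Signs and labels -/

theorem prod_signedF {p q : ℝ} (ξ : Fin N → ℂ) {A B : Finset (Fin N)} (h : Disjoint A B) :
    ∏ i ∈ A, ∏ j ∈ B, signedF p q ξ i j =
      (-1) ^ σ A B * ∏ i ∈ A, ∏ j ∈ B, f p q (ξ i) (ξ j) := by
  have h1 : ∀ i ∈ A, ∀ j ∈ B, signedF p q ξ i j =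
      (if j ≤ i then -1 else 1) * f p q (ξ i) (ξ j) := by
    intro i hi j hj
    have hne : i ≠ j := fun h' => Finset.disjoint_left.1 h hi (h' ▸ hj)
    rw [signedF, if_neg hne]
    rcases lt_or_gt_of_ne hne with h' | h'
    · simp [h', h'.not_ge]
    · simp [h'.le, h'.not_gt]
  rw [Finset.prod_congr rfl fun i hi => Finset.prod_congr rfl (h1 i hi)]
  simp only [Finset.prod_mul_distrib]
  congr 1
  rw [← Finset.prod_product' (f := fun i j => if j ≤ i then (-1 : ℂ) else 1), Finset.prod_ite, σ]
  simp

theorem pairProd_signedF {p q : ℝ} (ξ : Fin N → ℂ) {l : Fin r → Fin N}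
    (hl : Function.Injective l) :
    (pairProd fun a b => signedF p q ξ (l a) (l b)) =
      (sgn l : ℂ) * ∏ a, ∏ b with a < b, f p q (ξ (l a)) (ξ (l b)) := by
  have h1 : (∏ a, ∏ b with a < b, f p q (ξ (l a)) (ξ (l b))) =
      pairProd fun a b => f p q (ξ (l a)) (ξ (l b)) := by
    rw [pairProd_eq_prod_prod]
    simp only [Finset.prod_filter]
  have h2 : (sgn l : ℂ) = pairProd fun a b => if l b < l a then (-1 : ℂ) else 1 := by
    rw [pairProd, Finset.prod_ite, Finset.prod_const_one, mul_one, Finset.prod_const,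
      Finset.filter_filter, sgn]
    push_cast
    rfl
  rw [h1, h2, pairProd, pairProd, pairProd, ← Finset.prod_mul_distrib]
  refine Finset.prod_congr rfl fun x hx => ?_
  have hne : l x.1 ≠ l x.2 := fun h => (Finset.mem_filter.1 hx).2.ne (hl h)
  rw [signedF, if_neg hne]
  rcases lt_or_gt_of_ne hne with h' | h'
  · simp [h', h'.not_gt]
  · simp [h', h'.not_gt]

/-- The Vandermonde product of the union contains every mixed difference, oriented by the labels;
orienting all of them from `S₁` to `S` costs one sign for each pair counted by `σ S₁ S`. This is why
the denominators `ξ j - ξ i` cancel. -/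
theorem orderedProd_sub_union (ξ : Fin N → ℂ) {S S₁ : Finset (Fin N)} (h : Disjoint S S₁) :
    (orderedProd (S ∪ S₁) fun i j => ξ j - ξ i) =
      (orderedProd S fun i j => ξ j - ξ i) * (orderedProd S₁ fun i j => ξ j - ξ i) *
        ((-1) ^ σ S₁ S * ∏ i ∈ S₁, ∏ j ∈ S, (ξ j - ξ i)) := by
  rw [orderedProd_union h, Finset.prod_comm]
  congr 1
  have h1 : ∀ i ∈ S₁, ∀ j ∈ S, (if j < i then ξ i - ξ j else ξ j - ξ i) =
      (if j ≤ i then -1 else 1) * (ξ j - ξ i) := by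
    intro i hi j hj
    have hne : i ≠ j := fun h' => Finset.disjoint_left.1 h hj (h' ▸ hi)
    rcases lt_or_gt_of_ne hne with h' | h'
    · simp [h'.not_gt, h'.not_ge]
    · simp [h'.le, h']
  rw [Finset.prod_congr rfl fun i hi => Finset.prod_congr rfl (h1 i hi)]
  simp only [Finset.prod_mul_distrib]
  congr 1
  rw [← Finset.prod_product' (f := fun i j => if j ≤ i then (-1 : ℂ) else 1), Finset.prod_ite, σ]
  simp

theorem σ_union_left {A B C : Finset (Fin N)} (h : Disjoint A B) :
    σ (A ∪ B) C = σ A C + σ B C := by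
  rw [σ, σ, σ, Finset.union_product, Finset.filter_union, Finset.card_union_of_disjoint]
  refine Finset.disjoint_filter_filter (Finset.disjoint_left.2 fun x hx hx' => ?_)
  exact Finset.disjoint_left.1 h (Finset.mem_product.1 hx).1 (Finset.mem_product.1 hx').1

theorem σ_add_swap {A B : Finset (Fin N)} (h : Disjoint A B) : σ A B + σ B A = #A * #B := by
  have h1 : σ B A = #{x ∈ A ×ˢ B | ¬ x.2 ≤ x.1} := by
    rw [σ]
    refine Finset.card_bij' (fun x _ => x.swap) (fun x _ => x.swap) ?_ ?_ ?_ ?_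
    · intro x hx
      simp only [mem_filter, mem_product, Prod.fst_swap, Prod.snd_swap] at hx ⊢
      refine ⟨⟨hx.1.2, hx.1.1⟩, fun h' => ?_⟩
      exact Finset.disjoint_left.1 h hx.1.2 (le_antisymm hx.2 h' ▸ hx.1.1)
    · intro x hx
      simp only [mem_filter, mem_product, Prod.fst_swap, Prod.snd_swap] at hx ⊢
      exact ⟨⟨hx.1.2, hx.1.1⟩, (not_le.1 hx.2).le⟩
    · simp
    · simp
  rw [h1, σ, Finset.card_filter_add_card_filter_not, Finset.card_product]

theorem σ_univ (U : Finset (Fin N)) : (σ U univ : ℤ) = ∑ i ∈ U, ((i : ℤ) + 1) := by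
  have : σ U univ = ∑ i ∈ U, #{j : Fin N | j ≤ i} := by
    rw [σ, Finset.card_filter, Finset.sum_product]
    simp only [Finset.card_filter]
  rw [this]
  push_cast
  refine Finset.sum_congr rfl fun i _ => ?_
  rw [show (univ.filter fun j : Fin N => j ≤ i) = Finset.Iic i by ext; simp, Fin.card_Iic]
  push_cast; rfl

/-! ### The integrand as a sum of plane waves -/

/-- The slots with half-lines: the first `c` and the last `k` ones. -/
def slotSet (c d k : ℕ) : Finset (Fin (c + d + k)) :=
  univ.filter fun a => (a : ℕ) < c ∨ c + d ≤ a

/-- The bounds of the slots. -/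
def slotBound (c d k : ℕ) (x₀ : ℤ) (x : Fin d → ℤ) (z : ℤ) : Fin (c + d + k) → ℤ :=
  Fin.append (Fin.append (fun _ => x₀) x) fun _ => z

theorem prod_slotFn_append {c d k : ℕ} (x₀ : ℤ) (x : Fin d → ℤ) (z : ℤ)
    (ζ : Fin (c + d + k) → ℂ) :
    ∏ a, slotFn (slotSet c d k) (slotBound c d k x₀ x z) a (ζ a) =
      (∏ a : Fin c, ζ (Fin.castAdd k (Fin.castAdd d a)) ^ (x₀ + 1) /
        (ζ (Fin.castAdd k (Fin.castAdd d a)) - 1)) *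
      (∏ a : Fin d, ζ (Fin.castAdd k (Fin.natAdd c a)) ^ x a) *
      ∏ a : Fin k, ζ (Fin.natAdd (c + d) a) ^ (z + 1) / (ζ (Fin.natAdd (c + d) a) - 1) := by
  have h1 : ∀ a : Fin c, Fin.castAdd k (Fin.castAdd d a) ∈ slotSet c d k := fun a => by
    simp [slotSet]
  have h2 : ∀ a : Fin d, Fin.castAdd k (Fin.natAdd c a) ∉ slotSet c d k := fun a => by
    simp [slotSet]
  have h3 : ∀ a : Fin k, Fin.natAdd (c + d) a ∈ slotSet c d k := fun a => by
    simp [slotSet]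
  simp only [Fin.prod_univ_add, slotFn, h1, h2, h3, if_true, if_false, slotBound,
    Fin.append_left, Fin.append_right]

theorem prod_slotInd_append {c d k : ℕ} (x₀ : ℤ) (x : Fin d → ℤ) (z : ℤ)
    (y : Fin (c + d + k) → ℤ) :
    ∏ a, slotInd (slotSet c d k) (slotBound c d k x₀ x z) a (y a) =
      (∏ a : Fin c, if y (Fin.castAdd k (Fin.castAdd d a)) ≤ x₀ then 1 else 0) *
      (∏ a : Fin d, if y (Fin.castAdd k (Fin.natAdd c a)) = x a then 1 else 0) *
      ∏ a : Fin k, if y (Fin.natAdd (c + d) a) ≤ z then 1 else 0 := by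
  have h1 : ∀ a : Fin c, Fin.castAdd k (Fin.castAdd d a) ∈ slotSet c d k := fun a => by
    simp [slotSet]
  have h2 : ∀ a : Fin d, Fin.castAdd k (Fin.natAdd c a) ∉ slotSet c d k := fun a => by
    simp [slotSet]
  have h3 : ∀ a : Fin k, Fin.natAdd (c + d) a ∈ slotSet c d k := fun a => by
    simp [slotSet]
  simp only [Fin.prod_univ_add, slotInd, h1, h2, h3, if_true, if_false, slotBound,
    Fin.append_left, Fin.append_right]

/-- The part of the density that does not depend on the time. -/
def slotDensity (c d k : ℕ) (x₀ : ℤ) (x : Fin d → ℤ) (z : ℤ) (ζ : Fin (c + d + k) → ℂ) : ℂ :=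
  ∏ a, slotFn (slotSet c d k) (slotBound c d k x₀ x z) a (ζ a)

/-- The contribution of the sets `S₁`, `S` and the tuple `l`, up to the antisymmetric factors. -/
def blockTerm (p q : ℝ) (Y : Fin N → ℤ) (n m : ℕ) (x : ℕ → ℤ) (t : ℝ) (S₁ : Finset (Fin N))
    (l : Fin (m - n) → Fin N) (S : Finset (Fin N)) (ξ : Fin N → ℂ) : ℂ :=
  (labelPow (p / q) m #S
      (∑ i ∈ S₁, ((i : ℤ) + 1) + ∑ a, ((l a : ℤ) + 1) + ∑ i ∈ S, ((i : ℤ) + 1)) : ℝ) *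
    (orderedProd (S₁ ∪ univ.image l ∪ S) fun i j => f p q (ξ i) (ξ j))⁻¹ *
    ((∏ i ∈ S₁, ξ i ^ x n / (ξ i - 1)) * (∏ a, ξ (l a) ^ x (n + a)) *
      (∏ i ∈ S, ξ i ^ (x m + 1) / (ξ i - 1) - ∏ i ∈ S, ξ i ^ x m / (ξ i - 1)) *
      Complex.exp ((∑ i ∈ S₁, ε p q (ξ i) + ∑ a, ε p q (ξ (l a)) + ∑ i ∈ S, ε p q (ξ i)) * t)) *
    ((∏ i ∈ S₁, ξ i ^ (-Y i)) * (∏ a, ξ (l a) ^ (-Y (l a))) * ∏ i ∈ S, ξ i ^ (-Y i))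

theorem image_append {c d : ℕ} (e : Fin c → Fin N) (e' : Fin d → Fin N) :
    univ.image (Fin.append e e') = univ.image e ∪ univ.image e' := by
  ext i
  simp only [Finset.mem_image, mem_univ, true_and, Finset.mem_union]
  constructor
  · rintro ⟨a, rfl⟩
    refine Fin.addCases (fun a => ?_) (fun a => ?_) a
    · exact Or.inl ⟨a, by simp⟩
    · exact Or.inr ⟨a, by simp⟩
  · rintro (⟨a, rfl⟩ | ⟨a, rfl⟩)
    · exact ⟨Fin.castAdd d a, by simp⟩
    · exact ⟨Fin.natAdd c a, by simp⟩

/-- Apart from the pair factors, the summand for a tuple sees the outer two blocks only through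
their images, which is the hypothesis of `IsArrangement.sum_blocks`. -/
theorem blockTerm_eq {p q : ℝ} (Y : Fin N → ℤ) (n m : ℕ) (x : ℕ → ℤ) (t : ℝ)
    {c k : ℕ} {e₁ : Fin c → Fin N} (l : Fin (m - n) → Fin N) {e₂ : Fin k → Fin N}
    (he₁ : Function.Injective e₁) (he₂ : Function.Injective e₂) (ξ : Fin N → ℂ)
    {e : Fin (c + (m - n) + k) → Fin N} (he : e = Fin.append (Fin.append e₁ l) e₂) :
    ((labelPow (p / q) m k (labelSum e) : ℝ) : ℂ) *
      (orderedProd (univ.image e) fun i j => f p q (ξ i) (ξ j))⁻¹ *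
      ((slotDensity c (m - n) k (x n - 1) (fun a => x (n + a)) (x m) (ξ ∘ e) -
        slotDensity c (m - n) k (x n - 1) (fun a => x (n + a)) (x m - 1) (ξ ∘ e)) *
        Complex.exp ((∑ a, ε p q ((ξ ∘ e) a)) * t)) * (∏ a, ξ (e a) ^ (-Y (e a))) =
      blockTerm p q Y n m x t (univ.image e₁) l (univ.image e₂) ξ := by
  have hk : #(univ.image e₂) = k := by rw [Finset.card_image_of_injective _ he₂]; simp
  subst he
  rw [slotDensity, slotDensity, prod_slotFn_append, prod_slotFn_append]
  simp only [blockTerm, hk, image_append, labelSum,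
    Fin.sum_univ_add, Fin.prod_univ_add, Fin.append_left, Fin.append_right,
    Function.comp_apply, Finset.prod_image he₁.injOn, Finset.prod_image he₂.injOn,
    Finset.sum_image he₁.injOn, Finset.sum_image he₂.injOn, sub_add_cancel]
  ring

/-- The `τ`-factorial. -/
def tauFactorial (τ : ℂ) (k : ℕ) : ℂ := ∏ i ∈ range k, ∑ a ∈ range (i + 1), τ ^ a

theorem tauFactorial_ne_zero {p q : ℝ} (hp : 0 ≤ p) (hq : 0 < q) (k : ℕ) :
    tauFactorial (p / q : ℂ) k ≠ 0 := by
  refine Finset.prod_ne_zero_iff.2 fun i _ => ?_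
  have h : (0 : ℝ) < ∑ a ∈ range (i + 1), (p / q) ^ a := by
    rw [Finset.sum_range_succ', pow_zero]
    have : 0 ≤ ∑ a ∈ range i, (p / q) ^ (a + 1) := Finset.sum_nonneg fun a _ => by positivity
    linarith
  exact_mod_cast h.ne'

/-- The bookkeeping of signs and constants: `signedF` absorbs `sgn` and the signs `(-1) ^ σ`, the
powers of `q` turn `τ`-factorials into products of `homSum`, and the factors `1 - ξ j` rewritten as
`ξ j - 1` leave `-(-1) ^ #S`. -/
theorem coefficient_mul_integrand {p q : ℝ} (hp : 0 ≤ p) (hq : 0 < q) (Y : Config N) {n m : ℕ}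
    (x : ℕ → ℤ) (t : ℝ)
    {S S₁ : Finset (Fin N)} (l : Fin (m - n) ↪ Fin N) (hS : Disjoint S S₁) (hS₁ : #S₁ = n - 1)
    (hl : Disjoint (S ∪ S₁) (univ.map l)) {ξ : Fin N → ℂ} (hξ : Function.Injective ξ)
    (h0 : ∀ i, ξ i ≠ 0) :
    (coefficient p q n m S S₁ l : ℂ) *
      (integrand p q Y n m x t S S₁ l ξ * ∏ i ∈ indices S S₁ l, ξ i) =
    -(-1) ^ #S / (tauFactorial (p / q) (n - 1) * tauFactorial (p / q) #S) *
      ((∏ i ∈ range (n - 1), homSum p q (i + 1)) * (∏ i ∈ range #S, homSum p q (i + 1)) *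
      ((orderedProd S fun i j => ξ j - ξ i) * (orderedProd S₁ fun i j => ξ j - ξ i) *
        (pairProd fun a b => signedF p q ξ (l a) (l b)) *
        (∏ i ∈ S₁, ∏ b, signedF p q ξ i (l b)) * (∏ i ∈ S₁, ∏ j ∈ S, signedF p q ξ i j) *
        (∏ b, ∏ j ∈ S, signedF p q ξ (l b) j) * blockTerm p q Y.1 n m x t S₁ l S ξ)) := by
  set Λ := univ.map l with hΛ
  obtain ⟨hSΛ, hS₁Λ⟩ := Finset.disjoint_union_left.1 hl
  have himg : univ.image l = Λ := by rw [hΛ, Finset.map_eq_image]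
  have hU : indices S S₁ l = S₁ ∪ Λ ∪ S := by
    rw [indices, ← hΛ, Finset.union_assoc, Finset.union_comm S]
  have hd1 : Disjoint (S₁ ∪ Λ) S := Finset.disjoint_union_left.2 ⟨hS.symm, hSΛ.symm⟩
  have hk1 := tauFactorial_ne_zero hp hq (n - 1)
  have hk2 := tauFactorial_ne_zero hp hq #S
  have hprod : ∀ g : Fin N → ℂ, ∏ b, g (l b) = ∏ j ∈ Λ, g j := fun g => by
    rw [hΛ, Finset.prod_map]
  have hsum : ∀ g : Fin N → ℂ, ∑ b, g (l b) = ∑ j ∈ Λ, g j := fun g => by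
    rw [hΛ, Finset.sum_map]
  have hprodU : ∀ g : Fin N → ℂ, ∏ i ∈ indices S S₁ l, g i =
      (∏ i ∈ S₁, g i) * (∏ i ∈ Λ, g i) * ∏ i ∈ S, g i := fun g => by
    rw [hU, Finset.prod_union hd1, Finset.prod_union hS₁Λ]
  have hlab : ((σ (indices S S₁ l) univ : ℤ) - (m * (m - 1) / 2 : ℕ) - m * #S) =
      (∑ i ∈ S₁, ((i : ℤ) + 1) + ∑ a, ((l a : ℤ) + 1) + ∑ i ∈ S, ((i : ℤ) + 1)) -
        (m * (m - 1) / 2 : ℕ) - m * #S := by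
    rw [σ_univ, hU, Finset.sum_union hd1, Finset.sum_union hS₁Λ, hΛ, Finset.sum_map]
  have hcard : #Λ = m - n := by rw [hΛ, Finset.card_map]; simp
  have hcoef : (coefficient p q n m S S₁ l : ℂ) =
      (-1) ^ σ S₁ Λ * (-1) ^ σ Λ S * (-1) ^ (n - 1) * (sgn l : ℂ) *
      (labelPow (p / q) m #S (∑ i ∈ S₁, ((i : ℤ) + 1) + ∑ a, ((l a : ℤ) + 1) +
        ∑ i ∈ S, ((i : ℤ) + 1)) : ℝ) *
      (q ^ (#S * (#S - 1) / 2) * q ^ ((n - 1) * (n - 1 - 1) / 2)) := by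
    -- Since `σ S Λ + σ Λ S = k * (m - n)`, the sign `(-1) ^ ((m - n) * k)` turns `σ S Λ` into `σ Λ
    -- S`, matching the order of the blocks in the tuple.
    have hsg : ((-1) ^ (σ (S ∪ S₁) Λ + (n - 1) + (m - n) * #S) : ℂ) =
        (-1) ^ σ S₁ Λ * (-1) ^ σ Λ S * (-1) ^ (n - 1) := by
      rw [σ_union_left hS, ← hcard, mul_comm #Λ, ← σ_add_swap hSΛ]
      have h2 : ((-1) ^ σ S Λ * (-1) ^ σ S Λ : ℂ) = 1 := by
        rw [← mul_pow]; simp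
      rw [pow_add, pow_add, pow_add, pow_add]
      linear_combination ((-1) ^ σ S₁ Λ * (-1) ^ (n - 1) * (-1) ^ σ Λ S : ℂ) * h2
    rw [coefficient, ← hΛ, hlab, ← hsg, ← pow_add, labelPow, show n - 1 - 1 = n - 2 by omega]
    push_cast
    ring
  have hV := orderedProd_sub_union ξ hS
  have hZ : (∏ j ∈ S ∪ S₁, (1 - ξ j))⁻¹ = ((-1) ^ #S * (-1) ^ (n - 1)) *
      ((∏ i ∈ S, (ξ i - 1))⁻¹ * (∏ i ∈ S₁, (ξ i - 1))⁻¹) := by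
    have h2 : ∀ A : Finset (Fin N), ∏ j ∈ A, (1 - ξ j) = (-1) ^ #A * ∏ j ∈ A, (ξ j - 1) := by
      intro A
      rw [← Finset.prod_const, ← Finset.prod_mul_distrib]
      exact Finset.prod_congr rfl fun j _ => by ring
    have h3 : ∀ a : ℕ, (((-1) ^ a : ℂ))⁻¹ = (-1) ^ a := fun a => by
      rw [← inv_pow, inv_neg, inv_one]
    rw [Finset.prod_union hS, h2, h2, mul_inv, mul_inv, mul_inv, h3, h3, hS₁]
    ring
  have hD : (∏ i ∈ S₁, ∏ j ∈ S, (ξ j - ξ i)) * (1 / ∏ i ∈ S₁, ∏ j ∈ S, (ξ j - ξ i)) = 1 := by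
    refine mul_one_div_cancel (Finset.prod_ne_zero_iff.2 fun i hi =>
      Finset.prod_ne_zero_iff.2 fun j hj => sub_ne_zero.2 fun h => ?_)
    exact Finset.disjoint_left.1 hS hj (hξ h ▸ hi)
  have hv : ((-1) ^ (n - 1) * (-1) ^ (n - 1) : ℂ) = 1 := by rw [← mul_pow]; simp
  have hYξ : (∏ i ∈ indices S S₁ l, ξ i ^ (-Y.1 i - 1)) * ∏ i ∈ indices S S₁ l, ξ i =
      (∏ i ∈ S₁, ξ i ^ (-Y.1 i)) * (∏ i ∈ Λ, ξ i ^ (-Y.1 i)) * ∏ i ∈ S, ξ i ^ (-Y.1 i) := by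
    rw [← hprodU, ← Finset.prod_mul_distrib]
    exact Finset.prod_congr rfl fun i _ => by rw [zpow_sub_one₀ (h0 i), inv_mul_cancel_right₀ (h0 i)]
  have hexp : ∑ i ∈ indices S S₁ l, ε p q (ξ i) * t =
      (∑ i ∈ S₁, ε p q (ξ i) + ∑ a, ε p q (ξ (l a)) + ∑ i ∈ S, ε p q (ξ i)) * t := by
    rw [hsum fun i => ε p q (ξ i), ← Finset.sum_mul, hU, Finset.sum_union hd1,
      Finset.sum_union hS₁Λ]
  have hF1 : ∏ i ∈ S₁, ∏ j ∈ S ∪ Λ, f p q (ξ i) (ξ j) =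
      (∏ i ∈ S₁, ∏ j ∈ S, f p q (ξ i) (ξ j)) * ∏ i ∈ S₁, ∏ j ∈ Λ, f p q (ξ i) (ξ j) := by
    simp only [Finset.prod_union hSΛ, Finset.prod_mul_distrib]
  -- The factor `1 - ∏ ξ j` arises, up to sign, as the difference of the half-line densities for the
  -- bounds `x m` and `x m - 1`.
  have hG : ∏ i ∈ S, ξ i ^ (x m + 1) / (ξ i - 1) - ∏ i ∈ S, ξ i ^ x m / (ξ i - 1) =
      (∏ i ∈ S, ξ i ^ x m) * (∏ i ∈ S, ξ i - 1) * (∏ i ∈ S, (ξ i - 1))⁻¹ := by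
    have : ∀ i ∈ S, ξ i ^ (x m + 1) / (ξ i - 1) = ξ i ^ x m * ξ i * (ξ i - 1)⁻¹ := fun i _ => by
      rw [zpow_add_one₀ (h0 i), div_eq_mul_inv]
    rw [Finset.prod_congr rfl this]
    simp only [div_eq_mul_inv, Finset.prod_mul_distrib, Finset.prod_inv_distrib]
    ring
  have hG1 : ∏ i ∈ S₁, ξ i ^ x n / (ξ i - 1) =
      (∏ i ∈ S₁, ξ i ^ x n) * (∏ i ∈ S₁, (ξ i - 1))⁻¹ := by
    simp only [div_eq_mul_inv, Finset.prod_mul_distrib, Finset.prod_inv_distrib]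
  have hOU : ∏ i ∈ indices S S₁ l, ∏ j ∈ indices S S₁ l with i < j, f p q (ξ i) (ξ j) =
      orderedProd (S₁ ∪ Λ ∪ S) fun i j => f p q (ξ i) (ξ j) := by
    rw [hU]; rfl
  have hV' : ∏ i ∈ S ∪ S₁, ∏ j ∈ S ∪ S₁ with i < j, (ξ j - ξ i) =
      orderedProd (S ∪ S₁) fun i j => ξ j - ξ i := rfl
  have hq1 := prod_homSum (p := p) hq.ne' (n - 1)
  have hq2 := prod_homSum (p := p) hq.ne' #S
  rw [hcoef, integrand, ← hΛ]
  rw [hOU, hexp, hF1, hV', hV, div_eq_mul_inv _ (∏ j ∈ S ∪ S₁, (1 - ξ j)), hZ,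
    pairProd_signedF ξ l.injective, blockTerm, himg, hG, hG1, hq1, hq2]
  have e1 : ∏ i ∈ S₁, ∏ b, signedF p q ξ i (l b) =
      (-1) ^ σ S₁ Λ * ∏ i ∈ S₁, ∏ j ∈ Λ, f p q (ξ i) (ξ j) := by
    rw [← prod_signedF ξ hS₁Λ]
    exact Finset.prod_congr rfl fun i _ => hprod fun j => signedF p q ξ i j
  have e2 : ∏ b, ∏ j ∈ S, signedF p q ξ (l b) j =
      (-1) ^ σ Λ S * ∏ i ∈ Λ, ∏ j ∈ S, f p q (ξ i) (ξ j) := by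
    rw [← prod_signedF ξ hSΛ.symm]
    exact hprod fun i => ∏ j ∈ S, signedF p q ξ i j
  rw [e1, e2, prod_signedF ξ hS.symm, hprod fun i => ξ i ^ (-Y.1 i)]
  rw [← tauFactorial, ← tauFactorial]
  have hT : ∀ u Q₁ Q₂ G : ℂ, -u / (tauFactorial (p / q) (n - 1) * tauFactorial (p / q) #S) *
      (Q₁ * tauFactorial (p / q) (n - 1) * (Q₂ * tauFactorial (p / q) #S) * G) =
      -u * Q₁ * Q₂ * G := by
    intro u Q₁ Q₂ G
    field_simp
  rw [hT]
  clear hT hq1 hq2 hOU hV' hG hG1 hF1 hexp hZ hV hcoef hlab hprodU hprod hsum e1 e2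
  rw [← hYξ]
  clear hYξ
  generalize (∏ i ∈ indices S S₁ l, ξ i ^ (-Y.1 i - 1)) = A
  generalize ∏ i ∈ indices S S₁ l, ξ i = B
  generalize ((-1) ^ (n - 1) : ℂ) = v at hv ⊢
  generalize ((-1) ^ #S : ℂ) = u
  generalize (1 / ∏ i ∈ S₁, ∏ j ∈ S, (ξ j - ξ i)) = D' at hD ⊢
  generalize (∏ i ∈ S₁, ∏ j ∈ S, (ξ j - ξ i)) = D at hD ⊢
  generalize Complex.exp _ = E
  generalize (∏ i ∈ S, (ξ i - 1))⁻¹ = Z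
  generalize (∏ i ∈ S₁, (ξ i - 1))⁻¹ = Z₁
  generalize ((labelPow (p / q) m #S _ : ℝ) : ℂ) = L
  generalize ((-1) ^ σ S₁ Λ : ℂ) = s₁
  generalize ((-1) ^ σ S₁ S : ℂ) = s₂
  generalize ((-1) ^ σ Λ S : ℂ) = s₃
  generalize (sgn l : ℂ) = g
  generalize (q ^ ((n - 1) * (n - 1 - 1) / 2) : ℂ) = q₁
  generalize (q ^ (#S * (#S - 1) / 2) : ℂ) = q₂
  generalize (orderedProd S fun i j => ξ j - ξ i) = V
  generalize (orderedProd S₁ fun i j => ξ j - ξ i) = V₁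
  generalize (orderedProd (S₁ ∪ Λ ∪ S) fun i j => f p q (ξ i) (ξ j)) = O
  generalize ∏ i ∈ S₁, ∏ j ∈ S, f p q (ξ i) (ξ j) = F₁
  generalize ∏ i ∈ S₁, ∏ j ∈ Λ, f p q (ξ i) (ξ j) = F₂
  generalize ∏ i ∈ Λ, ∏ j ∈ S, f p q (ξ i) (ξ j) = F₃
  generalize ∏ a, ∏ b with a < b, f p q (ξ (l a)) (ξ (l b)) = F₄
  generalize ∏ i ∈ S, ξ i = X
  generalize ∏ i ∈ S₁, ξ i ^ x n = P₁
  generalize ∏ a, ξ (l a) ^ x (n + a) = P₂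
  generalize ∏ i ∈ S, ξ i ^ x m = P₃
  have key : ∀ K : ℂ, K * (v * v) * (D * D') = K := fun K => by rw [hv, hD]; ring
  rw [← key (-u * q₁ * q₂ * _)]
  ring

/-- In `contourIntegral` the variables outside `U` are set to zero; since the integrand does not see
them, their true values may be restored. -/
theorem integrand_congr {p q : ℝ} (Y : Config N) (n m : ℕ) (x : ℕ → ℤ) (t : ℝ)
    (S S₁ : Finset (Fin N)) (l : Fin (m - n) ↪ Fin N) {ξ' ξ : Fin N → ℂ}
    (h : ∀ i ∈ indices S S₁ l, ξ' i = ξ i) :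
    integrand p q Y n m x t S S₁ l ξ' = integrand p q Y n m x t S S₁ l ξ := by
  have h1 : ∀ i ∈ S, ξ' i = ξ i := fun i hi => h i (by simp [indices, hi])
  have h2 : ∀ i ∈ S₁, ξ' i = ξ i := fun i hi => h i (by simp [indices, hi])
  have h3 : ∀ i ∈ univ.map l, ξ' i = ξ i := fun i hi =>
    h i (by simp only [indices, Finset.mem_union]; exact Or.inr hi)
  have h3' : ∀ a, ξ' (l a) = ξ (l a) := fun a => h3 _ (by simp)
  have h5 : ∀ i ∈ S ∪ S₁, ξ' i = ξ i := fun i hi =>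
    (Finset.mem_union.1 hi).elim (h1 i) (h2 i)
  have h6 : ∀ i ∈ S ∪ univ.map l, ξ' i = ξ i := fun i hi =>
    (Finset.mem_union.1 hi).elim (h1 i) (h3 i)
  have hpair : ∀ (A : Finset (Fin N)) (B : Fin N → Finset (Fin N)) (g : ℂ → ℂ → ℂ),
      (∀ i ∈ A, ξ' i = ξ i) → (∀ i ∈ A, ∀ j ∈ B i, ξ' j = ξ j) →
      ∏ i ∈ A, ∏ j ∈ B i, g (ξ' i) (ξ' j) = ∏ i ∈ A, ∏ j ∈ B i, g (ξ i) (ξ j) :=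
    fun A B g hA hB => Finset.prod_congr rfl fun i hi => Finset.prod_congr rfl fun j hj => by
      rw [hA i hi, hB i hi j hj]
  have hone : ∀ (A : Finset (Fin N)) (g : Fin N → ℂ → ℂ), (∀ i ∈ A, ξ' i = ξ i) →
      ∏ i ∈ A, g i (ξ' i) = ∏ i ∈ A, g i (ξ i) := fun A g hA =>
    Finset.prod_congr rfl fun i hi => by rw [hA i hi]
  have hsum : ∑ i ∈ indices S S₁ l, ε p q (ξ' i) * t = ∑ i ∈ indices S S₁ l, ε p q (ξ i) * t :=
    Finset.sum_congr rfl fun i hi => by rw [h i hi]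
  rw [integrand, integrand]
  simp only [h3']
  rw [hpair S₁ (fun _ => S ∪ univ.map l) (f p q) h2 fun _ _ => h6,
    hpair (univ.map l) (fun _ => S) (f p q) h3 fun _ _ => h1,
    hpair (indices S S₁ l) (fun i => (indices S S₁ l).filter fun j => i < j) (f p q) h
      fun _ _ j hj => h j (Finset.mem_filter.1 hj).1,
    hone S (fun _ z => z) h1,
    hpair (S ∪ S₁) (fun i => (S ∪ S₁).filter fun j => i < j) (fun z w => w - z) h5
      fun _ _ j hj => h5 j (Finset.mem_filter.1 hj).1,
    hone (S ∪ S₁) (fun _ z => 1 - z) h5,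
    hpair S₁ (fun _ => S) (fun z w => w - z) h2 fun _ _ => h1,
    hone S₁ (fun _ z => z ^ x n) h2, hone S (fun _ z => z ^ x m) h1,
    hone (indices S S₁ l) (fun i z => z ^ (-Y.1 i - 1)) h, hsum]

theorem measurable_integrand {p q : ℝ} (Y : Config N) (n m : ℕ) (x : ℕ → ℤ) (t : ℝ)
    (S S₁ : Finset (Fin N)) (l : Fin (m - n) ↪ Fin N) :
    Measurable (integrand p q Y n m x t S S₁ l) := by
  unfold integrand f ε
  fun_prop

/-- The contribution of the sets `S₁`, `S` and the tuple `l`. -/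
def blockIntegrand (p q : ℝ) (Y : Fin N → ℤ) (n m : ℕ) (x : ℕ → ℤ) (t : ℝ) (S₁ : Finset (Fin N))
    (l : Fin (m - n) → Fin N) (S : Finset (Fin N)) (ξ : Fin N → ℂ) : ℂ :=
  (orderedProd S fun i j => ξ j - ξ i) * (orderedProd S₁ fun i j => ξ j - ξ i) *
    (pairProd fun a b => signedF p q ξ (l a) (l b)) *
    (∏ i ∈ S₁, ∏ b, signedF p q ξ i (l b)) * (∏ i ∈ S₁, ∏ j ∈ S, signedF p q ξ i j) *
    (∏ b, ∏ j ∈ S, signedF p q ξ (l b) j) * blockTerm p q Y n m x t S₁ l S ξ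

/-- `signedF` vanishes on the diagonal, so any repeated label kills the term. The sums over disjoint
sets and injective tuples may thus be extended to all sets and tuples. -/
theorem blockIntegrand_eq_zero {p q : ℝ} (Y : Fin N → ℤ) (n m : ℕ) (x : ℕ → ℤ) (t : ℝ)
    {S₁ : Finset (Fin N)} {l : Fin (m - n) → Fin N} {S : Finset (Fin N)}
    (h : ¬ (Function.Injective l ∧ Disjoint S S₁ ∧ Disjoint (S ∪ S₁) (univ.image l)))
    (ξ : Fin N → ℂ) : blockIntegrand p q Y n m x t S₁ l S ξ = 0 := by
  have hs : ∀ i, signedF p q ξ i i = 0 := fun i => by simp [signedF]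
  rw [blockIntegrand]
  by_cases hl : Function.Injective l
  swap
  · rw [pairProd_comp_eq_zero hs hl]; ring
  by_cases hS : Disjoint S S₁
  swap
  · obtain ⟨i, hi, hi'⟩ := Finset.not_disjoint_iff.1 hS
    rw [Finset.prod_eq_zero (f := fun i => ∏ j ∈ S, signedF p q ξ i j) hi'
      (Finset.prod_eq_zero hi (hs i))]
    ring
  obtain ⟨i, hi, hi'⟩ := Finset.not_disjoint_iff.1 fun h' => h ⟨hl, hS, h'⟩
  obtain ⟨b, -, rfl⟩ := Finset.mem_image.1 hi'
  rcases Finset.mem_union.1 hi with hi | hi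
  · rw [Finset.prod_eq_zero (f := fun b => ∏ j ∈ S, signedF p q ξ (l b) j) (mem_univ b)
      (Finset.prod_eq_zero hi (hs _))]
    ring
  · rw [Finset.prod_eq_zero (f := fun i => ∏ b, signedF p q ξ i (l b)) hi
      (Finset.prod_eq_zero (mem_univ b) (hs _))]
    ring

theorem continuous_signedF (p q : ℝ) (i j : Fin N) :
    Continuous fun ξ : Fin N → ℂ => signedF p q ξ i j := by
  unfold signedF f
  split_ifs <;> fun_prop

theorem continuousOn_zpow_div {R : ℝ} (hR : 1 < R) {ι : Type*} (i : ι) (k : ℤ) :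
    ContinuousOn (fun ξ : ι → ℂ => ξ i ^ k / (ξ i - 1)) (torus ι R) :=
  (continuousOn_coord_zpow hR i k).div (by fun_prop)
    fun _ hξ => sub_ne_zero.2 (ne_one_of_mem_torus hR hξ i)

theorem continuousOn_ε {R : ℝ} (hR : 1 < R) (p q : ℝ) {ι : Type*} (i : ι) :
    ContinuousOn (fun ξ : ι → ℂ => ε p q (ξ i)) (torus ι R) := by
  unfold ε
  have : ContinuousOn (fun ξ : ι → ℂ => (ξ i)⁻¹) (torus ι R) :=
    ContinuousOn.inv₀ (by fun_prop) fun _ hξ => ne_zero_of_mem_torus hR hξ i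
  fun_prop

theorem continuousOn_blockIntegrand {p q R : ℝ} (hR : IsLargeRadius p q R) (Y : Fin N → ℤ)
    (n m : ℕ) (x : ℕ → ℤ) (t : ℝ) (S₁ : Finset (Fin N)) (l : Fin (m - n) → Fin N)
    (S : Finset (Fin N)) :
    ContinuousOn (blockIntegrand p q Y n m x t S₁ l S) (torus (Fin N) R) := by
  have hs := fun i j => (continuous_signedF (N := N) p q i j).continuousOn (s := torus (Fin N) R)
  have h1 : ∀ A : Finset (Fin N), ContinuousOn
      (fun ξ : Fin N → ℂ => orderedProd A fun i j => ξ j - ξ i) (torus (Fin N) R) := fun A => by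
    unfold orderedProd; fun_prop
  have h2 : ContinuousOn (fun ξ : Fin N → ℂ =>
      (orderedProd (S₁ ∪ univ.image l ∪ S) fun i j => f p q (ξ i) (ξ j))⁻¹) (torus (Fin N) R) := by
    refine ContinuousOn.inv₀ ?_ fun ξ hξ => Finset.prod_ne_zero_iff.2 fun i _ =>
      Finset.prod_ne_zero_iff.2 fun j _ => f_ne_zero_of_mem_torus hR hξ i j
    unfold orderedProd f; fun_prop
  have h3 := fun i k => continuousOn_coord_zpow hR.1 (ι := Fin N) i k
  have h4 := fun i k => continuousOn_zpow_div hR.1 (ι := Fin N) i k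
  have h5 := fun i => continuousOn_ε hR.1 p q (ι := Fin N) i
  have h6 : ContinuousOn (fun ξ : Fin N → ℂ => pairProd fun a b => signedF p q ξ (l a) (l b))
      (torus (Fin N) R) := continuousOn_finsetProd _ fun _ _ => hs _ _
  unfold blockIntegrand blockTerm
  refine ((((((h1 S).mul (h1 S₁)).mul h6).mul ?_).mul ?_).mul ?_).mul
    (((continuousOn_const.mul h2).mul (((?_ : ContinuousOn _ _).mul ?_).mul ?_)).mul ?_)
  · exact continuousOn_finsetProd _ fun i _ => continuousOn_finsetProd _ fun _ _ => hs _ _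
  · exact continuousOn_finsetProd _ fun i _ => continuousOn_finsetProd _ fun _ _ => hs _ _
  · exact continuousOn_finsetProd _ fun i _ => continuousOn_finsetProd _ fun _ _ => hs _ _
  · exact (continuousOn_finsetProd _ fun i _ => h4 _ _).mul
      (continuousOn_finsetProd _ fun i _ => h3 _ _)
  · exact (continuousOn_finsetProd _ fun i _ => h4 _ _).sub
      (continuousOn_finsetProd _ fun i _ => h4 _ _)
  · exact (((((continuousOn_finsetSum _ fun i _ => h5 i).add
      (continuousOn_finsetSum _ fun i _ => h5 _)).add
      (continuousOn_finsetSum _ fun i _ => h5 _)).mul continuousOn_const)).cexp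
  · exact ((continuousOn_finsetProd _ fun i _ => h3 _ _).mul
      (continuousOn_finsetProd _ fun i _ => h3 _ _)).mul
      (continuousOn_finsetProd _ fun i _ => h3 _ _)

theorem continuousOn_slotDensity {R : ℝ} (hR : 1 < R) (c d k : ℕ) (x₀ : ℤ) (x : Fin d → ℤ)
    (z : ℤ) : ContinuousOn (slotDensity c d k x₀ x z) (torus (Fin (c + d + k)) R) :=
  continuousOn_slotFn hR _ _

/-- The difference of the densities for two adjacent bounds, evolved up to the time `t`. -/
def evolvedDensity (p q : ℝ) (n m k : ℕ) (x : ℕ → ℤ) (t : ℝ)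
    (ζ : Fin (n - 1 + (m - n) + k) → ℂ) : ℂ :=
  (slotDensity (n - 1) (m - n) k (x n - 1) (fun a => x (n + a)) (x m) ζ -
    slotDensity (n - 1) (m - n) k (x n - 1) (fun a => x (n + a)) (x m - 1) ζ) *
      Complex.exp ((∑ a, ε p q (ζ a)) * t)

theorem continuousOn_evolvedDensity {R : ℝ} (hR : 1 < R) (p q : ℝ) (n m k : ℕ) (x : ℕ → ℤ)
    (t : ℝ) : ContinuousOn (evolvedDensity p q n m k x t) (torus _ R) :=
  ((continuousOn_slotDensity hR _ _ _ _ _ _).sub (continuousOn_slotDensity hR _ _ _ _ _ _)).mul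
    ((continuousOn_finsetSum _ fun _ _ => continuousOn_ε hR p q _).mul continuousOn_const).cexp

/-- Pointwise off the diagonals, the sum over tuples is grouped by the sets that occupy the first `n
- 1` and the last `k` slots; `IsArrangement.sum_blocks` evaluates the sums over the orders within
them. -/
theorem bethe_evolvedDensity {p q R : ℝ} (hpq : p + q = 1) (hR : IsLargeRadius p q R)
    (Y : Fin N → ℤ) (n m k : ℕ) (x : ℕ → ℤ) (t : ℝ) :
    bethe p q R (fun e => ((labelPow (p / q) m k (labelSum e) : ℝ) : ℂ)) Y
        (evolvedDensity p q n m k x t) =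
      (∏ i ∈ range (n - 1), homSum p q (i + 1)) * (∏ i ∈ range k, homSum p q (i + 1)) *
      ∑ S : Finset (Fin N) with #S = k, ∑ S₁ : Finset (Fin N) with #S₁ = n - 1,
        ∑ l : Fin (m - n) → Fin N,
          ∫ ξ, blockIntegrand p q Y n m x t S₁ l S ξ ∂torusMeasure (Fin N) R := by
  have hR0 : 0 ≤ R := by linarith [hR.1]
  have hint := fun S₁ l S => integrable_of_continuousOn_torus hR0
    (continuousOn_blockIntegrand hR Y n m x t S₁ l S)
  have hsum : ∑ S : Finset (Fin N) with #S = k, ∑ S₁ : Finset (Fin N) with #S₁ = n - 1,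
      ∑ l : Fin (m - n) → Fin N,
        ∫ ξ, blockIntegrand p q Y n m x t S₁ l S ξ ∂torusMeasure (Fin N) R =
      ∫ ξ, ∑ S : Finset (Fin N) with #S = k, ∑ S₁ : Finset (Fin N) with #S₁ = n - 1,
        ∑ l : Fin (m - n) → Fin N, blockIntegrand p q Y n m x t S₁ l S ξ
          ∂torusMeasure (Fin N) R := by
    rw [integral_finsetSum _ fun S _ => integrable_finsetSum _ fun S₁ _ =>
      integrable_finsetSum _ fun l _ => hint S₁ l S]
    refine Finset.sum_congr rfl fun S _ => ?_
    rw [integral_finsetSum _ fun S₁ _ => integrable_finsetSum _ fun l _ => hint S₁ l S]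
    refine Finset.sum_congr rfl fun S₁ _ => ?_
    rw [integral_finsetSum _ fun l _ => hint S₁ l S]
  rw [hsum, ← integral_const_mul, bethe]
  simp_rw [← integral_const_mul]
  rw [← integral_finsetSum _ fun e _ => (integrable_wave hR e Y
    (continuousOn_evolvedDensity hR.1 p q n m k x t)).const_mul _]
  refine integral_congr_ae ?_
  filter_upwards [ae_mem_torus hR0, ae_injective_torusMeasure (by linarith [hR.1] : R ≠ 0)]
    with ξ hξ hinj
  have harr := isArrangement_signedF hpq hinj (ne_one_of_mem_torus hR.1 hξ)
  simp only [blockIntegrand]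
  rw [← harr.sum_blocks (c := n - 1) (d := m - n) (k := k) (fun e =>
    ((labelPow (p / q) m k (labelSum e) : ℝ) : ℂ) *
      (orderedProd (univ.image e) fun i j => f p q (ξ i) (ξ j))⁻¹ *
      evolvedDensity p q n m k x t (ξ ∘ e) * (∏ a, ξ (e a) ^ (-Y (e a))))
    (fun S₁ l S => blockTerm p q Y n m x t S₁ l S ξ)
    fun e₁ l e₂ he₁ he₂ => blockTerm_eq Y n m x t l he₁ he₂ ξ rfl]
  refine Finset.sum_congr rfl fun e _ => ?_
  rw [wave, amp_eq_mul_inv (f_ne_zero_of_mem_torus hR hξ)]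
  ring

theorem coefficient_mul_contourIntegral {p q R : ℝ} (hp : 0 ≤ p) (hq : 0 < q)
    (hR : IsLargeRadius p q R) (Y : Config N) {n m : ℕ} (x : ℕ → ℤ) (t : ℝ)
    {S S₁ : Finset (Fin N)} (l : Fin (m - n) ↪ Fin N) (hS : Disjoint S S₁) (hS₁ : #S₁ = n - 1)
    (hl : Disjoint (S ∪ S₁) (univ.map l)) :
    (coefficient p q n m S S₁ l : ℂ) * contourIntegral (indices S S₁ l) R
        (integrand p q Y n m x t S S₁ l) =
    -(-1) ^ #S / (tauFactorial (p / q) (n - 1) * tauFactorial (p / q) #S) *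
      ((∏ i ∈ range (n - 1), homSum p q (i + 1)) * (∏ i ∈ range #S, homSum p q (i + 1)) *
      ∫ ξ, blockIntegrand p q Y.1 n m x t S₁ l S ξ ∂torusMeasure (Fin N) R) := by
  rw [contourIntegral_eq _ (measurable_integrand Y n m x t S S₁ l), ← integral_const_mul,
    ← integral_const_mul, ← integral_const_mul]
  refine integral_congr_ae ?_
  filter_upwards [ae_mem_torus (by linarith [hR.1] : 0 ≤ R),
    ae_injective_torusMeasure (by linarith [hR.1] : R ≠ 0)] with ξ hξ hinj
  rw [integrand_congr Y n m x t S S₁ l (ξ := ξ) fun i hi => if_pos hi,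
    coefficient_mul_integrand hp hq Y x t l hS hS₁ hl hinj (ne_zero_of_mem_torus hR.1 hξ)]
  rfl

/-- The right-hand side of the integral formula in terms of plane wave superpositions. -/
theorem sum_coefficient_mul_contourIntegral {p q R : ℝ} (hp : 0 ≤ p) (hq : 0 < q)
    (hpq : p + q = 1) (hR : IsLargeRadius p q R) (Y : Config N) (n m : ℕ) (x : ℕ → ℤ) (t : ℝ) :
    ∑ S : Finset (Fin N), ∑ S₁ : Finset (Fin N) with Disjoint S S₁ ∧ #S₁ = n - 1,
        ∑ l : Fin (m - n) ↪ Fin N with Disjoint (S ∪ S₁) (univ.map l),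
          (coefficient p q n m S S₁ l : ℂ) *
            contourIntegral (indices S S₁ l) R (integrand p q Y n m x t S S₁ l) =
      ∑ k ∈ range (N + 1), -(-1) ^ k /
        (tauFactorial (p / q) (n - 1) * tauFactorial (p / q) k) *
        bethe p q R (fun e => ((labelPow (p / q) m k (labelSum e) : ℝ) : ℂ)) Y.1
          (evolvedDensity p q n m k x t) := by
  rw [← Finset.sum_fiberwise_of_maps_to (g := fun S : Finset (Fin N) => #S) (t := range (N + 1))
    fun S _ => by
      simpa [Nat.lt_succ_iff] using Finset.card_le_univ S]
  refine Finset.sum_congr rfl fun k _ => ?_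
  rw [bethe_evolvedDensity hpq hR, ← mul_assoc, Finset.mul_sum]
  refine Finset.sum_congr rfl fun S hS => ?_
  have hS : #S = k := (Finset.mem_filter.1 hS).2
  subst hS
  rw [← Finset.filter_filter, Finset.filter_comm, Finset.mul_sum, Finset.sum_filter]
  refine Finset.sum_congr rfl fun S₁ hS₁ => ?_
  have hS₁ : #S₁ = n - 1 := (Finset.mem_filter.1 hS₁).2
  split_ifs with hdis
  · rw [Finset.mul_sum]
    refine Finset.sum_of_injOn (fun l : Fin (m - n) ↪ Fin N => (l : Fin (m - n) → Fin N))
      (fun _ _ _ _ h => DFunLike.coe_injective h) (fun _ _ => by simp) (fun l _ hl => ?_)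
      fun l hl => ?_
    · rw [funext (blockIntegrand_eq_zero Y.1 n m x t (S₁ := S₁) (l := l) (S := S)
        fun h => hl ⟨⟨l, h.1⟩, ?_, rfl⟩)]
      · simp
      · simpa [Finset.map_eq_image] using h.2.2
    · rw [coefficient_mul_contourIntegral hp hq hR Y x t l hdis hS₁ (Finset.mem_filter.1 hl).2]
      ring
  · rw [Finset.sum_eq_zero, mul_zero]
    intro l _
    rw [funext (blockIntegrand_eq_zero Y.1 n m x t fun h => hdis h.2.1)]
    simp

/-! ### The formula at time zero -/

theorem prod_invWeight_left (τ : ℂ) {U : Finset (Fin N)} {c : Fin N} (hc : c ∉ U) :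
    ∏ u ∈ U, invWeight τ u c = τ ^ #{u ∈ U | c < u} := by
  rw [← Finset.prod_const, Finset.prod_filter]
  refine Finset.prod_congr rfl fun u hu => ?_
  have hne : u ≠ c := fun h => hc (h ▸ hu)
  rw [invWeight, if_neg hne]
  rcases lt_or_gt_of_ne hne with h | h
  · simp [h, h.not_gt]
  · simp [h, h.not_gt]

/-- The number of the labels below `c` outside of `U`. -/
def gapCount (U : Finset (Fin N)) (c : Fin N) : ℕ := #{i | i ∉ U ∧ i < c}

theorem card_gt_add {U : Finset (Fin N)} {c : Fin N} (hc : c ∉ U) :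
    (c : ℕ) + #{u ∈ U | c < u} = #U + gapCount U c := by
  have h1 : #U = #{u ∈ U | u < c} + #{u ∈ U | c < u} := by
    rw [← Finset.card_filter_add_card_filter_not (s := U) fun u => u < c]
    congr 2
    refine Finset.filter_congr fun u hu => ?_
    have hne : u ≠ c := fun h => hc (h ▸ hu)
    rw [not_lt, le_iff_lt_or_eq]
    simp [hne.symm]
  have h2 : (c : ℕ) = #{u ∈ U | u < c} + gapCount U c := by
    rw [gapCount, ← Fin.card_Iio, ← Finset.card_filter_add_card_filter_not (s := Iio c)
      fun u => u ∈ U]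
    congr 2
    · ext u; simp [and_comm]
    · ext u; simp [and_comm]
  omega

/-- For `c ∉ U`, its label `c + 1` plus the number of inversions with `U` equals `m` plus the number
of labels below `c` missing from `U`. The power `m * #S` in the weight is designed to leave only the
latter. -/
theorem labelPow_mul_prod_invWeight {τ : ℝ} {m : ℕ} {U S : Finset (Fin N)} (hU : #U + 1 = m)
    (hS : Disjoint U S) :
    (∏ u ∈ U, ∏ c ∈ S, invWeight (τ : ℂ) u c) *
        (labelPow τ m #S (∑ i ∈ U, ((i : ℤ) + 1) + ∑ i ∈ S, ((i : ℤ) + 1)) : ℝ) =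
      (labelPow τ m 0 (∑ i ∈ U, ((i : ℤ) + 1)) : ℝ) * ∏ c ∈ S, (τ : ℂ) ^ gapCount U c := by
  have hA := le_sum_label (m := m) (k := #S) (U := U ∪ S) (by
    rw [Finset.card_union_of_disjoint hS]; omega)
  have hC := le_sum_label (m := m) (k := 0) (U := U) (by omega)
  rw [Finset.sum_union hS] at hA
  obtain ⟨a, ha⟩ := Int.eq_ofNat_of_zero_le hA
  obtain ⟨b, hb⟩ := Int.eq_ofNat_of_zero_le hC
  have h1 : ∏ u ∈ U, ∏ c ∈ S, invWeight (τ : ℂ) u c = (τ : ℂ) ^ ∑ c ∈ S, #{u ∈ U | c < u} := by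
    rw [Finset.prod_comm, ← Finset.prod_pow_eq_pow_sum]
    exact Finset.prod_congr rfl fun c hc =>
      prod_invWeight_left _ fun h => Finset.disjoint_left.1 hS h hc
  have h2 : a + ∑ c ∈ S, #{u ∈ U | c < u} = b + ∑ c ∈ S, gapCount U c := by
    have h3 : ∑ c ∈ S, ((c : ℕ) + #{u ∈ U | c < u}) = ∑ c ∈ S, (#U + gapCount U c) :=
      Finset.sum_congr rfl fun c hc => card_gt_add fun h => Finset.disjoint_left.1 hS h hc
    rw [Finset.sum_add_distrib, Finset.sum_add_distrib, Finset.sum_const, smul_eq_mul] at h3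
    have h4 : ∑ i ∈ S, ((i : ℤ) + 1) = ((∑ i ∈ S, (i : ℕ) : ℕ) : ℤ) + #S := by
      rw [Finset.sum_add_distrib]; simp
    rw [h4] at ha
    zify at h3 ⊢
    have h5 : (#U : ℤ) + 1 = m := by exact_mod_cast hU
    push_cast at ha hb h3
    rw [← h5] at ha hb
    linear_combination h3 - ha + hb
  rw [h1, labelPow, labelPow, ha, hb, Finset.prod_pow_eq_pow_sum]
  push_cast
  rw [zpow_natCast, zpow_natCast, ← pow_add, ← pow_add, ← h2, add_comm]

/-- The alternating sum over the set `S`: inclusion and exclusion. -/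
theorem sum_alternating {τ : ℝ} {m : ℕ} {U : Finset (Fin N)} (hU : #U + 1 = m)
    {Y : Fin N → ℤ} (hY : StrictMono Y) (z : ℤ) :
    ∑ S : Finset (Fin N), (-1) ^ #S * ((∏ u ∈ U, ∏ c ∈ S, invWeight (τ : ℂ) u c) *
        (labelPow τ m #S (∑ i ∈ U, ((i : ℤ) + 1) + ∑ i ∈ S, ((i : ℤ) + 1)) : ℝ) *
        ∏ c ∈ S, if Y c ≤ z then 1 else 0) =
      (labelPow τ m 0 (∑ i ∈ U, ((i : ℤ) + 1)) : ℝ) *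
        if ∀ c, Y c ≤ z → c ∈ U then 1 else 0 := by
  set T : Finset (Fin N) := univ.filter fun c => c ∉ U ∧ Y c ≤ z with hT
  have hterm : ∀ S : Finset (Fin N), (-1) ^ #S * ((∏ u ∈ U, ∏ c ∈ S, invWeight (τ : ℂ) u c) *
        (labelPow τ m #S (∑ i ∈ U, ((i : ℤ) + 1) + ∑ i ∈ S, ((i : ℤ) + 1)) : ℝ) *
        ∏ c ∈ S, if Y c ≤ z then 1 else 0) =
      if S ⊆ T then (labelPow τ m 0 (∑ i ∈ U, ((i : ℤ) + 1)) : ℝ) *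
        ∏ c ∈ S, -(τ : ℂ) ^ gapCount U c else 0 := by
    intro S
    split_ifs with hST
    · have hdis : Disjoint U S := Finset.disjoint_right.2 fun c hc =>
        (Finset.mem_filter.1 (hST hc)).2.1
      rw [labelPow_mul_prod_invWeight hU hdis, Finset.prod_eq_one (s := S)
        (f := fun c => if Y c ≤ z then (1 : ℂ) else 0), Finset.prod_neg]
      · ring
      · exact fun c hc => if_pos (Finset.mem_filter.1 (hST hc)).2.2
    · obtain ⟨c, hc, hcT⟩ := Finset.not_subset.1 hST
      by_cases hcU : c ∈ U
      · rw [Finset.prod_eq_zero (f := fun u => ∏ c ∈ S, invWeight (τ : ℂ) u c) hcU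
          (Finset.prod_eq_zero hc (by simp [invWeight]))]
        ring
      · rw [Finset.prod_eq_zero (f := fun c => if Y c ≤ z then (1 : ℂ) else 0) hc
          (if_neg fun h => hcT (by simp [hT, hcU, h]))]
        ring
  rw [Finset.sum_congr rfl fun S _ => hterm S, ← Finset.sum_filter,
    show (univ.filter fun S => S ⊆ T) = T.powerset by ext; simp, ← Finset.mul_sum,
    ← Finset.prod_one_add]
  congr 1
  split_ifs with h
  · have : T = ∅ := by
      rw [hT, Finset.filter_eq_empty_iff]
      exact fun c _ hc => hc.1 (h c hc.2)
    rw [this, Finset.prod_empty]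
  · push Not at h
    obtain ⟨c, hc, hcU⟩ := h
    have hne : T.Nonempty := ⟨c, by simp [hT, hc, hcU]⟩
    have hmin := T.min'_mem hne
    -- For the least element of `T`, every smaller label lies in `U`, because its particle also lies
    -- weakly left of `z`. Hence `gapCount` is zero there and the factor is `1 - τ ^ 0 = 0`, even
    -- for `τ = 0`.
    refine Finset.prod_eq_zero hmin ?_
    have : gapCount U (T.min' hne) = 0 := by
      rw [gapCount, Finset.card_eq_zero, Finset.filter_eq_empty_iff]
      rintro i - ⟨hi, hlt⟩
      refine (T.min'_le i ?_).not_gt hlt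
      have := hY hlt
      have h2 := (Finset.mem_filter.1 hmin).2.2
      simp only [hT, mem_filter, mem_univ, true_and]
      exact ⟨hi, by omega⟩
    rw [this]
    simp

/-- The bound `x m - 1` is still at least `x (m - 1)`, and a half-line need not lie strictly above
the preceding point. Likewise `x n - 1` is strictly below the first point. -/
theorem isSlotOrdered_slotBound {n m k : ℕ} (hnm : n ≤ m) {x : ℕ → ℤ}
    (hx : StrictMonoOn x (Set.Icc n m)) {z : ℤ} (hz : x m - 1 ≤ z) :
    IsSlotOrdered (slotSet (n - 1) (m - n) k)
      (slotBound (n - 1) (m - n) k (x n - 1) (fun a => x (n + a)) z) := by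
  have hmono : ∀ a b, n ≤ a → a < b → b ≤ m → x a < x b := fun a b ha hab hb =>
    hx ⟨ha, by omega⟩ ⟨by omega, hb⟩ hab
  have hnm' : x n ≤ x m := hx.monotoneOn ⟨le_rfl, hnm⟩ ⟨hnm, le_rfl⟩ hnm
  have hA : ∀ i : Fin (n - 1), slotBound (n - 1) (m - n) k (x n - 1) (fun a => x (n + a)) z
      (Fin.castAdd k (Fin.castAdd (m - n) i)) = x n - 1 := fun i => by
    simp only [slotBound, Fin.append_left]
  have hB : ∀ i : Fin (m - n), slotBound (n - 1) (m - n) k (x n - 1) (fun a => x (n + a)) z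
      (Fin.castAdd k (Fin.natAdd (n - 1) i)) = x (n + i) := fun i => by
    simp only [slotBound, Fin.append_left, Fin.append_right]
  have hC : ∀ i : Fin k, slotBound (n - 1) (m - n) k (x n - 1) (fun a => x (n + a)) z
      (Fin.natAdd (n - 1 + (m - n)) i) = z := fun i => by
    simp only [slotBound, Fin.append_right]
  intro i j hij
  rw [Fin.lt_def] at hij
  induction i using Fin.addCases with
  | left i =>
    induction i using Fin.addCases with
    | left i =>
      induction j using Fin.addCases with
      | left j =>
        induction j using Fin.addCases with
        | left j => rw [hA, hA]; simp [slotSet]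
        | right j =>
          have : x n ≤ x (n + j) := hx.monotoneOn ⟨le_rfl, hnm⟩
            ⟨by omega, by have := j.2; omega⟩ (by omega)
          rw [hA, hB]
          exact ⟨by omega, fun _ => by omega⟩
      | right j =>
        rw [hA, hC]
        exact ⟨by omega, fun h => absurd (by simp [slotSet]) h⟩
    | right i =>
      induction j using Fin.addCases with
      | left j =>
        induction j using Fin.addCases with
        | left j => simp at hij; have := j.2; omega
        | right j =>
          have := hmono (n + i) (n + j) (by omega) (by simpa using hij)
            (by have := j.2; omega)
          rw [hB, hB]
          exact ⟨this.le, fun _ => this⟩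
      | right j =>
        have := hmono (n + i) m (by omega) (by have := i.2; omega) le_rfl
        rw [hB, hC]
        exact ⟨by omega, fun h => absurd (by simp [slotSet]) h⟩
  | right i =>
    induction j using Fin.addCases with
    | left j => simp at hij; have := j.2; omega
    | right j => rw [hC, hC]; simp [slotSet]

/-- The weighted number of the tuples that occupy the slots, as a sum over the blocks. -/
theorem slotSum_blocks (τ : ℝ) (Y : Fin N → ℤ) (n m k : ℕ) (x : ℕ → ℤ) (z : ℤ) :
    slotSum (τ : ℂ) (fun e => ((labelPow τ m k (labelSum e) : ℝ) : ℂ)) Y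
      (slotSet (n - 1) (m - n) k) (slotBound (n - 1) (m - n) k (x n - 1) (fun a => x (n + a)) z) =
    tauFactorial τ (n - 1) * tauFactorial τ k *
      ∑ S : Finset (Fin N) with #S = k, ∑ S₁ : Finset (Fin N) with #S₁ = n - 1,
        ∑ l : Fin (m - n) → Fin N, (pairProd fun a b => invWeight (τ : ℂ) (l a) (l b)) *
          (∏ i ∈ S₁, ∏ b, invWeight (τ : ℂ) i (l b)) * (∏ i ∈ S₁, ∏ j ∈ S, invWeight (τ : ℂ) i j) *
          (∏ b, ∏ j ∈ S, invWeight (τ : ℂ) (l b) j) *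
          ((labelPow τ m #S
            (∑ i ∈ S₁, ((i : ℤ) + 1) + ∑ a, ((l a : ℤ) + 1) + ∑ i ∈ S, ((i : ℤ) + 1)) : ℝ) *
          ((∏ i ∈ S₁, if Y i ≤ x n - 1 then 1 else 0) *
            (∏ a, if Y (l a) = x (n + a) then 1 else 0) * ∏ i ∈ S, if Y i ≤ z then 1 else 0)) := by
  have h := (isArrangement_invWeight (N := N) (τ : ℂ)).sum_blocks (c := n - 1) (d := m - n) (k := k)
    (fun e => ((labelPow τ m k (labelSum e) : ℝ) : ℂ) *
      ∏ a, slotInd (slotSet (n - 1) (m - n) k)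
        (slotBound (n - 1) (m - n) k (x n - 1) (fun a => x (n + a)) z) a (Y (e a)))
    (fun S₁ l S => ((labelPow τ m #S
        (∑ i ∈ S₁, ((i : ℤ) + 1) + ∑ a, ((l a : ℤ) + 1) + ∑ i ∈ S, ((i : ℤ) + 1)) : ℝ) *
      ((∏ i ∈ S₁, if Y i ≤ x n - 1 then 1 else 0) *
        (∏ a, if Y (l a) = x (n + a) then 1 else 0) * ∏ i ∈ S, if Y i ≤ z then 1 else 0) : ℂ))
    (fun e₁ l e₂ he₁ he₂ => by
      have hk : #(univ.image e₂) = k := by rw [Finset.card_image_of_injective _ he₂]; simp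
      rw [prod_slotInd_append]
      simp only [hk, labelSum, Fin.sum_univ_add, Fin.append_left, Fin.append_right,
        Finset.prod_image he₁.injOn, Finset.prod_image he₂.injOn,
        Finset.sum_image he₁.injOn, Finset.sum_image he₂.injOn])
  rw [slotSum, tauFactorial, tauFactorial]
  simp only [one_mul] at h
  rw [← h]
  exact Finset.sum_congr rfl fun e _ => by ring

/-- The conditions on the first two blocks. -/
theorem invWeight_blocks_eq_one (τ : ℂ) {Y : Fin N → ℤ} (hY : StrictMono Y) {n m : ℕ}
    {x : ℕ → ℤ} (hx : StrictMonoOn x (Set.Icc n m)) {S₁ : Finset (Fin N)}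
    {l : Fin (m - n) → Fin N} (h₁ : ∀ i ∈ S₁, Y i ≤ x n - 1) (hl : ∀ a, Y (l a) = x (n + a)) :
    StrictMono l ∧ Disjoint S₁ (univ.image l) ∧
      (pairProd fun a b => invWeight τ (l a) (l b)) = 1 ∧
      ∏ i ∈ S₁, ∏ b, invWeight τ i (l b) = 1 := by
  have hmono : StrictMono l := fun a b hab => hY.lt_iff_lt.1 (by
    rw [hl, hl]
    refine hx ⟨by omega, by have := a.2; omega⟩ ⟨by omega, by have := b.2; omega⟩ ?_
    rw [Fin.lt_def] at hab; omega)
  have hlt : ∀ i ∈ S₁, ∀ b, i < l b := fun i hi b => hY.lt_iff_lt.1 (by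
    have h2 : x n ≤ x (n + b) := hx.monotoneOn ⟨le_rfl, by have := b.2; omega⟩
      ⟨by omega, by have := b.2; omega⟩ (by omega)
    have := h₁ i hi
    rw [hl]; omega)
  refine ⟨hmono, Finset.disjoint_left.2 fun i hi hi' => ?_, ?_, ?_⟩
  · obtain ⟨b, -, rfl⟩ := Finset.mem_image.1 hi'
    exact (hlt _ hi b).false
  · refine Finset.prod_eq_one fun y hy => ?_
    have := hmono (Finset.mem_filter.1 hy).2
    simp [invWeight, this, this.ne]
  · refine Finset.prod_eq_one fun i hi => Finset.prod_eq_one fun b _ => ?_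
    simp [invWeight, hlt i hi b, (hlt i hi b).ne]

/-- The `τ`-factorials from the arrangements of `S₁` and `S` cancel the denominators. The occupation
conditions make the pair weights of `S₁` and `l` trivial, and inclusion and exclusion over `S` does
the rest. -/
theorem sum_slotSum (τ : ℝ) (hτ : ∀ k, tauFactorial (τ : ℂ) k ≠ 0) {Y : Fin N → ℤ}
    (hY : StrictMono Y) {n m : ℕ} (hn : 1 ≤ n) (hnm : n ≤ m)
    {x : ℕ → ℤ} (hx : StrictMonoOn x (Set.Icc n m)) (z : ℤ) :
    ∑ k ∈ range (N + 1), -(-1) ^ k / (tauFactorial (τ : ℂ) (n - 1) * tauFactorial (τ : ℂ) k) *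
      slotSum (τ : ℂ) (fun e => ((labelPow τ m k (labelSum e) : ℝ) : ℂ)) Y
        (slotSet (n - 1) (m - n) k)
        (slotBound (n - 1) (m - n) k (x n - 1) (fun a => x (n + a)) z) =
    ∑ S₁ : Finset (Fin N) with #S₁ = n - 1, ∑ l : Fin (m - n) → Fin N,
      if (∀ i ∈ S₁, Y i ≤ x n - 1) ∧ ∀ a, Y (l a) = x (n + a) then
        (labelPow τ m 0 (∑ i ∈ S₁ ∪ univ.image l, ((i : ℤ) + 1)) : ℝ) *
          -(if ∀ c, Y c ≤ z → c ∈ S₁ ∪ univ.image l then (1 : ℂ) else 0) else 0 := by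
  have h1 : ∀ k, -(-1) ^ k / (tauFactorial (τ : ℂ) (n - 1) * tauFactorial (τ : ℂ) k) *
      slotSum (τ : ℂ) (fun e => ((labelPow τ m k (labelSum e) : ℝ) : ℂ)) Y
        (slotSet (n - 1) (m - n) k)
        (slotBound (n - 1) (m - n) k (x n - 1) (fun a => x (n + a)) z) =
      ∑ S : Finset (Fin N) with #S = k, ∑ S₁ : Finset (Fin N) with #S₁ = n - 1,
        ∑ l : Fin (m - n) → Fin N, -(-1) ^ #S *
          ((pairProd fun a b => invWeight (τ : ℂ) (l a) (l b)) *
          (∏ i ∈ S₁, ∏ b, invWeight (τ : ℂ) i (l b)) * (∏ i ∈ S₁, ∏ j ∈ S, invWeight (τ : ℂ) i j) *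
          (∏ b, ∏ j ∈ S, invWeight (τ : ℂ) (l b) j) *
          ((labelPow τ m #S
            (∑ i ∈ S₁, ((i : ℤ) + 1) + ∑ a, ((l a : ℤ) + 1) + ∑ i ∈ S, ((i : ℤ) + 1)) : ℝ) *
          ((∏ i ∈ S₁, if Y i ≤ x n - 1 then 1 else 0) *
            (∏ a, if Y (l a) = x (n + a) then 1 else 0) *
            ∏ i ∈ S, if Y i ≤ z then 1 else 0))) := by
    intro k
    have h2 := hτ (n - 1)
    have h3 := hτ k
    have h4 : ∀ B : ℂ, -(-1) ^ k / (tauFactorial (τ : ℂ) (n - 1) * tauFactorial (τ : ℂ) k) *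
        (tauFactorial (τ : ℂ) (n - 1) * tauFactorial (τ : ℂ) k * B) = -(-1) ^ k * B := fun B => by
      field_simp
    rw [slotSum_blocks, h4, Finset.mul_sum]
    refine Finset.sum_congr rfl fun S hS => ?_
    rw [(Finset.mem_filter.1 hS).2, Finset.mul_sum]
    refine Finset.sum_congr rfl fun S₁ _ => ?_
    rw [Finset.mul_sum]
  simp_rw [h1]
  rw [Finset.sum_fiberwise_of_maps_to (g := fun S : Finset (Fin N) => #S) (t := range (N + 1))
    fun S _ => by simpa [Nat.lt_succ_iff] using Finset.card_le_univ S, Finset.sum_comm]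
  refine Finset.sum_congr rfl fun S₁ hS₁ => ?_
  rw [Finset.sum_comm]
  refine Finset.sum_congr rfl fun l _ => ?_
  have hS₁ : #S₁ = n - 1 := (Finset.mem_filter.1 hS₁).2
  by_cases hc : (∀ i ∈ S₁, Y i ≤ x n - 1) ∧ ∀ a, Y (l a) = x (n + a)
  · rw [if_pos hc]
    obtain ⟨hmono, hdis, e1, e2⟩ := invWeight_blocks_eq_one (τ : ℂ) hY hx hc.1 hc.2
    have hcard : #(S₁ ∪ univ.image l) + 1 = m := by
      rw [Finset.card_union_of_disjoint hdis, hS₁, Finset.card_image_of_injective _ hmono.injective,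
        Finset.card_univ, Fintype.card_fin]
      omega
    have h2 := sum_alternating (τ := τ) hcard hY z
    rw [mul_neg, ← h2, ← Finset.sum_neg_distrib]
    refine Finset.sum_congr rfl fun S _ => ?_
    rw [e1, e2, Finset.prod_eq_one fun i hi => if_pos (hc.1 i hi),
      Finset.prod_eq_one fun a _ => if_pos (hc.2 a), Finset.prod_union hdis,
      Finset.sum_union hdis, Finset.prod_image hmono.injective.injOn,
      Finset.sum_image hmono.injective.injOn]
    ring
  · rw [if_neg hc]
    refine Finset.sum_eq_zero fun S _ => ?_
    have : (∏ i ∈ S₁, if Y i ≤ x n - 1 then (1 : ℂ) else 0) *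
        (∏ a, if Y (l a) = x (n + a) then 1 else 0) = 0 := by
      rw [Finset.prod_ite_zero, Finset.prod_ite_zero]
      simp only [Finset.prod_const_one, mem_univ, true_implies]
      by_cases h' : ∀ i ∈ S₁, Y i ≤ x n - 1
      · rw [if_neg fun h'' => hc ⟨h', h''⟩, mul_zero]
      · rw [if_neg h', zero_mul]
    rw [this]
    ring

/-- By `h₂` the set `S₁ ∪ Λ` consists of all the particles to the left of `x m`, and by `h₃` some
further particle sits at `x m`. Having `m - 1` elements, the set is the first `m - 1` labels; `S₁`
is its part to the left of `x n`. -/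
theorem eq_of_occupied {Y : Fin N → ℤ} (hY : StrictMono Y) {n m : ℕ} (hn : 1 ≤ n) (hnm : n ≤ m)
    {x : ℕ → ℤ} (hx : StrictMonoOn x (Set.Icc n m)) {S₁ : Finset (Fin N)}
    {l : Fin (m - n) → Fin N} (hS₁ : #S₁ = n - 1) (h₁ : ∀ i ∈ S₁, Y i ≤ x n - 1)
    (hl : ∀ a, Y (l a) = x (n + a)) (h₂ : ∀ c, Y c ≤ x m - 1 → c ∈ S₁ ∪ univ.image l)
    (h₃ : ¬ ∀ c, Y c ≤ x m → c ∈ S₁ ∪ univ.image l) :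
    S₁ = univ.filter (fun i : Fin N => (i : ℕ) + 1 < n) ∧ (∀ a, (l a : ℕ) = n - 1 + a) ∧
      ∀ i : Fin N, n ≤ (i : ℕ) + 1 → (i : ℕ) + 1 ≤ m → Y i = x (i + 1) := by
  obtain ⟨hmono, hdis, -, -⟩ := invWeight_blocks_eq_one 0 hY hx h₁ hl
  have hxn : ∀ b : Fin (m - n), x n ≤ x (n + b) := fun b => hx.monotoneOn
    ⟨le_rfl, hnm⟩ ⟨by omega, by have := b.2; omega⟩ (by omega)
  have hxm : ∀ b : Fin (m - n), x (n + b) < x m := fun b => hx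
    ⟨by omega, by have := b.2; omega⟩ ⟨hnm, le_rfl⟩ (by have := b.2; omega)
  have hnm' : x n ≤ x m := hx.monotoneOn ⟨le_rfl, hnm⟩ ⟨hnm, le_rfl⟩ hnm
  have hltm : ∀ c ∈ S₁ ∪ univ.image l, Y c < x m := by
    intro c hc
    rcases Finset.mem_union.1 hc with hc | hc
    · have := h₁ c hc; omega
    · obtain ⟨b, -, rfl⟩ := Finset.mem_image.1 hc
      rw [hl]; exact hxm b
  have hlower : ∀ c ∈ S₁, Iic c ⊆ S₁ := by
    intro c hc i hi
    have h4 := h₁ c hc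
    have h5 := hY.monotone (Finset.mem_Iic.1 hi)
    rcases Finset.mem_union.1 (h₂ i (by omega)) with h | h
    · exact h
    · obtain ⟨b, -, rfl⟩ := Finset.mem_image.1 h
      have := hxn b
      rw [hl] at h5
      omega
  -- A label equals the number of labels below it: those below `l a` are all of `S₁` and the earlier
  -- entries of `l`.
  have hlval : ∀ a, (l a : ℕ) = n - 1 + a := by
    intro a
    have hset : Iio (l a) = S₁ ∪ (Iio a).image l := by
      ext c
      simp only [Finset.mem_Iio, Finset.mem_union, Finset.mem_image]
      constructor
      · intro hc
        have h5 := hY hc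
        rw [hl] at h5
        have := hxm a
        rcases Finset.mem_union.1 (h₂ c (by omega)) with h | h
        · exact Or.inl h
        · obtain ⟨b, -, rfl⟩ := Finset.mem_image.1 h
          exact Or.inr ⟨b, hmono.lt_iff_lt.1 hc, rfl⟩
      · rintro (hc | ⟨b, hb, rfl⟩)
        · refine hY.lt_iff_lt.1 ?_
          have := h₁ c hc
          have := hxn a
          rw [hl]; omega
        · exact hmono hb
    have h5 := congrArg Finset.card hset
    rw [Fin.card_Iio, Finset.card_union_of_disjoint, hS₁,
      Finset.card_image_of_injective _ hmono.injective, Fin.card_Iio] at h5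
    · exact h5
    · exact hdis.mono_right (Finset.image_subset_image (Finset.subset_univ _))
  push Not at h₃
  obtain ⟨c, hc, hcU⟩ := h₃
  have hcm : Y c = x m := by
    by_contra h
    exact hcU (h₂ c (by omega))
  have hcval : (c : ℕ) + 1 = m := by
    have hset : Iio c = S₁ ∪ univ.image l := by
      ext i
      rw [Finset.mem_Iio]
      constructor
      · intro hi
        have := hY hi
        exact h₂ i (by omega)
      · intro hi
        refine hY.lt_iff_lt.1 ?_
        rw [hcm]; exact hltm i hi
    have h5 := congrArg Finset.card hset
    rw [Fin.card_Iio, Finset.card_union_of_disjoint hdis, hS₁,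
      Finset.card_image_of_injective _ hmono.injective, Finset.card_univ, Fintype.card_fin] at h5
    omega
  refine ⟨?_, hlval, fun i hi hi' => ?_⟩
  · refine Finset.eq_of_subset_of_card_le (fun i hi => ?_) ?_
    · have h5 := Finset.card_le_card (hlower i hi)
      rw [Fin.card_Iic, hS₁] at h5
      simp only [mem_filter, mem_univ, true_and]
      omega
    · rw [hS₁]
      have h6 : (univ.filter fun i : Fin N => (i : ℕ) + 1 < n) ⊆
          Iio (⟨n - 1, by omega⟩ : Fin N) := fun i hi => by
        simp only [mem_filter, mem_univ, true_and] at hi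
        rw [Finset.mem_Iio, Fin.lt_def]
        simp only
        omega
      exact (Finset.card_le_card h6).trans (by rw [Fin.card_Iio])
  · rcases eq_or_lt_of_le hi' with h | h
    · have : i = c := Fin.ext (by omega)
      rw [this, hcm, hcval]
    · have h7 : i = l ⟨(i : ℕ) + 1 - n, by omega⟩ := Fin.ext (by
        rw [hlval]; simp only; omega)
      rw [h7, hl, hlval]
      simp only
      congr 1
      omega

/-- The indicator for the bound `x m` implies the one for `x m - 1`, so a term survives only if the
second holds and the first fails. Then `eq_of_occupied` leaves a single pair `S₁`, `l`. -/
theorem sum_occupied (τ : ℝ) {Y : Fin N → ℤ}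
    (hY : StrictMono Y) {n m : ℕ} (hn : 1 ≤ n) (hnm : n ≤ m) (hmN : m ≤ N)
    {x : ℕ → ℤ} (hx : StrictMonoOn x (Set.Icc n m)) :
    ∑ S₁ : Finset (Fin N) with #S₁ = n - 1, ∑ l : Fin (m - n) → Fin N,
      (if (∀ i ∈ S₁, Y i ≤ x n - 1) ∧ ∀ a, Y (l a) = x (n + a) then
        (labelPow τ m 0 (∑ i ∈ S₁ ∪ univ.image l, ((i : ℤ) + 1)) : ℝ) *
          ((if ∀ c, Y c ≤ x m - 1 → c ∈ S₁ ∪ univ.image l then (1 : ℂ) else 0) -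
            if ∀ c, Y c ≤ x m → c ∈ S₁ ∪ univ.image l then 1 else 0) else 0) =
      open Classical in
      if ∀ i : Fin N, n ≤ (i : ℕ) + 1 → (i : ℕ) + 1 ≤ m → Y i = x (i + 1) then 1 else 0 := by
  classical
  set G : Finset (Fin N) → (Fin (m - n) → Fin N) → ℂ := fun S₁ l =>
    (if (∀ i ∈ S₁, Y i ≤ x n - 1) ∧ ∀ a, Y (l a) = x (n + a) then
        (labelPow τ m 0 (∑ i ∈ S₁ ∪ univ.image l, ((i : ℤ) + 1)) : ℝ) *
          ((if ∀ c, Y c ≤ x m - 1 → c ∈ S₁ ∪ univ.image l then (1 : ℂ) else 0) -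
            if ∀ c, Y c ≤ x m → c ∈ S₁ ∪ univ.image l then 1 else 0) else 0) with hG
  have hne : ∀ S₁ l, #S₁ = n - 1 → G S₁ l ≠ 0 →
      S₁ = univ.filter (fun i : Fin N => (i : ℕ) + 1 < n) ∧ (∀ a, (l a : ℕ) = n - 1 + a) ∧
      ∀ i : Fin N, n ≤ (i : ℕ) + 1 → (i : ℕ) + 1 ≤ m → Y i = x (i + 1) := by
    intro S₁ l hS₁ h0
    simp only [hG] at h0
    split_ifs at h0 with h1 h2 h3 h3
    · simp at h0
    · exact eq_of_occupied hY hn hnm hx hS₁ h1.1 h1.2 h2 h3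
    · exact absurd (fun c hc => h3 c (by omega)) h2
    · simp at h0
    · simp at h0
  split_ifs with hev
  swap
  · refine Finset.sum_eq_zero fun S₁ hS₁ => Finset.sum_eq_zero fun l _ => ?_
    by_contra h
    exact hev (hne S₁ l (Finset.mem_filter.1 hS₁).2 h).2.2
  set T : Finset (Fin N) := univ.filter fun i : Fin N => (i : ℕ) + 1 < n with hT
  set L : Fin (m - n) → Fin N := fun a => ⟨n - 1 + a, by have := a.2; omega⟩ with hL
  have hLinj : Function.Injective L := fun a b hab => Fin.ext (by
    have := congrArg Fin.val hab
    simp only [hL] at this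
    omega)
  have hTI : T = Iio (⟨n - 1, by omega⟩ : Fin N) := by
    ext i
    simp only [hT, mem_filter, mem_univ, true_and, Finset.mem_Iio, Fin.lt_def]
    omega
  have hTcard : #T = n - 1 := by rw [hTI, Fin.card_Iio]
  rw [Finset.sum_eq_single_of_mem T (by simp [hTcard]), Finset.sum_eq_single_of_mem L (mem_univ _)]
  · set M : Fin N := ⟨m - 1, by omega⟩ with hM
    have hYM : Y M = x m := by
      rw [hev M (by simp only [hM]; omega) (by simp only [hM]; omega)]
      congr 1
      simp only [hM]; omega
    have hU : T ∪ univ.image L = Iio M := by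
      ext i
      simp only [hTI, Finset.mem_union, Finset.mem_Iio, Fin.lt_def, Finset.mem_image, mem_univ,
        true_and, hM, hL]
      constructor
      · rintro (h | ⟨a, rfl⟩)
        · omega
        · have := a.2
          simp only
          omega
      · intro h
        by_cases h' : (i : ℕ) < n - 1
        · exact Or.inl h'
        · exact Or.inr ⟨⟨i - (n - 1), by omega⟩, Fin.ext (by simp only; omega)⟩
    -- The labels `1, …, m - 1` sum to `m * (m - 1) / 2`, so the surviving power of `τ` has exponent
    -- zero.
    have hsum : ∑ i ∈ Iio M, ((i : ℤ) + 1) = ((m * (m - 1) / 2 : ℕ) : ℤ) := by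
      have h1 : ∑ i ∈ Iio M, ((i : ℤ) + 1) = ∑ i ∈ range (m - 1), ((i : ℤ) + 1) := by
        refine Finset.sum_bij (fun i _ => (i : ℕ)) (fun i hi => ?_) (fun i _ j _ h => Fin.ext h)
          (fun i hi => ?_) fun i _ => rfl
        · rw [Finset.mem_Iio, Fin.lt_def] at hi
          exact Finset.mem_range.2 hi
        · have := Finset.mem_range.1 hi
          exact ⟨⟨i, by omega⟩, by rw [Finset.mem_Iio, Fin.lt_def]; exact this, rfl⟩
      rw [h1]
      obtain ⟨m', rfl⟩ : ∃ m', m = m' + 1 := ⟨m - 1, by omega⟩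
      rw [← Finset.sum_range_id, Finset.sum_range_succ']
      push_cast [Nat.add_sub_cancel]
      simp
    have hYlt : ∀ c, Y c ≤ x m - 1 → c ∈ Iio M := fun c hc => by
      rw [Finset.mem_Iio]
      refine hY.lt_iff_lt.1 ?_
      omega
    have hnot : ¬ ∀ c, Y c ≤ x m → c ∈ Iio M := fun h => by
      have := h M hYM.le
      simp at this
    have hcond : (∀ i ∈ T, Y i ≤ x n - 1) ∧ ∀ a, Y (L a) = x (n + a) := by
      constructor
      · intro i hi
        have h1 : i < ⟨n - 1, by omega⟩ := by rw [hTI] at hi; exact Finset.mem_Iio.1 hi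
        have h2 := hY h1
        rw [hev ⟨n - 1, by omega⟩ (by simp only; omega) (by simp only; omega)] at h2
        simp only [Nat.sub_add_cancel hn] at h2
        omega
      · intro a
        have := a.2
        rw [hev (L a) (by simp only [hL]; omega) (by simp only [hL]; omega)]
        congr 1
        simp only [hL]; omega
    rw [if_pos hcond, hU, if_pos hYlt, if_neg hnot, hsum, labelPow]
    simp
  · intro l _ hl
    by_contra h
    refine hl (funext fun a => Fin.ext ?_)
    rw [(hne T l hTcard h).2.1 a]
  · intro S₁ hS₁ hST
    refine Finset.sum_eq_zero fun l _ => ?_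
    by_contra h
    exact hST (hne S₁ l (Finset.mem_filter.1 hS₁).2 h).1

/-! ### Time evolution -/

/-- The generator on complex valued functions. -/
def complexGenerator (p q : ℝ) (g : Config N → ℂ) (X : Config N) : ℂ :=
  ∑ i : Fin N, (p * (g (jump X i 1) - g X) + q * (g (jump X i (-1)) - g X))

theorem complexGenerator_sum (p q : ℝ) {ι : Type*} (s : Finset ι) (c : ι → ℂ)
    (g : ι → Config N → ℂ) (X : Config N) :
    complexGenerator p q (fun Z => ∑ k ∈ s, c k * g k Z) X =
      ∑ k ∈ s, c k * complexGenerator p q (g k) X := by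
  simp only [complexGenerator, Finset.mul_sum (s := univ)]
  rw [Finset.sum_comm]
  refine Finset.sum_congr rfl fun i _ => ?_
  rw [← Finset.sum_sub_distrib, ← Finset.sum_sub_distrib, Finset.mul_sum, Finset.mul_sum,
    ← Finset.sum_add_distrib]
  exact Finset.sum_congr rfl fun k _ => by ring

/-- On configurations, the superpositions of plane waves are evolved by the generator. -/
theorem complexGenerator_bethe {p q R : ℝ} (hpq : p + q = 1) (hR : IsLargeRadius p q R)
    {w : (Fin r → Fin N) → ℂ} (hw : IsBalanced p q w) {Ψ : (Fin r → ℂ) → ℂ}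
    (hΨ : ContinuousOn Ψ (torus (Fin r) R)) (X : Config N) :
    complexGenerator p q (fun Z => bethe p q R w Z.1 Ψ) X =
      bethe p q R w X.1 (fun ζ => Ψ ζ * ∑ a, ε p q (ζ a)) := by
  classical
  set B : (Fin N → ℤ) → ℂ := fun Z => bethe p q R w Z Ψ with hB
  have hpc : (p : ℂ) + q = 1 := by exact_mod_cast hpq
  have hjump : ∀ (i : Fin N) (d : ℤˣ), B (jump X i d).1 - B X.1 =
      B (Function.update X.1 i (X.1 i + d)) - B X.1 -
        if ∃ j, X.1 j = X.1 i + d then B (Function.update X.1 i (X.1 i + d)) - B X.1 else 0 := by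
    intro i d
    by_cases h : ∃ j, X.1 j = X.1 i + d
    · rw [if_pos h, jump, dif_neg (by simpa using h)]; ring
    · rw [if_neg h, jump, dif_pos (by simpa using h)]; ring
  -- The blocked moves, which `jump` suppresses but the free generator performs, cancel in pairs by
  -- the boundary condition.
  have hblock := sum_blocked_eq_zero X.2
    (fun i => p * (B (Function.update X.1 i (X.1 i + 1)) - B X.1))
    (fun i => q * (B (Function.update X.1 i (X.1 i + -1)) - B X.1)) fun u v huv hX => by
      have h := bethe_boundary hpq hR hw huv X.1 hX hΨ
      simp only [hB]
      linear_combination h - bethe p q R w X.1 Ψ * hpc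
  have h1 := bethe_free_generator hpq hR w X.1 hΨ
  rw [← h1, complexGenerator, ← sub_eq_zero, ← Finset.sum_sub_distrib, ← neg_eq_zero, ← hblock,
    ← Finset.sum_add_distrib, ← Finset.sum_neg_distrib]
  refine Finset.sum_congr rfl fun i _ => ?_
  have h2 := hjump i 1
  have h3 := hjump i (-1)
  simp only [hB, Units.val_one, Units.val_neg] at h2 h3 ⊢
  rw [h2, h3]
  split_ifs <;> linear_combination bethe p q R w X.1 Ψ * hpc

/-- If the generator, shifted by the total rate, maps each function of a sequence to the next one,
then the sequence consists of the expectations after the successive rings. -/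
theorem integral_chainLaw_of_generator {p q : ℝ} (hp : 0 ≤ p) (hq : 0 ≤ q) (hpq : p + q = 1)
    [NeZero N] (h : Config N → ℝ) {C : ℝ} (hC : ∀ X, |h X| ≤ C) (u : ℕ → Config N → ℂ)
    (hu₀ : ∀ X, u 0 X = h X)
    (hu : ∀ k X, complexGenerator p q (u k) X + N * u k X = u (k + 1) X) (Y : Config N) (k : ℕ) :
    (N : ℂ) ^ k * (∫ X, h X ∂(chainLaw p q Y k) : ℝ) = u k Y := by
  have hN : (N : ℝ) ≠ 0 := by exact_mod_cast NeZero.ne N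
  -- The real iterates of `N` times the expectation after one ring. This operator is the generator
  -- plus `N`, so the iterates coincide with the `u k`.
  let g : ℕ → Config N → ℝ := fun k =>
    Nat.rec (motive := fun _ => Config N → ℝ) h (fun _ g X => N * ∫ Z, g Z ∂(ringLaw p q X)) k
  have hg : ∀ k X, g (k + 1) X = N * ∫ Z, g k Z ∂(ringLaw p q X) := fun k X => rfl
  have hug : ∀ k X, u k X = ((g k X : ℝ) : ℂ) := by
    intro k
    induction k with
    | zero => exact hu₀
    | succ k ih =>
      intro X
      have h1 := integral_ringLaw hp hq hpq (g k) X
      rw [← hu, hg, show (N : ℝ) * ∫ Z, g k Z ∂(ringLaw p q X) =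
        generator p q (g k) X + N * g k X by rw [← h1]; ring, complexGenerator, generator]
      push_cast
      simp only [ih]
  have hbound : ∀ k, ∃ D, ∀ X, |g k X| ≤ D := by
    intro k
    induction k with
    | zero => exact ⟨C, hC⟩
    | succ k ih =>
      obtain ⟨D, hD⟩ := ih
      refine ⟨N * D, fun X => ?_⟩
      have := isProb_ringLaw hp hq hpq X
      have h1 : |∫ Z, g k Z ∂(ringLaw p q X)| ≤ D := by
        simpa using norm_integral_le_of_norm_le_const (μ := ringLaw p q X) (f := g k)
          (C := D) (Filter.Eventually.of_forall hD)
      rw [hg, abs_mul, Nat.abs_cast]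
      gcongr
  have hmain : ∀ k j, (N : ℝ) ^ k * ∫ X, g j X ∂(chainLaw p q Y k) = g (j + k) Y := by
    intro k
    induction k with
    | zero => intro j; simp [chainLaw]
    | succ k ih =>
      intro j
      obtain ⟨D, hD⟩ := hbound j
      have := isProb_chainLaw hp hq hpq Y k
      rw [chainLaw, integral_bind_of_bounded _ _ (isProb_ringLaw hp hq hpq) (g j) D hD, pow_succ,
        mul_assoc, ← integral_const_mul]
      have h1 := ih (j + 1)
      simp only [hg] at h1
      rw [h1, add_right_comm, add_assoc]
  have h1 := hmain k 0
  rw [zero_add] at h1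
  rw [hug, ← h1]
  push_cast
  rfl

/-- The exponential series is integrated term by term; on the compact torus the wave and `S` are
bounded, which gives a summable dominating series. -/
theorem hasSum_bethe {p q R : ℝ} (hR : IsLargeRadius p q R) (w : (Fin r → Fin N) → ℂ)
    (Y : Fin N → ℤ) {Φ S : (Fin r → ℂ) → ℂ} (hΦ : ContinuousOn Φ (torus (Fin r) R))
    (hS : ContinuousOn S (torus (Fin r) R)) (t : ℝ) :
    HasSum (fun k : ℕ => bethe p q R w Y (fun ζ => Φ ζ * S ζ ^ k) * ((t : ℂ) ^ k / k.factorial))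
      (bethe p q R w Y fun ζ => Φ ζ * Complex.exp (S ζ * t)) := by
  have hR0 : 0 ≤ R := by linarith [hR.1]
  obtain ⟨C, hC⟩ := (isCompact_torus (Fin r) R).exists_bound_of_continuousOn hS
  simp only [bethe, Finset.sum_mul]
  refine hasSum_sum fun e _ => ?_
  simp only [mul_assoc]
  refine HasSum.mul_left _ ?_
  simp only [← integral_mul_const]
  obtain ⟨M, hM⟩ := (isCompact_torus (Fin N) R).exists_bound_of_continuousOn
    (continuousOn_wave hR e Y hΦ)
  have hsplit : ∀ (H : (Fin r → ℂ) → ℂ) ξ, wave p q e Y (fun ζ => Φ ζ * H ζ) ξ =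
      wave p q e Y Φ ξ * H (ξ ∘ e) := fun H ξ => by simp only [wave]; ring
  have hbs : Summable fun k : ℕ => M * ((|C| * |t|) ^ k / k.factorial) :=
    (Real.summable_pow_div_factorial _).mul_left M
  refine hasSum_integral_of_dominated_convergence
    (fun k _ => M * ((|C| * |t|) ^ k / k.factorial)) (fun k => ?_) (fun k => ?_)
    (Filter.Eventually.of_forall fun _ => hbs) (integrable_const _) ?_
  · exact ((integrable_wave hR e Y (hΦ.mul (hS.pow k))).mul_const _).aestronglyMeasurable
  · filter_upwards [ae_mem_torus hR0] with ξ hξ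
    have h1 := hM ξ hξ
    have h2 := (hC _ (comp_mem_torus hξ e)).trans (le_abs_self C)
    rw [hsplit (fun ζ => S ζ ^ k), norm_mul, norm_mul, norm_div, norm_pow, norm_pow,
      Complex.norm_real, Complex.norm_natCast, Real.norm_eq_abs, mul_pow, mul_assoc, mul_div_assoc]
    have : 0 ≤ M := (norm_nonneg _).trans h1
    gcongr
  · refine Filter.Eventually.of_forall fun ξ => ?_
    have h1 : HasSum (fun k : ℕ => (S (ξ ∘ e) * t) ^ k / (k.factorial : ℂ))
        (Complex.exp (S (ξ ∘ e) * t)) := by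
      rw [Complex.exp_eq_exp_ℂ]
      exact NormedSpace.expSeries_div_hasSum_exp _
    rw [hsplit fun ζ => Complex.exp (S ζ * t)]
    refine (h1.mul_left (wave p q e Y Φ ξ)).congr_fun fun k => ?_
    rw [hsplit fun ζ => S ζ ^ k, mul_pow]
    ring

/-- The expectation of a function whose iterated images under the generator are superpositions of
plane waves. -/
theorem integral_law_eq {p q : ℝ} (hp : 0 ≤ p) (hq : 0 ≤ q) (hpq : p + q = 1)
    [NeZero N] (h : Config N → ℝ) {C : ℝ} (hC : ∀ X, |h X| ≤ C) (u : ℕ → Config N → ℂ)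
    (hu₀ : ∀ X, u 0 X = h X)
    (hu : ∀ k X, complexGenerator p q (u k) X + N * u k X = u (k + 1) X) (Y : Config N)
    (t : ℝ≥0) {v : ℂ} (hv : HasSum (fun k : ℕ => u k Y * ((t : ℝ) ^ k / k.factorial)) v) :
    ((∫ X, h X ∂(law p q Y t) : ℝ) : ℂ) = Complex.exp (-(N * (t : ℝ))) * v := by
  rw [integral_law hp hq hpq Y h C hC t, ← hv.tsum_eq]
  push_cast
  congr 1
  refine tsum_congr fun k => ?_
  rw [← integral_chainLaw_of_generator hp hq hpq h hC u hu₀ hu Y k]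
  ring

/-- The part of the density at time zero. -/
def initialDensity (n m k : ℕ) (x : ℕ → ℤ) (ζ : Fin (n - 1 + (m - n) + k) → ℂ) : ℂ :=
  slotDensity (n - 1) (m - n) k (x n - 1) (fun a => x (n + a)) (x m) ζ -
    slotDensity (n - 1) (m - n) k (x n - 1) (fun a => x (n + a)) (x m - 1) ζ

theorem continuousOn_initialDensity {R : ℝ} (hR : 1 < R) (n m k : ℕ) (x : ℕ → ℤ) :
    ContinuousOn (initialDensity n m k x) (torus _ R) :=
  (continuousOn_slotDensity hR _ _ _ _ _ _).sub (continuousOn_slotDensity hR _ _ _ _ _ _)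

/-- Each superposition is a difference of two slot counts by `bethe_slot`, and the alternating sums
of these are evaluated by `sum_slotSum` and `sum_occupied`. -/
theorem sum_bethe_initialDensity {p q R : ℝ} (hp : 0 ≤ p) (hq : 0 < q) (hpq : p + q = 1)
    (hR : IsLargeRadius p q R) {Y : Fin N → ℤ} (hY : StrictMono Y) {n m : ℕ} (hn : 1 ≤ n)
    (hnm : n ≤ m) (hmN : m ≤ N) {x : ℕ → ℤ} (hx : StrictMonoOn x (Set.Icc n m)) :
    ∑ k ∈ range (N + 1), -(-1) ^ k /
        (tauFactorial (p / q : ℂ) (n - 1) * tauFactorial (p / q : ℂ) k) *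
        bethe p q R (fun e => ((labelPow (p / q) m k (labelSum e) : ℝ) : ℂ)) Y
          (initialDensity n m k x) =
      open Classical in
      if ∀ i : Fin N, n ≤ (i : ℕ) + 1 → (i : ℕ) + 1 ≤ m → Y i = x (i + 1) then 1 else 0 := by
  have hτ : ((p / q : ℝ) : ℂ) = p / q := by push_cast; rfl
  have hbethe : ∀ k, bethe p q R (fun e => ((labelPow (p / q) m k (labelSum e) : ℝ) : ℂ)) Y
      (initialDensity n m k x) =
      slotSum ((p / q : ℝ) : ℂ) (fun e => ((labelPow (p / q) m k (labelSum e) : ℝ) : ℂ)) Y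
        (slotSet (n - 1) (m - n) k)
        (slotBound (n - 1) (m - n) k (x n - 1) (fun a => x (n + a)) (x m)) -
      slotSum ((p / q : ℝ) : ℂ) (fun e => ((labelPow (p / q) m k (labelSum e) : ℝ) : ℂ)) Y
        (slotSet (n - 1) (m - n) k)
        (slotBound (n - 1) (m - n) k (x n - 1) (fun a => x (n + a)) (x m - 1)) := by
    intro k
    have hw : ∀ (e : Fin (n - 1 + (m - n) + k) → Fin N) (s : Equiv.Perm _),
        ((labelPow (p / q) m k (labelSum (e ∘ s)) : ℝ) : ℂ) =
        ((labelPow (p / q) m k (labelSum e) : ℝ) : ℂ) := fun e s => by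
      rw [labelSum_comp_perm]
    rw [hτ, ← bethe_slot hp hq hpq hR hw hY _ _
      (isSlotOrdered_slotBound hnm hx (by omega : x m - 1 ≤ x m)),
      ← bethe_slot hp hq hpq hR hw hY _ _ (isSlotOrdered_slotBound hnm hx le_rfl),
      eq_sub_iff_add_eq, ← bethe_add hR _ _ (continuousOn_initialDensity hR.1 n m k x)
      (continuousOn_slotFn hR.1 _ _)]
    refine bethe_congr hR.1 _ _ fun ζ _ => ?_
    rw [initialDensity, slotDensity, slotDensity, sub_add_cancel]
  simp_rw [hbethe, mul_sub, Finset.sum_sub_distrib]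
  have hτ' : ∀ k, tauFactorial ((p / q : ℝ) : ℂ) k ≠ 0 := fun k => by
    rw [hτ]; exact tauFactorial_ne_zero hp hq k
  rw [← hτ, sum_slotSum (p / q) hτ' hY hn hnm hx, sum_slotSum (p / q) hτ' hY hn hnm hx,
    ← sum_occupied (p / q) hY hn hnm hmN hx, ← Finset.sum_sub_distrib]
  refine Finset.sum_congr rfl fun S₁ _ => ?_
  rw [← Finset.sum_sub_distrib]
  refine Finset.sum_congr rfl fun l _ => ?_
  by_cases hc : (∀ i ∈ S₁, Y i ≤ x n - 1) ∧ ∀ a, Y (l a) = x (n + a)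
  · rw [if_pos hc, if_pos hc, if_pos hc]; ring
  · rw [if_neg hc, if_neg hc, if_neg hc]; ring

end ASEP

end

/-! ### The integral formula -/

theorem theorem3 (p q : ℝ) (hp : 0 ≤ p) (hq : 0 ≤ q) (hpq : p + q = 1) (hq0 : q ≠ 0)
    (N n m : ℕ) (hn : 1 ≤ n) (hnm : n ≤ m) (hmN : m ≤ N)
    (Y : ASEP.Config N) (x : ℕ → ℤ) (hx : StrictMonoOn x (Set.Icc n m)) (t : ℝ≥0)
    (R : ℝ) (hR : ASEP.IsLargeRadius p q R) :
    (((ASEP.law p q Y t).real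
        {X | ∀ i : Fin N, n ≤ (i : ℕ) + 1 → (i : ℕ) + 1 ≤ m → X.1 i = x (i + 1)} : ℝ) : ℂ) =
      ∑ S : Finset (Fin N), ∑ S₁ : Finset (Fin N) with Disjoint S S₁ ∧ #S₁ = n - 1,
        ∑ l : Fin (m - n) ↪ Fin N with Disjoint (S ∪ S₁) (univ.map l),
          (ASEP.coefficient p q n m S S₁ l : ℂ) *
            ASEP.contourIntegral (ASEP.indices S S₁ l) R
              (ASEP.integrand p q Y n m x t S S₁ l) := by
  classical
  have hq' : 0 < q := lt_of_le_of_ne hq hq0.symm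
  have : NeZero N := ⟨by omega⟩
  rw [ASEP.sum_coefficient_mul_contourIntegral hp hq' hpq hR Y n m x t]
  set E : Set (ASEP.Config N) :=
    {X | ∀ i : Fin N, n ≤ (i : ℕ) + 1 → (i : ℕ) + 1 ≤ m → X.1 i = x (i + 1)} with hE
  set h : ASEP.Config N → ℝ := E.indicator 1 with hh
  have hlaw : (ASEP.law p q Y t).real E = ∫ X, h X ∂(ASEP.law p q Y t) :=
    (integral_indicator_one (MeasurableSet.of_discrete)).symm
  have hbound : ∀ X, |h X| ≤ 1 := fun X => by
    simp only [hh, Set.indicator_apply]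
    split_ifs <;> simp
  set c : ℕ → ℂ := fun k => -(-1) ^ k /
    (ASEP.tauFactorial (p / q : ℂ) (n - 1) * ASEP.tauFactorial (p / q : ℂ) k) with hc
  -- The shift by the total rate `N` makes multiplication by `S k` correspond to the generator plus
  -- `N`, the operator of one ring.
  set S : ∀ k : ℕ, (Fin (n - 1 + (m - n) + k) → ℂ) → ℂ := fun k ζ =>
    N + ∑ a, ASEP.ε p q (ζ a) with hS
  have hSc : ∀ k, ContinuousOn (S k) (ASEP.torus _ R) := fun k =>
    continuousOn_const.add (continuousOn_finsetSum _ fun _ _ => ASEP.continuousOn_ε hR.1 p q _)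
  have hΦ := fun k => ASEP.continuousOn_initialDensity hR.1 n m k x
  set B : ℕ → ℕ → ASEP.Config N → ℂ := fun j k X => ASEP.bethe p q R
    (fun e => ((ASEP.labelPow (p / q) m k (ASEP.labelSum e) : ℝ) : ℂ)) X.1
    (fun ζ => ASEP.initialDensity n m k x ζ * S k ζ ^ j) with hB
  have hstep : ∀ j k X, ASEP.complexGenerator p q (B j k) X + N * B j k X = B (j + 1) k X := by
    intro j k X
    have hcont : ContinuousOn (fun ζ => ASEP.initialDensity n m k x ζ * S k ζ ^ j)
        (ASEP.torus _ R) := (hΦ k).mul ((hSc k).pow j)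
    have h1 := ASEP.complexGenerator_bethe hpq hR
      (ASEP.isBalanced_labelPow (N := N) (p := p) hq' (m := m) (k := k)
        (r := n - 1 + (m - n) + k) (by omega)) hcont X
    simp only [hB]
    rw [h1, ← ASEP.bethe_const_mul, ← ASEP.bethe_add hR]
    · refine ASEP.bethe_congr hR.1 _ _ fun ζ _ => ?_
      simp only [hS, pow_succ]
      ring
    · exact hcont.mul (continuousOn_finsetSum _ fun _ _ => ASEP.continuousOn_ε hR.1 p q _)
    · exact continuousOn_const.mul hcont
  have hstart : ∀ X, ∑ k ∈ range (N + 1), c k * B 0 k X = ((h X : ℝ) : ℂ) := fun X => by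
    have h1 := ASEP.sum_bethe_initialDensity hp hq' hpq hR X.2 hn hnm hmN hx
    simp only [hB, pow_zero, mul_one, hc]
    rw [h1]
    simp only [hh, Set.indicator_apply, hE, Set.mem_ofPred_eq, Pi.one_apply]
    split_ifs <;> simp
  have hgen : ∀ j X, ASEP.complexGenerator p q (fun X => ∑ k ∈ range (N + 1), c k * B j k X) X +
      N * ∑ k ∈ range (N + 1), c k * B j k X = ∑ k ∈ range (N + 1), c k * B (j + 1) k X :=
    fun j X => by
      rw [ASEP.complexGenerator_sum, Finset.mul_sum, ← Finset.sum_add_distrib]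
      refine Finset.sum_congr rfl fun k _ => ?_
      rw [← hstep]
      ring
  have hseries : HasSum (fun j : ℕ => (∑ k ∈ range (N + 1), c k * B j k Y) *
      (((t : ℝ) : ℂ) ^ j / j.factorial)) (∑ k ∈ range (N + 1), c k * ASEP.bethe p q R
      (fun e => ((ASEP.labelPow (p / q) m k (ASEP.labelSum e) : ℝ) : ℂ)) Y.1
      (fun ζ => ASEP.initialDensity n m k x ζ * Complex.exp (S k ζ * (t : ℝ)))) := by
    simp only [Finset.sum_mul]
    refine hasSum_sum fun k _ => ?_
    simp only [mul_assoc]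
    exact (ASEP.hasSum_bethe hR _ Y.1 (hΦ k) (hSc k) t).mul_left (c k)
  rw [hlaw, ASEP.integral_law_eq hp hq hpq h hbound
    (fun j X => ∑ k ∈ range (N + 1), c k * B j k X) hstart hgen Y t hseries, Finset.mul_sum]
  refine Finset.sum_congr rfl fun k _ => ?_
  rw [mul_left_comm, ← ASEP.bethe_const_mul]
  congr 1
  -- The factor `exp (-(N * t))` of the Poisson law cancels the shift by `N` in the exponent.
  refine ASEP.bethe_congr hR.1 _ _ fun ζ _ => ?_
  rw [mul_left_comm, ← Complex.exp_add]
  simp only [ASEP.evolvedDensity, ASEP.initialDensity, hS]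
  congr 2
  ring
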